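/- Let $k$ be an algebraically closed field, $Q$ a finite connected quiver with at least one arrow, and $I$ an admissible ideal of $kQ$ such that $(Q,I)$ is gentle: at most two arrows start and at most two arrows end at each vertex; for each arrow $\alpha$ there is at most one arrow $\beta$ with $\alpha\beta\notin I$ and at most one arrow $\gamma$ with $\gamma\alpha\notin I$; $I$ is generated by paths of length two; and for each arrow $\alpha$ there is at most one arrow $\delta$ composable with $\alpha$ such that $\alpha\delta\in I$ and at most one arrow $\varepsilon$ composable with $\alpha$ such that $\varepsilon\alpha\in I$. (Paths are composed from left to right.) Let $A=kQ/I$ and let $T(A)=A\ltimes D(A)$, $D(A)=\operatorname{Hom}_k(A,k)$, with $(a,f)(b,g)=(ab,ag+fb)$. A path $p\notin I$ is maximal if $\alpha p\in I$ and $p\alpha\in I$ for all arrows $\alpha$. Let $\mathcal M$ be the set of maximal paths, and let $\overline{\mathcal M}$ consist of $\mathcal M$ and the trivial paths $e_i$ at those vertices $i$ that are a sink at which a single arrow ends, or a source at which a single arrow starts, or at which a single arrow $\alpha$ ends and a single arrow $\beta$ starts and $\alpha\beta\notin I$. Let $\Gamma_A$ be the graph with vertices $\nu(m)$, $m\in\overline{\mathcal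 M}$, and edges $E_i$, $i\in Q_0$. If $m\in\overline{\mathcal M}$ passes successively through the vertices $i_1,\dots,i_{n+1}$ of $Q$, then the half-edges at $\nu(m)$ are the positions $1,\dots,n+1$ in this cyclic order, and the half-edge at position $j$ is an end of $E_{i_j}$. All multiplicities are one. For a Brauer graph $\Gamma$ with multiplicities $e(\nu)$, the Brauer graph algebra of $\Gamma$ is the following bound quiver algebra. The vertices of its quiver are the edges of $\Gamma$. Each half-edge $h$, except one at a vertex of valency one and multiplicity one (call such an $h$ truncated), gives an arrow $\alpha_h$ from the edge of $h$ to the edge of the successor of $h$. For a non-truncated half-edge $h$ at $\nu$, let $C_h$ be the cycle that starts with $\alpha_h$ and goes once around $\nu$. The relations are $C_h^{e(\nu)}-C_{h'}^{e(\nu')}$ if $h$ at $\nu$ and $h'$ at $\nu'$ are the two ends of one edge and neither is truncated; $C_h^{e(\nu)}\alpha_h$ if $h$ at $\nu$ is not truncated but the other end of its edge is; and $\alpha_h\alpha_{h'}$ if $h,h'$ are not truncated and the successor of $h$ and $h'$ are the two distinct ends of one edge. Let $\Lambda=kQ'/I'$, with $Q'$ finite and $I'$ admissible, be a symmetric special biserial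 algebra (that is, $(Q',I')$ satisfies the first two of the conditions on $(Q,I)$ above) whose ideal $I'$ is generated by paths and by differences $p-q$ of parallel paths $p,q\notin I'$. Its graph $G_\Lambda$ has as edges the vertices of $Q'$. Its vertices are the rotation classes $\nu(p)$ of maximal cyclic paths $p$, that is, of the non-trivial closed maximal paths of $(Q',I')$ and of the trivial paths $e_i$ for which the projective module $e_i\Lambda$ is uniserial. If $p$ is non-trivial and $p=p_0^{m}$ with $p_0$ not a proper power, then the half-edges at $\nu(p)$ are the starting points of the arrows of $p_0$, each labelled by the vertex of $Q'$ at this point, in the cyclic order given by $p_0$, and the multiplicity of $\nu(p)$ is $m$. If $p=e_i$, there is one half-edge, labelled $i$, and the multiplicity is one. Then the following hold. 1. $\Gamma_A$ is a Brauer graph: it is finite and connected, and each of its edges has exactly two ends. 2. $T(A)$ is isomorphic, as a $k$-algebra, to the Brauer graph algebra of $\Gamma_A$ (with multiplicity one at every vertex). 3. Let $Q_E$ be the quiver obtained from $Q$ by adding, for each $m\in\mathcal M$, an arrow $\beta_m$ from the end of $m$ to the start of $m$. Let $\varphi\colon kQ_E\to T(A)$ be given by $e_i\mapsto(e_i,0)$,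 $\alpha\mapsto(\alpha,0)$ for arrows $\alpha$ of $Q$, and $\beta_m\mapsto(0,m^*)$, where $m^*\in D(A)$ is one on $m$ and zero on all other paths. Then $\varphi$ is a well-defined surjective algebra homomorphism, it presents $T(A)\cong kQ_E/\ker\varphi$ as a symmetric special biserial algebra as above (in particular $\ker\varphi$ is admissible and generated by paths and differences of parallel paths), and the graph $G_{T(A)}$ of this presentation is $\Gamma_A$: there is an isomorphism $\Gamma_A\cong G_{T(A)}$ that is the identity on the edges (the vertices of $Q$) and respects the cyclic orderings and the multiplicities. -/

import Mathlib

universe u v w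

noncomputable section

namespace Gentle

open Quiver MulOpposite

/-! ### Path algebras and bound quiver algebras -/

/-- All paths of a quiver, with their start and end vertices; `Path.nil` is the trivial path. Paths
are composed from left to right. -/
abbrev QPath (V : Type u) [Quiver.{v} V] : Type (max u v) := Σ i j : V, Path i j

/-- The underlying vector space of the path algebra `kQ`: its basis is the set of all paths. -/
def PathAlgebra (k : Type w) (V : Type u) [Field k] [Quiver.{v} V] : Type (max u v w) :=
  QPath V →₀ k

namespace PathAlgebra

section

variable (k : Type w) {V : Type u} [Field k] [Quiver.{v} V]

instance : AddCommGroup (PathAlgebra k V) := inferInstanceAs (AddCommGroup (QPath V →₀ k))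

instance : Module k (PathAlgebra k V) := inferInstanceAs (Module k (QPath V →₀ k))

/-- The basis of the path algebra given by the paths. -/
def basis : Module.Basis (QPath V) k (PathAlgebra k V) :=
  Module.Basis.ofRepr (LinearEquiv.refl k (QPath V →₀ k))

/-- A path as a basis element of the path algebra. -/
def path {i j : V} (p : Path i j) : PathAlgebra k V := basis k ⟨i, j, p⟩

/-- An arrow as an element of the path algebra. -/
def arrow {i j : V} (α : i ⟶ j) : PathAlgebra k V := path k α.toPath

/-- The product of two paths: their concatenation when they can be composed, `0` otherwise. -/
def mulPath : QPath V → QPath V → PathAlgebra k V := by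
  classical
  exact fun x y => if h : x.2.1 = y.1 then path k (x.2.2.comp (y.2.2.cast h.symm rfl)) else 0

/-- The bilinear extension of the concatenation of paths. -/
def mulBilin : PathAlgebra k V →ₗ[k] PathAlgebra k V →ₗ[k] PathAlgebra k V :=
  (basis k).constr k fun x => (basis k).constr k fun y => mulPath k x y

instance : Mul (PathAlgebra k V) := ⟨fun x y => mulBilin k x y⟩

theorem mul_def (x y : PathAlgebra k V) : x * y = mulBilin k x y := rfl

/-- Properties that are stable under linear combinations can be checked on paths. -/
theorem induction_path {P : PathAlgebra k V → Prop} (x : PathAlgebra k V)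
    (hp : ∀ (i j : V) (p : Path i j), P (path k p)) (h0 : P 0)
    (ha : ∀ x y, P x → P y → P (x + y)) (hs : ∀ (c : k) x, P x → P (c • x)) : P x := by
  have hx : x ∈ Submodule.span k (Set.range (basis k (V := V))) := (basis k).mem_span x
  induction hx using Submodule.span_induction with
  | mem x hx => obtain ⟨y, rfl⟩ := hx; exact hp _ _ _
  | zero => exact h0
  | add x y _ _ h h' => exact ha x y h h'
  | smul c x _ h => exact hs c x h

theorem path_mul (x y : QPath V) : path k x.2.2 * path k y.2.2 = mulPath k x y := by
  change mulBilin k (basis k x) (basis k y) = _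
  rw [mulBilin, Module.Basis.constr_basis, Module.Basis.constr_basis]

theorem path_mul_path {i j l : V} (p : Path i j) (q : Path j l) :
    path k p * path k q = path k (p.comp q) := by
  refine (path_mul k ⟨i, j, p⟩ ⟨j, l, q⟩).trans ?_
  simp [mulPath]

theorem path_mul_path_of_ne {i j j' l : V} (p : Path i j) (q : Path j' l) (h : j ≠ j') :
    path k p * path k q = 0 := by
  refine (path_mul k ⟨i, j, p⟩ ⟨j', l, q⟩).trans ?_
  simp [mulPath, h]

theorem mul_assoc_path {i j i' j' i'' j'' : V} (p : Path i j) (q : Path i' j') (r : Path i'' j'') :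
    path k p * path k q * path k r = path k p * (path k q * path k r) := by
  by_cases h : j = i'
  · subst h
    by_cases h' : j' = i''
    · subst h'
      simp only [path_mul_path, Path.comp_assoc]
    · rw [path_mul_path, path_mul_path_of_ne k _ _ h', path_mul_path_of_ne k _ _ h',
        mul_def, map_zero]
  · by_cases h' : j' = i''
    · subst h'
      rw [path_mul_path_of_ne k _ _ h, path_mul_path, path_mul_path_of_ne k _ _ h, mul_def,
        map_zero, LinearMap.zero_apply]
    · rw [path_mul_path_of_ne k _ _ h, path_mul_path_of_ne k _ _ h', mul_def, mul_def, map_zero,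
        map_zero, LinearMap.zero_apply]

instance : NonUnitalRing (PathAlgebra k V) where
  left_distrib x y z := by simp only [mul_def, map_add]
  right_distrib x y z := by simp only [mul_def, map_add, LinearMap.add_apply]
  zero_mul x := by simp only [mul_def, map_zero, LinearMap.zero_apply]
  mul_zero x := by simp only [mul_def, map_zero]
  mul_assoc x y z := by
    refine induction_path k (P := fun x => x * y * z = x * (y * z)) x (fun i j p => ?_) ?_
      (fun _ _ h h' => ?_) (fun c _ h => ?_)
    · refine induction_path k (P := fun y => path k p * y * z = path k p * (y * z)) y
        (fun i' j' q => ?_) ?_ (fun _ _ h h' => ?_) (fun c _ h => ?_)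
      · refine induction_path k (P := fun z => path k p * path k q * z = path k p * (path k q * z)) z
          (fun i'' j'' r => mul_assoc_path k p q r) ?_ (fun _ _ h h' => ?_) (fun c _ h => ?_)
        all_goals simp_all only [mul_def, map_add, map_zero, map_smul]
      all_goals simp_all only [mul_def, map_add, map_zero, map_smul, LinearMap.add_apply,
        LinearMap.zero_apply, LinearMap.smul_apply]
    all_goals simp_all only [mul_def, map_add, map_zero, map_smul, LinearMap.add_apply,
        LinearMap.zero_apply, LinearMap.smul_apply]

variable [Fintype V]

/-- The unit of the path algebra of a quiver with finitely many vertices: the sum of all trivial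
paths. -/
instance : One (PathAlgebra k V) := ⟨∑ i : V, path k (Path.nil : Path i i)⟩

theorem one_def : (1 : PathAlgebra k V) = ∑ i : V, path k (Path.nil : Path i i) := rfl

instance : Ring (PathAlgebra k V) where
  __ := (inferInstance : NonUnitalRing (PathAlgebra k V))
  one_mul x := by
    refine induction_path k (P := fun x => 1 * x = x) x (fun i j p => ?_) (mul_zero _)
      (fun _ _ h h' => ?_) (fun c _ h => ?_)
    · rw [one_def, Finset.sum_mul, Finset.sum_eq_single i
        (fun l _ hl => path_mul_path_of_ne k _ _ hl) (fun h => absurd (Finset.mem_univ i) h),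
        path_mul_path, Path.nil_comp]
    · rw [mul_add, h, h']
    · rw [mul_def, map_smul, ← mul_def, h]
  mul_one x := by
    refine induction_path k (P := fun x => x * 1 = x) x (fun i j p => ?_) (zero_mul _)
      (fun _ _ h h' => ?_) (fun c _ h => ?_)
    · rw [one_def, Finset.mul_sum, Finset.sum_eq_single j
        (fun l _ hl => path_mul_path_of_ne k _ _ hl.symm) (fun h => absurd (Finset.mem_univ j) h),
        path_mul_path, Path.comp_nil]
    · rw [add_mul, h, h']
    · rw [mul_def, map_smul, LinearMap.smul_apply, ← mul_def, h]

instance : Algebra k (PathAlgebra k V) :=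
  Algebra.ofModule
    (fun c x y => by simp only [mul_def, map_smul, LinearMap.smul_apply])
    (fun c x y => by simp only [mul_def, map_smul])

end

end PathAlgebra

open PathAlgebra

section BoundQuiver

variable {k : Type w} {V : Type u} [Field k] [Quiver.{v} V] [Fintype V]

/-- The bound quiver algebra `kQ/I`. -/
abbrev BoundQuiverAlgebra (I : TwoSidedIdeal (PathAlgebra k V)) : Type (max u v w) :=
  I.ringCon.Quotient

/-- The quotient map `kQ → kQ/I`. -/
abbrev toBound (I : TwoSidedIdeal (PathAlgebra k V)) : PathAlgebra k V →ₐ[k] BoundQuiverAlgebra I :=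
  I.ringCon.mkₐ (α := k)

/-- An ideal `I` of `kQ` is admissible if `Rᴺ ⊆ I ⊆ R²` for some `N`, where `R` is the ideal
generated by the arrows: `Rⁿ` is spanned by the paths of length at least `n`. -/
structure IsAdmissible (I : TwoSidedIdeal (PathAlgebra k V)) : Prop where
  pow_le : ∃ N : ℕ, ∀ (i j : V) (p : Path i j), N ≤ p.length → path k p ∈ I
  le_sq : ∀ x ∈ I, ∀ (i j : V) (p : Path i j), (basis k).repr x ⟨i, j, p⟩ ≠ 0 → 2 ≤ p.length

/-- A bound quiver `(Q, I)` with admissible `I` that satisfies the special biserial conditions. -/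
structure IsSpecialBiserial (I : TwoSidedIdeal (PathAlgebra k V)) : Prop where
  admissible : IsAdmissible I
  /-- at most two arrows start at every vertex -/
  card_star_le : ∀ i : V, ENat.card (Star i) ≤ 2
  /-- at most two arrows end at every vertex -/
  card_costar_le : ∀ i : V, ENat.card (Costar i) ≤ 2
  /-- for every arrow `α` there is at most one arrow `β` with `αβ ∉ I` -/
  mul_right_unique : ∀ (i j : V) (α : i ⟶ j),
    {β : Star j | arrow k α * arrow k β.2 ∉ I}.Subsingleton
  /-- for every arrow `α` there is at most one arrow `γ` with `γα ∉ I` -/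
  mul_left_unique : ∀ (i j : V) (α : i ⟶ j),
    {γ : Costar i | arrow k γ.2 * arrow k α ∉ I}.Subsingleton

/-- A gentle bound quiver `(Q, I)`. -/
structure IsGentle (I : TwoSidedIdeal (PathAlgebra k V)) : Prop extends IsSpecialBiserial I where
  /-- `I` is generated by paths of length two -/
  generated : ∃ S : Set (QPath V), (∀ x ∈ S, x.2.2.length = 2) ∧
    I = TwoSidedIdeal.span ((fun x : QPath V => path k x.2.2) '' S)
  /-- for every arrow `α` there is at most one arrow `δ` that can be composed with `α` such that
  `αδ ∈ I` -/
  rel_right_unique : ∀ (i j : V) (α : i ⟶ j),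
    {δ : Star j | arrow k α * arrow k δ.2 ∈ I}.Subsingleton
  /-- for every arrow `α` there is at most one arrow `ε` that can be composed with `α` such that
  `εα ∈ I` -/
  rel_left_unique : ∀ (i j : V) (α : i ⟶ j),
    {ε : Costar i | arrow k ε.2 * arrow k α ∈ I}.Subsingleton

/-- `p` is a maximal path of `(Q, I)`: it is not in `I`, but `αp ∈ I` and `pα ∈ I` for all
arrows `α`. -/
def IsMaximalPath (I : TwoSidedIdeal (PathAlgebra k V)) {i j : V} (p : Path i j) : Prop :=
  path k p ∉ I ∧ (∀ (l : V) (α : l ⟶ i), arrow k α * path k p ∈ I) ∧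
    ∀ (l : V) (α : j ⟶ l), path k p * arrow k α ∈ I

/-- The vertices `i` whose trivial path is added to the maximal paths: `i` is a sink at which a
single arrow ends, or a source at which a single arrow starts, or there are a single arrow `α`
ending at `i` and a single arrow `β` starting at `i`, and `αβ ∉ I`. -/
def HasTrivialMaximalPath (I : TwoSidedIdeal (PathAlgebra k V)) (i : V) : Prop :=
  (ENat.card (Star i) = 0 ∧ ENat.card (Costar i) = 1) ∨
  (ENat.card (Star i) = 1 ∧ ENat.card (Costar i) = 0) ∨
  (ENat.card (Star i) = 1 ∧ ENat.card (Costar i) = 1 ∧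
    ∀ (α : Costar i) (β : Star i), arrow k α.2 * arrow k β.2 ∉ I)

/-- The extended set of maximal paths. -/
def ExtMaximalPath (I : TwoSidedIdeal (PathAlgebra k V)) : Type (max u v) :=
  {x : QPath V // IsMaximalPath I x.2.2 ∨
    ∃ i : V, x = ⟨i, i, Path.nil⟩ ∧ HasTrivialMaximalPath I i}

end BoundQuiver

/-- The `n`-th vertex on a path, for `0 ≤ n ≤ length p`. -/
def vertexAt {V : Type u} [Quiver.{v} V] {i j : V} (p : Path i j) (n : ℕ) : V :=
  p.vertices.getD n i

/-! ### The dual bimodule and trivial extensions -/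

section TrivialExtension

variable (k : Type u) (A : Type v) [Field k] [Ring A] [Algebra k A]

/-- `D(A) = Hom_k(A, k)`, viewed as an `A`-`A`-bimodule by `(a f b)(x) = f(b x a)`. -/
def DualBimodule : Type (max u v) := Module.Dual k A

instance : AddCommGroup (DualBimodule k A) := inferInstanceAs (AddCommGroup (Module.Dual k A))

instance : Module k (DualBimodule k A) := inferInstanceAs (Module k (Module.Dual k A))

instance : FunLike (DualBimodule k A) A k := inferInstanceAs (FunLike (Module.Dual k A) A k)

variable {k A} in
@[ext] theorem DualBimodule.ext {f g : DualBimodule k A} (h : ∀ x, f x = g x) : f = g :=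
  DFunLike.ext f g h

/-- The left action `(a f)(x) = f(x a)`. -/
instance : Module A (DualBimodule k A) where
  smul a f := (show Module.Dual k A from f) ∘ₗ LinearMap.mulRight k a
  one_smul f := DualBimodule.ext fun x => congrArg f (mul_one x)
  mul_smul a b f := DualBimodule.ext fun x => congrArg f (mul_assoc x a b).symm
  smul_zero _ := rfl
  smul_add _ _ _ := rfl
  add_smul a b f := DualBimodule.ext fun x =>
    (congrArg f (mul_add x a b)).trans (map_add (show Module.Dual k A from f) _ _)
  zero_smul f := DualBimodule.ext fun x =>
    (congrArg f (mul_zero x)).trans (map_zero (show Module.Dual k A from f))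

/-- The right action `(f a)(x) = f(a x)`. -/
instance : Module Aᵐᵒᵖ (DualBimodule k A) where
  smul a f := (show Module.Dual k A from f) ∘ₗ LinearMap.mulLeft k (unop a)
  one_smul f := DualBimodule.ext fun x => congrArg f (one_mul x)
  mul_smul a b f := DualBimodule.ext fun x => congrArg f (mul_assoc (unop b) (unop a) x)
  smul_zero _ := rfl
  smul_add _ _ _ := rfl
  add_smul a b f := DualBimodule.ext fun x =>
    (congrArg f (add_mul (unop a) (unop b) x)).trans (map_add (show Module.Dual k A from f) _ _)
  zero_smul f := DualBimodule.ext fun x =>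
    (congrArg f (zero_mul x)).trans (map_zero (show Module.Dual k A from f))

theorem DualBimodule.smul_apply (a : A) (f : DualBimodule k A) (x : A) :
    (a • f) x = f (x * a) := rfl

theorem DualBimodule.op_smul_apply (a : A) (f : DualBimodule k A) (x : A) :
    (op a • f) x = f (a * x) := rfl

instance : SMulCommClass A Aᵐᵒᵖ (DualBimodule k A) :=
  ⟨fun a b f => DualBimodule.ext fun x => congrArg f (mul_assoc (unop b) x a).symm⟩

instance : IsScalarTower k A (DualBimodule k A) :=
  ⟨fun c a f => DualBimodule.ext fun x =>
    (congrArg f (mul_smul_comm c x a)).trans (map_smul (show Module.Dual k A from f) c _)⟩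

instance : IsScalarTower k Aᵐᵒᵖ (DualBimodule k A) :=
  ⟨fun c a f => DualBimodule.ext fun x =>
    (congrArg f (smul_mul_assoc c (unop a) x)).trans (map_smul (show Module.Dual k A from f) c _)⟩

/-- The trivial extension `T(A) = A ⋉ D(A)`, with `(a, f)(b, g) = (ab, ag + fb)`. -/
abbrev TrivialExtension : Type (max u v) := TrivSqZeroExt A (DualBimodule k A)

/-- A `k`-algebra is symmetric if it is isomorphic to its dual as a bimodule. -/
def IsSymmetricAlgebra : Prop :=
  ∃ θ : A ≃ₗ[k] DualBimodule k A, ∀ a x b : A, θ (a * x * b) = a • op b • θ x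

end TrivialExtension

/-! ### Brauer graphs and Brauer graph algebras -/

/-- The data of a graph with edges `E` (loops and multiple edges are allowed), a cyclic ordering of
the edges around every vertex, and a multiplicity for every vertex. A half-edge is an end of an
edge; it is attached to a vertex and has a successor in the cyclic ordering around that vertex. -/
structure RibbonGraph (E : Type u) where
  Vertex : Type v
  HalfEdge : Type v
  vert : HalfEdge → Vertex
  edge : HalfEdge → E
  next : Equiv.Perm HalfEdge
  mult : Vertex → ℕ

namespace RibbonGraph

variable {E : Type u}

/-- The data form a Brauer graph: a finite connected graph in which every edge has two ends, the
half-edges at each vertex are cyclically ordered by `next`, and the multiplicities are positive. -/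
structure IsBrauerGraph (Γ : RibbonGraph.{u, v} E) : Prop where
  finite_edge : Finite E
  finite_vertex : Finite Γ.Vertex
  two_ends : ∀ e : E, Nat.card {h : Γ.HalfEdge // Γ.edge h = e} = 2
  vert_surjective : Function.Surjective Γ.vert
  vert_eq_iff : ∀ h h' : Γ.HalfEdge, Γ.vert h = Γ.vert h' ↔ Γ.next.SameCycle h h'
  mult_pos : ∀ x : Γ.Vertex, 0 < Γ.mult x
  nonempty : Nonempty Γ.Vertex
  connected : ∀ x y : Γ.Vertex, Relation.ReflTransGen
    (fun x y => ∃ h h', Γ.edge h = Γ.edge h' ∧ Γ.vert h = x ∧ Γ.vert h' = y) x y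

/-- An isomorphism of graphs that respects the cyclic orderings and the multiplicities. -/
structure Iso {E' : Type w} (Γ : RibbonGraph.{u, v} E) (Γ' : RibbonGraph.{w, v} E') where
  onVertices : Γ.Vertex ≃ Γ'.Vertex
  onEdges : E ≃ E'
  onHalfEdges : Γ.HalfEdge ≃ Γ'.HalfEdge
  vert_comm : ∀ h, Γ'.vert (onHalfEdges h) = onVertices (Γ.vert h)
  edge_comm : ∀ h, Γ'.edge (onHalfEdges h) = onEdges (Γ.edge h)
  next_comm : ∀ h, Γ'.next (onHalfEdges h) = onHalfEdges (Γ.next h)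
  mult_comm : ∀ x, Γ'.mult (onVertices x) = Γ.mult x

/-- A half-edge is truncated if its vertex has valency one and multiplicity one. -/
def Truncated (Γ : RibbonGraph.{u, v} E) (h : Γ.HalfEdge) : Prop :=
  Γ.next h = h ∧ Γ.mult (Γ.vert h) = 1

/-- The vertex set of the quiver of a Brauer graph: the edges of the graph. -/
def QuiverVertex (_Γ : RibbonGraph.{u, v} E) : Type u := E

instance (Γ : RibbonGraph.{u, v} E) [Fintype E] : Fintype Γ.QuiverVertex :=
  inferInstanceAs (Fintype E)

/-- The quiver of a Brauer graph: every half-edge `h` that is not truncated gives an arrow from the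
edge of `h` to the edge of its successor. -/
instance (Γ : RibbonGraph.{u, v} E) : Quiver.{v} Γ.QuiverVertex where
  Hom i j := {h : Γ.HalfEdge // Γ.edge h = i ∧ Γ.edge (Γ.next h) = j ∧ ¬ Γ.Truncated h}

section Algebra

variable (k : Type w) [Field k] (Γ : RibbonGraph.{u, v} E)

open Classical in
/-- The arrow that starts at the half-edge `h` (only used if `h` is not truncated). -/
def arr (h : Γ.HalfEdge) : PathAlgebra k Γ.QuiverVertex :=
  if hh : Γ.Truncated h then 0
  else arrow k (i := (Γ.edge h : Γ.QuiverVertex)) (j := (Γ.edge (Γ.next h) : Γ.QuiverVertex))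
    ⟨h, rfl, rfl, hh⟩

variable [Fintype E]

/-- The `e(ν)`-th power of the cycle around the vertex `ν` of `h` that starts at `h`. The valency of
`ν` is the minimal period of `h` under `next`. -/
def cyclePow (h : Γ.HalfEdge) : PathAlgebra k Γ.QuiverVertex :=
  ((List.range (Γ.mult (Γ.vert h) * Function.minimalPeriod Γ.next h)).map
    fun n => Γ.arr k (Γ.next^[n] h)).prod

/-- The relations of the Brauer graph algebra. -/
inductive Rel : PathAlgebra k Γ.QuiverVertex → Prop
  /-- the two cycles at an edge agree if none of its ends is truncated -/
  | comm (h h' : Γ.HalfEdge) (he : Γ.edge h = Γ.edge h') (hne : h ≠ h')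
      (ht : ¬ Γ.Truncated h) (ht' : ¬ Γ.Truncated h') : Rel (Γ.cyclePow k h - Γ.cyclePow k h')
  /-- if one end of an edge is truncated, the cycle at the other end, followed by its first arrow,
  is zero -/
  | trunc (h h' : Γ.HalfEdge) (he : Γ.edge h = Γ.edge h') (hne : h ≠ h')
      (ht : ¬ Γ.Truncated h) (ht' : Γ.Truncated h') : Rel (Γ.cyclePow k h * Γ.arr k h)
  /-- two arrows that do not follow each other around a vertex compose to zero: the second arrow
  starts at the other end of the edge at which the first one arrives -/
  | zero (h h' : Γ.HalfEdge) (he : Γ.edge h' = Γ.edge (Γ.next h)) (hne : h' ≠ Γ.next h)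
      (ht : ¬ Γ.Truncated h) (ht' : ¬ Γ.Truncated h') : Rel (Γ.arr k h * Γ.arr k h')

/-- The Brauer graph algebra of `Γ`. -/
abbrev BrauerGraphAlgebra : Type (max u v w) :=
  BoundQuiverAlgebra (TwoSidedIdeal.span {x : PathAlgebra k Γ.QuiverVertex | Γ.Rel k x})

end Algebra

end RibbonGraph

/-! ### The graph of a gentle algebra -/

section GentleGraph

variable {k : Type w} {V : Type u} [Field k] [Quiver.{v} V] [Fintype V]

/-- The graph `Γ_A` of a gentle algebra `A = kQ/I`. Its vertices are the extended maximal paths and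
its edges are the vertices of `Q`. The half-edges at a maximal path `m` are the positions on `m`, and
such a half-edge belongs to the vertex of `Q` at this position. The linear order of the positions is
closed up to a cyclic order. All multiplicities are one. -/
def gentleGraph (I : TwoSidedIdeal (PathAlgebra k V)) : RibbonGraph.{u, max u v} V where
  Vertex := ExtMaximalPath I
  HalfEdge := Σ m : ExtMaximalPath I, Fin (m.1.2.2.length + 1)
  vert h := h.1
  edge h := vertexAt h.1.1.2.2 h.2
  next := Equiv.sigmaCongrRight fun m => finRotate (m.1.2.2.length + 1)
  mult _ := 1

end GentleGraph

/-! ### The graph of a symmetric special biserial algebra -/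

section SymmetricSpecialBiserial

/-- The `n`-th power of a closed path. -/
def closedPathPow {V : Type u} [Quiver.{v} V] {i : V} (c : Path i i) : ℕ → Path i i
  | 0 => Path.nil
  | n + 1 => (closedPathPow c n).comp c

open Classical in
/-- The multiplicity of a closed path `p`: one for a trivial path, and otherwise the largest `m` for
which `p = cᵐ` for some closed path `c`; this `c` is then not a proper power. -/
def pathMult {V : Type u} [Quiver.{v} V] {i : V} (p : Path i i) : ℕ :=
  if p.length = 0 then 1 else sSup {m : ℕ | ∃ c : Path i i, p = closedPathPow c m}

/-- The length of the sequence `μ(p)` of a closed path `p`: it is one for a trivial path, and the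
length of `c` if `p = cᵐ` where `m` is the multiplicity of `p`. -/
def muLength {V : Type u} [Quiver.{v} V] {i : V} (p : Path i i) : ℕ :=
  if p.length = 0 then 1 else p.length / pathMult p

variable {k : Type w} {V : Type u} [Field k] [Quiver.{v} V] [Fintype V]

/-- A finite-dimensional symmetric special biserial algebra `kQ/I`, where `I` is generated by zero
relations and commutativity relations. -/
structure IsSymmetricSpecialBiserial (I : TwoSidedIdeal (PathAlgebra k V)) : Prop
    extends IsSpecialBiserial I where
  symmetric : IsSymmetricAlgebra k (BoundQuiverAlgebra I)
  generated : ∃ ρ : Set (PathAlgebra k V), I = TwoSidedIdeal.span ρ ∧ ∀ x ∈ ρ,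
    (∃ (i j : V) (p : Path i j), x = path k p) ∨
    ∃ (i j : V) (p q : Path i j), path k p ∉ I ∧ path k q ∉ I ∧ x = path k p - path k q

/-- The indecomposable projective right module `e_i Λ` over `Λ = kQ/I`. -/
def projectiveAt (I : TwoSidedIdeal (PathAlgebra k V)) (i : V) :
    Submodule (BoundQuiverAlgebra I)ᵐᵒᵖ (BoundQuiverAlgebra I) :=
  Submodule.span _ {toBound I (path k (Path.nil : Path i i))}

/-- `e_i Λ` is uniserial: its submodules form a chain. -/
def IsUniserialAt (I : TwoSidedIdeal (PathAlgebra k V)) (i : V) : Prop :=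
  ∀ N N' : Submodule (BoundQuiverAlgebra I)ᵐᵒᵖ (BoundQuiverAlgebra I),
    N ≤ projectiveAt I i → N' ≤ projectiveAt I i → N ≤ N' ∨ N' ≤ N

/-- The maximal cyclic paths: the non-trivial closed maximal paths of `(Q, I)`, and the trivial paths
at the vertices whose indecomposable projective module is uniserial. -/
def MaximalCyclicPath (I : TwoSidedIdeal (PathAlgebra k V)) : Type (max u v) :=
  {x : Σ i : V, Path i i // (0 < x.2.length ∧ IsMaximalPath I x.2) ∨
    (x.2.length = 0 ∧ IsUniserialAt I x.1)}

/-- Two closed paths are cyclic rotations of each other. -/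
def IsRotation (x y : Σ i : V, Path i i) : Prop :=
  ∃ (i j : V) (p : Path i j) (q : Path j i), x = ⟨i, p.comp q⟩ ∧ y = ⟨j, q.comp p⟩

/-- The vertices `ν(p)`: the maximal cyclic paths up to rotation. -/
def RotationClass (I : TwoSidedIdeal (PathAlgebra k V)) : Type (max u v) :=
  Quot fun x y : MaximalCyclicPath I => IsRotation x.1 y.1

/-- A maximal cyclic path in a given rotation class. -/
def RotationClass.rep {I : TwoSidedIdeal (PathAlgebra k V)} (x : RotationClass I) :
    MaximalCyclicPath I :=
  Quot.out x

/-- The graph `G_Λ` of a symmetric special biserial algebra `Λ = kQ/I`. Its vertices are the rotation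
classes `ν(p)` of the maximal cyclic paths and its edges are the vertices of `Q`. The half-edges
(germs) at `ν(p)` are the positions in the sequence `μ(p)`, in cyclic order, each of them labelled by
the vertex of `Q` at this position. The multiplicity of `ν(p)` is that of `p`. -/
def symmetricSpecialBiserialGraph (I : TwoSidedIdeal (PathAlgebra k V)) :
    RibbonGraph.{u, max u v} V where
  Vertex := RotationClass I
  HalfEdge := Σ x : RotationClass I, Fin (muLength x.rep.1.2)
  vert h := h.1
  edge h := vertexAt h.1.rep.1.2 h.2
  next := Equiv.sigmaCongrRight fun x => finRotate (muLength x.rep.1.2)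
  mult x := pathMult x.rep.1.2

end SymmetricSpecialBiserial

/-! ### The quiver of the trivial extension -/

section ExtendedQuiver

variable {k : Type w} {V : Type u} [Field k] [Quiver.{v} V] [Fintype V]

/-- The vertices of the quiver `Q_E` of the trivial extension of `kQ/I`: those of `Q`. -/
def ExtendedQuiver (_I : TwoSidedIdeal (PathAlgebra k V)) : Type u := V

/-- The identification of the vertices of `Q` with those of `Q_E`. -/
def ExtendedQuiver.of (I : TwoSidedIdeal (PathAlgebra k V)) : V ≃ ExtendedQuiver I := Equiv.refl V

instance (I : TwoSidedIdeal (PathAlgebra k V)) : Fintype (ExtendedQuiver I) :=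
  inferInstanceAs (Fintype V)

/-- The arrows of `Q_E`: the arrows of `Q`, and for every maximal path `m` of `(Q, I)` a new arrow
`β_m` from the end of `m` to the start of `m`. -/
instance (I : TwoSidedIdeal (PathAlgebra k V)) : Quiver.{max u v} (ExtendedQuiver I) where
  Hom i j := (((ExtendedQuiver.of I).symm i) ⟶ ((ExtendedQuiver.of I).symm j)) ⊕
    {m : Path ((ExtendedQuiver.of I).symm j) ((ExtendedQuiver.of I).symm i) // IsMaximalPath I m}

/-- An arrow of `Q` as an arrow of `Q_E`. -/
def ExtendedQuiver.oldArrow (I : TwoSidedIdeal (PathAlgebra k V)) {i j : V} (α : i ⟶ j) :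
    ExtendedQuiver.of I i ⟶ ExtendedQuiver.of I j :=
  Sum.inl α

/-- The arrow `β_m` of `Q_E`. -/
def ExtendedQuiver.newArrow (I : TwoSidedIdeal (PathAlgebra k V)) {i j : V} (m : Path i j)
    (hm : IsMaximalPath I m) : ExtendedQuiver.of I j ⟶ ExtendedQuiver.of I i :=
  Sum.inr ⟨m, hm⟩

open Classical in
/-- The canonical map `kQ_E → T(A)` for `A = kQ/I`: it sends trivial paths `e_i` to `(e_i, 0)`, arrows
`α` of `Q` to `(α, 0)`, and the arrow `β_m` to `(0, m*)`, where the linear form `m*` on `A` takes the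
value one at `m` and zero at all other paths. -/
structure IsCanonical (I : TwoSidedIdeal (PathAlgebra k V))
    (φ : PathAlgebra k (ExtendedQuiver I) →ₐ[k] TrivialExtension k (BoundQuiverAlgebra I)) :
    Prop where
  map_vertex : ∀ i : V, φ (path k (Path.nil : Path (ExtendedQuiver.of I i) _)) =
    TrivSqZeroExt.inl (toBound I (path k (Path.nil : Path i i)))
  map_oldArrow : ∀ (i j : V) (α : i ⟶ j), φ (arrow k (ExtendedQuiver.oldArrow I α)) =
    TrivSqZeroExt.inl (toBound I (arrow k α))
  map_newArrow : ∀ (i j : V) (m : Path i j) (hm : IsMaximalPath I m),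
    ∃ f : DualBimodule k (BoundQuiverAlgebra I),
      φ (arrow k (ExtendedQuiver.newArrow I m hm)) = TrivSqZeroExt.inr f ∧
      ∀ x : QPath V, f (toBound I (path k x.2.2)) = if x = ⟨i, j, m⟩ then 1 else 0

end ExtendedQuiver

end Gentle

end

/-! The linear form `(a, f) ↦ f(1)` on `T(A)` vanishes on no nonzero right ideal
(`eq_zero_of_trivialExtensionTrace`). Pulled back along `φ`, it becomes the indicator function of a
set of closed paths of `Q_E`, namely the rotations of the closed paths `m β_m` with `m` maximal
(`trace_map`). Since `φ` is surjective, `ker φ` is the radical of the form `(x, y) ↦ cycleTrace (x *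
y)` (`mem_ker_iff`), so it is determined by these cycles alone.

Gentleness enters through the maximal paths. As `I` is generated by paths of length two, paths
outside `I` that overlap in an arrow can be glued, and each arrow of `Q` has one position on one
maximal path (`maximalPath_unique`). Hence each arrow of `Q_E` starts exactly one cycle, and the
cycles form a `CycleSystem`. For any such system with at most two arrows starting at each vertex,
the quotient by the radical is symmetric special biserial. Its maximal paths are the cycles, and the
radical is generated by zero relations of length two, differences of cycles, and cycles followed by
their first arrow (`le_of_relations`).

The cycles of `Q_E` correspond to the half-edges of `Γ_A` on non-trivial paths: rotation by one
arrow is passage to the successor, and `β_m` closes the linear order of `m` to a cyclic one. Thus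
`Q_E` is the quiver of `Γ_A`, and the relations of the Brauer graph algebra generate the same ideal.
A count at a vertex `v` shows that the arrows of `Q_E` starting at `v`, together with the trivial
maximal path at `v` if there is one, are two in number (`card_star_add_card_trivial`). So every edge
has two ends, and a trivial maximal path sits exactly where the projective module of `T(A)` is
uniserial. This matches the vertices of the two graphs. -/

noncomputable section
namespace Gentle
open Quiver MulOpposite
open PathAlgebra

/-! ### Paths -/

section Paths

variable {V : Type u} [Quiver.{v} V]

/-- Induction on paths from the left. -/
theorem path_induction_left {j : V} {P : ∀ {i : V}, Path i j → Prop} (hnil : P (Path.nil : Path j j))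
    (hcons : ∀ {i i' : V} (a : i ⟶ i') (p : Path i' j), P p → P (a.toPath.comp p)) {i : V}
    (p : Path i j) : P p := by
  obtain ⟨n, hn⟩ : ∃ n, p.length = n := ⟨_, rfl⟩
  induction n generalizing i with
  | zero =>
    obtain rfl := Path.eq_of_length_zero p hn
    obtain rfl := Path.eq_nil_of_length_zero p hn
    exact hnil
  | succ n ih =>
    obtain ⟨c, a, q, hq, rfl⟩ := p.eq_toPath_comp_of_length_eq_succ hn
    exact hcons a q (ih q hq)

theorem cases_left {i j : V} (p : Path i j) :
    (∃ h : i = j, p = Path.nil.cast rfl h) ∨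
      ∃ (l : V) (a : i ⟶ l) (q : Path l j), p = a.toPath.comp q := by
  induction p using path_induction_left with
  | hnil => exact Or.inl ⟨rfl, rfl⟩
  | hcons a p _ => exact Or.inr ⟨_, a, p, rfl⟩

/-- Paths grow by appending arrows at the end, so the first arrow is not exposed by the constructors
and an induction is needed. The inner vertices may differ a priori, whence the sigma types. -/
theorem toPath_comp_inj {i l l' j : V} {a : i ⟶ l} {a' : i ⟶ l'} {p : Path l j} {p' : Path l' j}
    (h : a.toPath.comp p = a'.toPath.comp p') :
    (⟨l, a⟩ : Star i) = ⟨l', a'⟩ ∧ (⟨l, p⟩ : Σ x, Path x j) = ⟨l', p'⟩ := by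
  induction p with
  | nil =>
    cases p' with
    | nil =>
      have := h
      simp only [Path.comp_nil, Hom.toPath, Path.cons.injEq] at this
      obtain ⟨-, -, h3⟩ := this
      obtain rfl := eq_of_heq h3
      exact ⟨rfl, rfl⟩
    | cons q b =>
      have := congrArg Path.length h
      simp at this
  | cons q b ih =>
    cases p' with
    | nil =>
      have := congrArg Path.length h
      simp at this
    | cons q' b' =>
      simp only [Path.comp_cons, Path.cons.injEq] at h
      obtain ⟨rfl, h2, h3⟩ := h
      obtain ⟨h4, h5⟩ := ih (eq_of_heq h2)
      obtain rfl := eq_of_heq h3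
      cases h4
      cases h5
      exact ⟨rfl, rfl⟩

theorem comp_cons_inj {i l l' j : V} {p : Path i l} {p' : Path i l'} {a : l ⟶ j} {a' : l' ⟶ j}
    (h : p.cons a = p'.cons a') :
    (⟨l, a⟩ : Costar j) = ⟨l', a'⟩ ∧ (⟨l, p⟩ : Σ x, Path i x) = ⟨l', p'⟩ := by
  simp only [Path.cons.injEq] at h
  obtain ⟨rfl, h2, h3⟩ := h
  obtain rfl := eq_of_heq h2
  obtain rfl := eq_of_heq h3
  exact ⟨rfl, rfl⟩

/-- Two factorizations of a path with equally long first factors agree. -/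
theorem comp_eq_comp_of_length {i l l' j : V} {p : Path i l} {q : Path l j} {p' : Path i l'}
    {q' : Path l' j} (h : p.comp q = p'.comp q') (hl : p.length = p'.length) :
    (⟨l, p, q⟩ : Σ x, Path i x × Path x j) = ⟨l', p', q'⟩ := by
  induction q with
  | nil =>
    cases q' with
    | nil => simp at h; rw [h]
    | cons q' b =>
      have := congrArg Path.length h
      simp at this; omega
  | cons q b ih =>
    cases q' with
    | nil =>
      have := congrArg Path.length h
      simp at this; omega
    | cons q' b' =>
      simp only [Path.comp_cons] at h
      obtain ⟨h1, h2⟩ := comp_cons_inj h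
      cases h1
      have := ih (by simpa using h2)
      cases this
      rfl

theorem exists_comp_of_length_le {i j : V} (p : Path i j) {n : ℕ} (hn : n ≤ p.length) :
    ∃ (l : V) (q : Path i l) (r : Path l j), p = q.comp r ∧ q.length = n := by
  induction p with
  | nil => exact ⟨_, Path.nil, Path.nil, rfl, by simp at hn; simp [hn]⟩
  | cons p a ih =>
    rcases Nat.lt_or_ge p.length n with h | h
    · exact ⟨_, p.cons a, Path.nil, rfl, by simp at hn ⊢; omega⟩
    · obtain ⟨l, q, r, rfl, hq⟩ := ih h
      exact ⟨l, q, r.cons a, rfl, hq⟩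

/-- The vertex list of a composite omits the last vertex of `p`, which is the first one of `q`. The
bound on `n` keeps the default values of `vertexAt`, which differ on the two sides, out of play. -/
theorem vertexAt_comp_right {i l j : V} (p : Path i l) (q : Path l j) (n : ℕ) :
    n ≤ q.length → vertexAt (p.comp q) (p.length + n) = vertexAt q n := by
  intro hn
  have hd : p.vertices.dropLast.length = p.length := by simp
  simp only [vertexAt, Path.vertices_comp]
  rw [List.getD_append_right _ _ _ _ (by omega), hd, Nat.add_sub_cancel_left,
    List.getD_eq_getElem _ _ (by simp; omega), List.getD_eq_getElem _ _ (by simp; omega)]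

theorem vertexAt_zero {i j : V} (p : Path i j) : vertexAt p 0 = i := by
  simp [vertexAt]

theorem vertexAt_length_comp {i l j : V} (p : Path i l) (q : Path l j) :
    vertexAt (p.comp q) p.length = l := by
  simpa [vertexAt_zero] using vertexAt_comp_right p q 0 (Nat.zero_le _)

/-- A path splits at each of its vertices. -/
theorem exists_comp_vertexAt {i j v : V} (p : Path i j) {n : ℕ} (hn : n ≤ p.length)
    (hv : vertexAt p n = v) :
    ∃ (q : Path i v) (r : Path v j), p = q.comp r ∧ q.length = n := by
  obtain ⟨l, q, r, rfl, rfl⟩ := exists_comp_of_length_le p hn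
  rw [vertexAt_length_comp] at hv
  subst hv
  exact ⟨q, r, rfl, rfl⟩

/-- In a finite quiver there are finitely many paths of bounded length. -/
theorem finite_paths_of_length_lt [Finite V] (h : ∀ i : V, Finite (Star i)) (n : ℕ) :
    {x : QPath V | x.2.2.length < n}.Finite := by
  induction n with
  | zero => simp
  | succ n ih =>
    have : {x : QPath V | x.2.2.length < n + 1} ⊆
        Set.range (fun i : V => (⟨i, i, Path.nil⟩ : QPath V)) ∪
        ⋃ x ∈ {x : QPath V | x.2.2.length < n},
          Set.range (fun a : Star x.2.1 => (⟨x.1, a.1, x.2.2.cons a.2⟩ : QPath V)) := by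
      rintro ⟨i, j, p⟩ hp
      cases p with
      | nil => exact Or.inl ⟨i, rfl⟩
      | @cons b c p a =>
        refine Or.inr (Set.mem_biUnion (x := ⟨i, b, p⟩) ?_ ⟨⟨_, a⟩, rfl⟩)
        simpa using hp
    refine Set.Finite.subset (Set.Finite.union (Set.finite_range _) (ih.biUnion fun x _ => ?_)) this
    have := h x.2.1
    exact Set.finite_range _

end Paths

/-! ### Path algebras -/

namespace PathAlgebra

section Basic

variable (k : Type w) {V : Type u} [Field k] [Quiver.{v} V]

theorem basis_apply (x : QPath V) : basis k x = path k x.2.2 := rfl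

theorem smul_mul_path_aux (c : k) (x y : PathAlgebra k V) : (c • x) * y = c • (x * y) := by
  simp only [mul_def, map_smul, LinearMap.smul_apply]

theorem mul_smul_path_aux (c : k) (x y : PathAlgebra k V) : x * (c • y) = c • (x * y) := by
  simp only [mul_def, map_smul]

theorem path_cons {i j l : V} (p : Path i j) (a : j ⟶ l) :
    path k (p.cons a) = path k p * arrow k a := by
  rw [arrow, path_mul_path]; rfl

theorem path_toPath_comp {i j l : V} (a : i ⟶ j) (p : Path j l) :
    path k (a.toPath.comp p) = arrow k a * path k p := by
  rw [arrow, path_mul_path]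

theorem repr_path_apply [DecidableEq (QPath V)] {i j : V} (p : Path i j) (x : QPath V) :
    (basis k).repr (path k p) x = if (⟨i, j, p⟩ : QPath V) = x then 1 else 0 := by
  rw [path, Module.Basis.repr_self, Finsupp.single_apply]

end Basic

section Ext

variable {k : Type w} {V : Type u} [Field k] [Quiver.{v} V] [Fintype V]
  {B : Type*} [Ring B] [Algebra k B]

/-- The value of a path under an assignment of values to vertices and arrows. -/
def pathValue (e : V → B) (a : ∀ ⦃i j : V⦄, (i ⟶ j) → B) {i : V} : ∀ {j : V}, Path i j → B
  | _, Path.nil => e i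
  | _, Path.cons p α => pathValue e a p * a α

/-- The universal property of the path algebra. -/
theorem exists_lift (e : V → B) (a : ∀ ⦃i j : V⦄, (i ⟶ j) → B) (he : ∀ i, e i * e i = e i)
    (hne : ∀ i j, i ≠ j → e i * e j = 0) (hsum : ∑ i, e i = 1)
    (hl : ∀ ⦃i j : V⦄ (α : i ⟶ j), e i * a α = a α)
    (hr : ∀ ⦃i j : V⦄ (α : i ⟶ j), a α * e j = a α) :
    ∃ f : PathAlgebra k V →ₐ[k] B, (∀ i : V, f (path k (Path.nil : Path i i)) = e i) ∧
      ∀ ⦃i j : V⦄ (α : i ⟶ j), f (arrow k α) = a α := by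
  have vr : ∀ {i j : V} (p : Path i j), pathValue e a p * e j = pathValue e a p := by
    intro i j p
    cases p with
    | nil => exact he _
    | cons p α => rw [pathValue, mul_assoc, hr]
  have vl : ∀ {i j : V} (p : Path i j), e i * pathValue e a p = pathValue e a p := by
    intro i j p
    induction p with
    | nil => exact he _
    | cons p α ih => rw [pathValue, ← mul_assoc, ih]
  have vc : ∀ {i j l : V} (p : Path i j) (q : Path j l),
      pathValue e a (p.comp q) = pathValue e a p * pathValue e a q := by
    intro i j l p q
    induction q with
    | nil => rw [Path.comp_nil, pathValue, vr]
    | cons q α ih => rw [Path.comp_cons, pathValue, pathValue, ih, mul_assoc]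
  let g : PathAlgebra k V →ₗ[k] B := (basis k).constr k fun x => pathValue e a x.2.2
  have hg : ∀ {i j : V} (p : Path i j), g (path k p) = pathValue e a p := fun p =>
    (basis k).constr_basis k _ _
  have hmul : ∀ x y, g (x * y) = g x * g y := by
    intro x y
    refine induction_path k (P := fun x => g (x * y) = g x * g y) x (fun i j p => ?_) (by simp)
      (fun _ _ h h' => by simp [add_mul, h, h']) (fun c _ h => by simp [h])
    refine induction_path k (P := fun y => g (path k p * y) = g (path k p) * g y) y
      (fun i' j' q => ?_) (by simp) (fun _ _ h h' => by simp [mul_add, h, h'])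
      (fun c _ h => by simp [h])
    by_cases h : j = i'
    · subst h
      rw [path_mul_path, hg, hg, hg, vc]
    · rw [path_mul_path_of_ne k _ _ h, hg, hg, ← vr p, ← vl q, mul_assoc, ← mul_assoc (e j),
        hne _ _ h, zero_mul, mul_zero, map_zero]
  refine ⟨AlgHom.ofLinearMap g ?_ hmul, fun i => ?_, fun i j α => ?_⟩
  · rw [one_def, map_sum, ← hsum]
    exact Finset.sum_congr rfl fun i _ => hg _
  · exact hg _
  · refine (hg _).trans ?_
    rw [Hom.toPath, pathValue, pathValue, hl]

theorem algHom_ext {f g : PathAlgebra k V →ₐ[k] B}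
    (h0 : ∀ i : V, f (path k (Path.nil : Path i i)) = g (path k (Path.nil : Path i i)))
    (h1 : ∀ ⦃i j : V⦄ (α : i ⟶ j), f (arrow k α) = g (arrow k α)) : f = g := by
  ext x
  refine induction_path k (P := fun x => f x = g x) x (fun i j p => ?_) (by simp)
    (fun _ _ h h' => by simp [h, h']) (fun c _ h => by simp [h])
  induction p with
  | nil => exact h0 _
  | cons p α ih => rw [path_cons, map_mul, map_mul, ih, h1]

theorem smul_mem_twoSidedIdeal {R : Type*} [Ring R] [Algebra k R] (I : TwoSidedIdeal R) (c : k)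
    {x : R} (hx : x ∈ I) : c • x ∈ I := by
  rw [Algebra.smul_def]
  exact I.mul_mem_left _ _ hx

theorem toBound_eq_zero_iff (I : TwoSidedIdeal (PathAlgebra k V)) (x : PathAlgebra k V) :
    toBound I x = 0 ↔ x ∈ I := by
  rw [TwoSidedIdeal.mem_iff]
  exact RingCon.eq I.ringCon

theorem toBound_surjective (I : TwoSidedIdeal (PathAlgebra k V)) :
    Function.Surjective (toBound I) :=
  RingCon.mkₐ_surjective I.ringCon

end Ext

end PathAlgebra

end Gentle
end

noncomputable section
namespace Gentle
open Quiver MulOpposite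
open PathAlgebra

/-! ### Bound quiver algebras -/

section BoundQuiverAlgebra

variable {k : Type w} {V : Type u} [Field k] [Quiver.{v} V] [Fintype V]

/-- A linear map that vanishes on `I` factors through `kQ/I`. -/
theorem exists_factor_toBound {M : Type*} [AddCommGroup M] [Module k M]
    (I : TwoSidedIdeal (PathAlgebra k V)) (f : PathAlgebra k V →ₗ[k] M) (hf : ∀ x ∈ I, f x = 0) :
    ∃ g : BoundQuiverAlgebra I →ₗ[k] M, ∀ x, g (toBound I x) = f x := by
  -- A linear section of the quotient map defines the factor; it changes a representative only by an
  -- element of `I`, which `f` does not see.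
  obtain ⟨s, hs⟩ := (toBound I).toLinearMap.exists_rightInverse_of_surjective
    (LinearMap.range_eq_top.2 (toBound_surjective I))
  refine ⟨f ∘ₗ s, fun x => ?_⟩
  have h1 : toBound I (s (toBound I x)) = toBound I x := LinearMap.congr_fun hs (toBound I x)
  have h2 : s (toBound I x) - x ∈ I := by
    rw [← toBound_eq_zero_iff, map_sub, h1, sub_self]
  have h3 := hf _ h2
  rw [map_sub, sub_eq_zero] at h3
  exact h3

theorem span_toBound_path_eq_top (I : TwoSidedIdeal (PathAlgebra k V)) :
    Submodule.span k ((fun x : QPath V => toBound I (path k x.2.2)) ''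
      {x : QPath V | path k x.2.2 ∉ I}) = ⊤ := by
  rw [eq_top_iff]
  intro x _
  obtain ⟨x, rfl⟩ := toBound_surjective I x
  refine induction_path k (P := fun x => toBound I x ∈ _) x (fun i j p => ?_)
    (by rw [map_zero]; exact zero_mem _) (fun _ _ h h' => by rw [map_add]; exact add_mem h h')
    (fun c _ h => by rw [map_smul]; exact Submodule.smul_mem _ _ h)
  by_cases hp : path k p ∈ I
  · rw [(toBound_eq_zero_iff I _).2 hp]
    exact zero_mem _
  · exact Submodule.subset_span ⟨⟨i, j, p⟩, hp, rfl⟩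

theorem finite_paths_notMem (I : TwoSidedIdeal (PathAlgebra k V))
    (hI : ∃ N : ℕ, ∀ (i j : V) (p : Path i j), N ≤ p.length → path k p ∈ I)
    (hs : ∀ i : V, Finite (Star i)) : {x : QPath V | path k x.2.2 ∉ I}.Finite := by
  obtain ⟨N, hN⟩ := hI
  refine (finite_paths_of_length_lt hs N).subset fun x hx => ?_
  by_contra h
  exact hx (hN _ _ _ (not_lt.1 h))

theorem finite_boundQuiverAlgebra (I : TwoSidedIdeal (PathAlgebra k V))
    (hI : ∃ N : ℕ, ∀ (i j : V) (p : Path i j), N ≤ p.length → path k p ∈ I)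
    (hs : ∀ i : V, Finite (Star i)) : Module.Finite k (BoundQuiverAlgebra I) :=
  ⟨(Submodule.fg_def).2 ⟨_, (finite_paths_notMem I hI hs).image _, span_toBound_path_eq_top I⟩⟩

end BoundQuiverAlgebra

/-! ### Systems of cycles and their trace forms -/

section CycleSystem

variable {W : Type u} [Quiver.{v} W]

/-- A set of closed paths that is closed under rotation and contains exactly one cycle starting with
any given arrow. -/
structure CycleSystem (C : ∀ v : W, Path v v → Prop) : Prop where
  rotate : ∀ {v w : W} (p : Path v w) (q : Path w v), C v (p.comp q) → C w (q.comp p)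
  exists_of_arrow : ∀ {v w : W} (a : v ⟶ w), ∃ y : Path w v, C v (a.toPath.comp y)
  unique : ∀ {v w : W} (a : v ⟶ w) (y y' : Path w v),
    C v (a.toPath.comp y) → C v (a.toPath.comp y') → y = y'
  -- Length at least two keeps arrows out of the ideal to be defined, `bounded` puts all long paths
  -- into it, and `exists_arrow` provides a cycle at each vertex.
  two_le_length : ∀ {v : W} (c : Path v v), C v c → 2 ≤ c.length
  bounded : ∃ N, ∀ (v : W) (c : Path v v), C v c → c.length < N
  exists_arrow : ∀ v : W, Nonempty (Star v)

variable {C : ∀ v : W, Path v v → Prop}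

namespace CycleSystem

theorem exists_cycle (hC : CycleSystem C) (v : W) : ∃ c : Path v v, C v c := by
  obtain ⟨w, a⟩ := hC.exists_arrow v
  obtain ⟨y, hy⟩ := hC.exists_of_arrow a
  exact ⟨_, hy⟩

/-- A non-trivial initial part contains the first arrow, which already determines the cycle. -/
theorem cancel_left (hC : CycleSystem C) {v w : W} {p : Path v w} {q q' : Path w v}
    (hp : 0 < p.length) (h : C v (p.comp q)) (h' : C v (p.comp q')) : q = q' := by
  rcases cases_left p with ⟨rfl, rfl⟩ | ⟨l, a, r, rfl⟩
  · simp at hp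
  · rw [Path.comp_assoc] at h h'
    exact Path.comp_inj_right.1 (hC.unique a _ _ h h')

theorem cancel_right (hC : CycleSystem C) {v w : W} {p p' : Path v w} {q : Path w v}
    (hq : 0 < q.length) (h : C v (p.comp q)) (h' : C v (p'.comp q)) : p = p' :=
  hC.cancel_left hq (hC.rotate _ _ h) (hC.rotate _ _ h')

/-- The two cycles share their first arrow. So no cycle is a proper initial part of another; in
particular no proper power of a cycle is a cycle. -/
theorem eq_nil_of_comp (hC : CycleSystem C) {v : W} {c q : Path v v}
    (h : C v c) (h' : C v (c.comp q)) : q = Path.nil :=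
  hC.cancel_left (p := c) (q := q) (by have := hC.two_le_length c h; omega) h' (by simpa using h)

/-- Send an arrow that ends at `v` to the arrow that follows it on its cycle. This is injective
because the following arrow determines the cycle, hence also its last arrow. -/
theorem card_costar_le_card_star (hC : CycleSystem C) (v : W) :
    ENat.card (Costar v) ≤ ENat.card (Star v) := by
  have key : ∀ a : Costar v, ∃ (b : Star v) (y : Path b.1 a.1),
      C v (b.2.toPath.comp (y.cons a.2)) := by
    rintro ⟨w, a⟩
    obtain ⟨y, hy⟩ := hC.exists_of_arrow a
    have hl := hC.two_le_length _ hy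
    have hy' := hC.rotate _ _ hy
    rcases cases_left y with ⟨rfl, rfl⟩ | ⟨l, b, z, rfl⟩
    · simp at hl
    · exact ⟨⟨l, b⟩, z, by simpa using hy'⟩
  choose f y hy using key
  refine ENat.card_le_card_of_injective (f := f) fun a a' haa => ?_
  have h1 := hy a
  have aux : ∀ (b : Star v) (y' : Path b.1 a'.1), f a = b →
      C v (b.2.toPath.comp (y'.cons a'.2)) → a = a' := by
    rintro _ y' rfl h2
    exact (comp_cons_inj (hC.unique _ _ _ h1 h2)).1
  exact aux _ _ haa (hy a')

end CycleSystem

/-! ### The symmetric trace form of a system of cycles. -/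

section Trace

variable (k : Type w) [Field k]

open Classical in
/-- The linear form on the path algebra that takes the value one at the cycles in `C` and zero at all
other paths. -/
def cycleTrace (C : ∀ v : W, Path v v → Prop) : PathAlgebra k W →ₗ[k] k :=
  (basis k).constr k fun x => if ∃ h : x.2.1 = x.1, C x.1 (x.2.2.cast rfl h) then 1 else 0

theorem cycleTrace_of_mem {v : W} {c : Path v v} (h : C v c) : cycleTrace k C (path k c) = 1 := by
  rw [cycleTrace, path, Module.Basis.constr_basis, if_pos ⟨rfl, h⟩]

theorem cycleTrace_of_notMem {v : W} {c : Path v v} (h : ¬ C v c) :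
    cycleTrace k C (path k c) = 0 := by
  rw [cycleTrace, path, Module.Basis.constr_basis, if_neg]
  rintro ⟨h1, h2⟩
  exact h h2

theorem cycleTrace_of_ne {v w : W} (c : Path v w) (h : v ≠ w) :
    cycleTrace k C (path k c) = 0 := by
  rw [cycleTrace, path, Module.Basis.constr_basis, if_neg]
  rintro ⟨h1, -⟩
  exact h h1.symm

/-- On paths this is closure under rotation: `pq` is a cycle if and only if `qp` is one. -/
theorem CycleSystem.cycleTrace_mul_comm (hC : CycleSystem C) (x y : PathAlgebra k W) :
    cycleTrace k C (x * y) = cycleTrace k C (y * x) := by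
  refine induction_path k (P := fun x => cycleTrace k C (x * y) = cycleTrace k C (y * x)) x
    (fun i j p => ?_) (by simp) (fun _ _ h h' => by simp [mul_add, add_mul, h, h'])
    (fun c _ h => by simp only [smul_mul_path_aux, mul_smul_path_aux, map_smul, h])
  refine induction_path k (P := fun y => cycleTrace k C (path k p * y) = cycleTrace k C (y * path k p))
    y (fun i' j' q => ?_) (by simp) (fun _ _ h h' => by simp [mul_add, add_mul, h, h'])
    (fun c _ h => by simp only [smul_mul_path_aux, mul_smul_path_aux, map_smul, h])
  by_cases h : j = i'
  · subst h
    by_cases h' : j' = i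
    · subst h'
      rw [path_mul_path, path_mul_path]
      by_cases hc : C j' (p.comp q)
      · rw [cycleTrace_of_mem k hc, cycleTrace_of_mem k (hC.rotate _ _ hc)]
      · rw [cycleTrace_of_notMem k hc, cycleTrace_of_notMem k fun h => hc (hC.rotate _ _ h)]
    · rw [path_mul_path, path_mul_path_of_ne k _ _ h', cycleTrace_of_ne k _ (Ne.symm h'), map_zero]
  · by_cases h' : j' = i
    · subst h'
      rw [path_mul_path, path_mul_path_of_ne k _ _ h, cycleTrace_of_ne k _ (Ne.symm h), map_zero]
    · rw [path_mul_path_of_ne k _ _ h', path_mul_path_of_ne k _ _ h]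

/-- Multiplying by the complement of a proper initial path of a cycle and taking the trace reads off
a coefficient. -/
theorem CycleSystem.cycleTrace_mul_path (hC : CycleSystem C) {i j : W} {p : Path i j}
    {q : Path j i} (hq : 0 < q.length) (h : C i (p.comp q)) (x : PathAlgebra k W) :
    cycleTrace k C (x * path k q) = (basis k).repr x ⟨i, j, p⟩ := by
  classical
  refine induction_path k (P := fun x => cycleTrace k C (x * path k q) =
    (basis k).repr x ⟨i, j, p⟩) x (fun i' j' r => ?_) (by simp)
    (fun _ _ h h' => by simp [add_mul, h, h'])
    (fun c _ h => by simp [smul_mul_path_aux, h])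
  rw [repr_path_apply]
  by_cases hj : j' = j
  · subst hj
    rw [path_mul_path]
    by_cases hi : i' = i
    · subst hi
      by_cases hr : r = p
      · subst hr
        rw [cycleTrace_of_mem k h, if_pos rfl]
      · rw [cycleTrace_of_notMem k fun h' => hr (hC.cancel_right hq h' h), if_neg]
        simpa using hr
    · rw [cycleTrace_of_ne k _ hi, if_neg]
      intro h; cases h; exact hi rfl
  · rw [path_mul_path_of_ne k _ _ hj, map_zero, if_neg]
    intro h; cases h; exact hj rfl

end Trace

/-! ### The radical of the trace form and its generators. -/

namespace CycleSystem

variable {k : Type w} [Field k] [Fintype W] {K : TwoSidedIdeal (PathAlgebra k W)}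

/-- The recurring hypothesis `hK` says that `K` is the radical of the form `(x, y) ↦ cycleTrace (x *
y)`. A path can pair non-trivially only with a path that closes it to a cycle. -/
theorem path_mem_iff (hK : ∀ x, x ∈ K ↔ ∀ y, cycleTrace k C (x * y) = 0)
    {i j : W} (p : Path i j) : path k p ∈ K ↔ ∀ q : Path j i, ¬ C i (p.comp q) := by
  rw [hK]
  refine ⟨fun h q hq => ?_, fun h y => ?_⟩
  · have := h (path k q)
    rw [path_mul_path, cycleTrace_of_mem k hq] at this
    exact one_ne_zero this
  · refine induction_path k (P := fun y => cycleTrace k C (path k p * y) = 0) y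
      (fun i' j' r => ?_) (by simp) (fun _ _ h h' => by simp [mul_add, h, h'])
      (fun c _ h => by simp [h])
    by_cases hj : j = i'
    · subst hj
      rw [path_mul_path]
      by_cases hi : i = j'
      · subst hi
        exact cycleTrace_of_notMem k (h r)
      · exact cycleTrace_of_ne k _ hi
    · rw [path_mul_path_of_ne k _ _ hj, map_zero]

theorem path_notMem_iff (hK : ∀ x, x ∈ K ↔ ∀ y, cycleTrace k C (x * y) = 0)
    {i j : W} (p : Path i j) : path k p ∉ K ↔ ∃ q : Path j i, C i (p.comp q) := by
  rw [path_mem_iff hK]; push Not; rfl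

theorem path_notMem_of_cycle (hK : ∀ x, x ∈ K ↔ ∀ y, cycleTrace k C (x * y) = 0)
    {i : W} {c : Path i i} (h : C i c) : path k c ∉ K :=
  (path_notMem_iff hK c).2 ⟨Path.nil, h⟩

theorem mul_notMem_iff (hK : ∀ x, x ∈ K ↔ ∀ y, cycleTrace k C (x * y) = 0)
    {i j l : W} (a : i ⟶ j) (b : j ⟶ l) :
    arrow k a * arrow k b ∉ K ↔ ∃ z : Path l i, C i (a.toPath.comp (b.toPath.comp z)) := by
  rw [arrow, arrow, path_mul_path, path_notMem_iff hK]
  simp only [Path.comp_assoc]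

theorem isAdmissible (hC : CycleSystem C)
    (hK : ∀ x, x ∈ K ↔ ∀ y, cycleTrace k C (x * y) = 0) : IsAdmissible K where
  pow_le := by
    obtain ⟨N, hN⟩ := hC.bounded
    refine ⟨N, fun i j p hp => (path_mem_iff hK p).2 fun q hq => ?_⟩
    have := hN _ _ hq
    rw [Path.length_comp] at this
    omega
  le_sq := by
    intro x hx i j p hp
    by_contra hl
    -- A path of length at most one is a proper initial part of some cycle, so its coefficient in
    -- `x` is the trace of `x * q`, which is zero on `K`.
    have key : ∃ q : Path j i, 0 < q.length ∧ C i (p.comp q) := by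
      cases p with
      | nil =>
        obtain ⟨c, hc⟩ := hC.exists_cycle i
        exact ⟨c, by have := hC.two_le_length _ hc; omega, by simpa using hc⟩
      | cons p a =>
        cases p with
        | nil =>
          obtain ⟨y, hy⟩ := hC.exists_of_arrow a
          refine ⟨y, ?_, hy⟩
          have := hC.two_le_length _ hy
          simp at this
          omega
        | cons p b => simp at hl
    obtain ⟨q, hq, hc⟩ := key
    rw [← hC.cycleTrace_mul_path k hq hc] at hp
    exact hp ((hK x).1 hx _)

/-- A cycle with a further arrow is not an initial part of a cycle, by `eq_nil_of_comp`. For an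
arrow in front, a rotation moves it to the end. -/
theorem isMaximalPath_of_cycle (hC : CycleSystem C)
    (hK : ∀ x, x ∈ K ↔ ∀ y, cycleTrace k C (x * y) = 0) {i : W} {c : Path i i} (h : C i c) :
    IsMaximalPath K c := by
  refine ⟨path_notMem_of_cycle hK h, fun l a => ?_, fun l a => ?_⟩
  · rw [arrow, path_mul_path, path_mem_iff hK]
    intro q hq
    rw [Path.comp_assoc] at hq
    have := hC.rotate _ _ hq
    rw [Path.comp_assoc] at this
    have := congrArg Path.length (hC.eq_nil_of_comp h this)
    simp at this
  · rw [arrow, path_mul_path, path_mem_iff hK]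
    intro q hq
    rw [Path.comp_assoc] at hq
    have := congrArg Path.length (hC.eq_nil_of_comp h hq)
    simp at this

/-- The complement of a maximal path in a cycle is trivial, since its first arrow would prolong the
path outside `K`. -/
theorem cycle_of_isMaximalPath (hK : ∀ x, x ∈ K ↔ ∀ y, cycleTrace k C (x * y) = 0)
    {i j : W} {p : Path i j} (h : IsMaximalPath K p) :
    ∃ h : j = i, C i (p.cast rfl h) := by
  obtain ⟨q, hq⟩ := (path_notMem_iff hK p).1 h.1
  rcases cases_left q with ⟨rfl, rfl⟩ | ⟨l, a, r, rfl⟩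
  · exact ⟨rfl, hq⟩
  · refine absurd (h.2.2 l a) ?_
    rw [arrow, path_mul_path, path_notMem_iff hK]
    exact ⟨r, by rwa [Path.comp_assoc]⟩

theorem sub_mem (hC : CycleSystem C) (hK : ∀ x, x ∈ K ↔ ∀ y, cycleTrace k C (x * y) = 0)
    {v : W} {p q : Path v v} (hp : C v p) (hq : C v q) : path k p - path k q ∈ K := by
  -- Cycles are maximal, so every product with a non-trivial path lies in `K`. Only the trivial path
  -- at `v` remains to be paired, and there both traces are one.
  have key : ∀ (p : Path v v), C v p → ∀ (l : W) (a : v ⟶ l), path k p * arrow k a ∈ K :=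
    fun p hp => (hC.isMaximalPath_of_cycle hK hp).2.2
  rw [hK]
  intro y
  refine induction_path k (P := fun y => cycleTrace k C ((path k p - path k q) * y) = 0) y
      (fun i' j' r => ?_) (by simp) (fun _ _ h h' => by simp [mul_add, h, h'])
      (fun c _ h => by simp [h])
  by_cases hi : v = i'
  · subst hi
    rcases cases_left r with ⟨rfl, rfl⟩ | ⟨l, a, r, rfl⟩
    · change cycleTrace k C ((path k p - path k q) * path k Path.nil) = 0
      rw [sub_mul, path_mul_path, path_mul_path, map_sub, Path.comp_nil, Path.comp_nil,
        cycleTrace_of_mem k hp, cycleTrace_of_mem k hq, sub_self]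
    · rw [path_toPath_comp, ← mul_assoc]
      refine (hK _).1 ?_ _
      rw [sub_mul]
      exact K.sub_mem (key _ hp _ _) (key _ hq _ _)
  · rw [sub_mul, path_mul_path_of_ne k _ _ hi, path_mul_path_of_ne k _ _ hi, sub_zero, map_zero]

/-- An element of `K` has zero coefficient at every path outside `K` that is not a cycle, because
such a coefficient is a trace. It is therefore a combination of paths in `K` and cycles, and at each
vertex the coefficients of the cycles sum to zero. -/
theorem le_of_path_mem (hC : CycleSystem C)
    (hK : ∀ x, x ∈ K ↔ ∀ y, cycleTrace k C (x * y) = 0) (J : TwoSidedIdeal (PathAlgebra k W))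
    (h1 : ∀ {i j : W} (p : Path i j), path k p ∈ K → path k p ∈ J)
    (h2 : ∀ {v : W} (p q : Path v v), C v p → C v q → path k p - path k q ∈ J) : K ≤ J := by
  classical
  choose c hc using hC.exists_cycle
  let S : Set (QPath W) := {x | path k x.2.2 ∈ K ∨ ∃ h : x.2.1 = x.1, C x.1 (x.2.2.cast rfl h)}
  -- Modulo `J`, each cycle at `v` is replaced by the chosen cycle `c v`; its total coefficient is
  -- the trace of `x` times the trivial path at `v`, which vanishes for `x` in `K`.
  have key : ∀ x ∈ Submodule.span k (basis k '' S),
      x - ∑ v, cycleTrace k C (x * path k (Quiver.Path.nil : Quiver.Path v v)) • path k (c v) ∈ J := by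
    intro x hx
    induction hx using Submodule.span_induction with
    | zero => simp [J.zero_mem]
    | add x y _ _ h h' =>
      have := J.add_mem h h'
      simp only [add_mul, map_add, add_smul, Finset.sum_add_distrib]
      convert this using 1
      abel
    | smul a x _ h =>
      have := smul_mem_twoSidedIdeal J a h
      rw [smul_sub, Finset.smul_sum] at this
      simpa only [smul_mul_path_aux, map_smul, smul_eq_mul, mul_smul] using this
    | mem x hx =>
      obtain ⟨⟨i, j, p⟩, hp, rfl⟩ := hx
      rw [basis_apply]
      rcases hp with hp | ⟨h, hp⟩
      · have : ∀ v, cycleTrace k C (path k p * path k (Quiver.Path.nil : Quiver.Path v v)) = 0 :=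
          fun v => (hK _).1 hp _
        simp only [this, zero_smul, Finset.sum_const_zero, sub_zero]
        exact h1 p hp
      · obtain rfl : j = i := h
        replace hp : C j p := hp
        dsimp only
        rw [Finset.sum_eq_single j]
        · rw [path_mul_path, Path.comp_nil, cycleTrace_of_mem k hp, one_smul]
          exact h2 _ _ hp (hc j)
        · intro v _ hv
          rw [path_mul_path_of_ne k _ _ hv.symm, map_zero, zero_smul]
        · simp
  intro x hx
  have hx' : x ∈ Submodule.span k (basis k '' S) := by
    rw [Module.Basis.mem_span_image]
    rintro ⟨i, j, p⟩ hp
    by_contra hS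
    simp only [S, Set.mem_ofPred_eq, not_or] at hS
    obtain ⟨q, hq⟩ := (path_notMem_iff hK p).1 hS.1
    rcases cases_left q with ⟨rfl, rfl⟩ | ⟨l, a, r, rfl⟩
    · exact hS.2 ⟨rfl, hq⟩
    · simp only [Finset.mem_coe, Finsupp.mem_support_iff] at hp
      rw [← hC.cycleTrace_mul_path k (by simp) hq] at hp
      exact hp ((hK x).1 hx _)
  have := key x hx'
  simpa only [(hK x).1 hx, zero_smul, Finset.sum_const_zero, sub_zero] using this

/-- Generators of the ideal defined by the trace form of a system of cycles. -/
theorem le_of_relations (hC : CycleSystem C)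
    (hK : ∀ x, x ∈ K ↔ ∀ y, cycleTrace k C (x * y) = 0) (J : TwoSidedIdeal (PathAlgebra k W))
    (h1 : ∀ {i j l : W} (a : i ⟶ j) (b : j ⟶ l), arrow k a * arrow k b ∈ K →
      arrow k a * arrow k b ∈ J)
    (h2 : ∀ {v : W} (p q : Path v v), C v p → C v q → path k p - path k q ∈ J)
    (h3 : ∀ {v w : W} (a : v ⟶ w) (y : Path w v), C v (a.toPath.comp y) →
      path k (a.toPath.comp y) * arrow k a ∈ J) : K ≤ J := by
  refine hC.le_of_path_mem hK J (fun p => ?_) h2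
  induction p with
  | nil =>
    intro h
    obtain ⟨c, hc⟩ := hC.exists_cycle _
    exact absurd (by simpa using hc) ((path_mem_iff hK _).1 h c)
  | @cons j l p b ih =>
    intro h
    by_cases hp : path k p ∈ K
    · rw [path_cons]
      exact J.mul_mem_right _ _ (ih hp)
    obtain ⟨q, hq⟩ := (path_notMem_iff hK p).1 hp
    cases p with
    | nil =>
      obtain ⟨y, hy⟩ := hC.exists_of_arrow b
      exact absurd hy ((path_mem_iff hK _).1 h y)
    | cons p d =>
      by_cases hdb : arrow k d * arrow k b ∈ K
      · rw [path_cons, path_cons, mul_assoc]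
        exact J.mul_mem_left _ _ (h1 _ _ hdb)
      -- Now `d` and `b` are consecutive on the unique cycle through `d`, so `b z = q p`. If `q` is
      -- trivial, then `p d` is a cycle with first arrow `b`, and `h3` applies. Otherwise `q` starts
      -- with `b`, so `p d b` is still part of a cycle and does not lie in `K`.
      obtain ⟨z, hz⟩ := (mul_notMem_iff hK d b).1 hdb
      have hq' : C _ (d.toPath.comp (q.comp p)) := by
        have := hC.rotate p (d.toPath.comp q) (by simpa [← Path.comp_assoc] using hq)
        rwa [Path.comp_assoc] at this
      have e := hC.unique _ _ _ hz hq'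
      rcases cases_left q with ⟨rfl, rfl⟩ | ⟨l', a, r, rfl⟩
      · obtain rfl : b.toPath.comp z = p := by simpa using e
        rw [path_cons]
        exact h3 b (z.cons d) hq
      · rw [Path.comp_assoc] at e
        have e' := (toPath_comp_inj e).1
        cases e'
        refine absurd h ((path_notMem_iff hK _).2 ⟨r, ?_⟩)
        rw [← Path.comp_toPath_eq_cons, Path.comp_assoc]
        exact hq

/-- The only arrows that can follow or precede `a` outside `K` are its neighbours on the unique
cycle through `a`. -/
theorem isSpecialBiserial (hC : CycleSystem C)
    (hK : ∀ x, x ∈ K ↔ ∀ y, cycleTrace k C (x * y) = 0)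
    (hs : ∀ i : W, ENat.card (Star i) ≤ 2) : IsSpecialBiserial K where
  admissible := hC.isAdmissible hK
  card_star_le := hs
  card_costar_le i := (hC.card_costar_le_card_star i).trans (hs i)
  mul_right_unique := by
    intro i j a b hb b' hb'
    obtain ⟨z, hz⟩ := (mul_notMem_iff hK _ _).1 hb
    obtain ⟨z', hz'⟩ := (mul_notMem_iff hK _ _).1 hb'
    exact (toPath_comp_inj (hC.unique _ _ _ hz hz')).1
  mul_left_unique := by
    intro i j a b hb b' hb'
    obtain ⟨z, hz⟩ := (mul_notMem_iff hK _ _).1 hb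
    obtain ⟨z', hz'⟩ := (mul_notMem_iff hK _ _).1 hb'
    have h1 := hC.rotate _ _ hz
    have h2 := hC.rotate _ _ hz'
    rw [Path.comp_assoc] at h1 h2
    exact (comp_cons_inj (hC.unique _ _ _ h1 h2)).1

/-- The trace descends to the quotient. The induced bilinear form is symmetric by rotation and has
zero radical because `K` is the radical upstairs; in finite dimension it identifies the algebra with
its dual. -/
theorem isSymmetricAlgebra (hC : CycleSystem C)
    (hK : ∀ x, x ∈ K ↔ ∀ y, cycleTrace k C (x * y) = 0) (hs : ∀ i : W, Finite (Star i)) :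
    IsSymmetricAlgebra k (BoundQuiverAlgebra K) := by
  have := finite_boundQuiverAlgebra K (hC.isAdmissible hK).pow_le hs
  obtain ⟨t, ht⟩ := exists_factor_toBound K (cycleTrace k C)
    fun x hx => by simpa using (hK x).1 hx 1
  let θ : BoundQuiverAlgebra K →ₗ[k] Module.Dual k (BoundQuiverAlgebra K) :=
    (LinearMap.mul k (BoundQuiverAlgebra K)).compr₂ t
  have hθ : ∀ x y, θ x y = t (x * y) := fun _ _ => rfl
  have htc : ∀ x y, t (x * y) = t (y * x) := by
    intro x y
    obtain ⟨x, rfl⟩ := toBound_surjective K x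
    obtain ⟨y, rfl⟩ := toBound_surjective K y
    rw [← map_mul, ← map_mul, ht, ht, hC.cycleTrace_mul_comm k]
  have hinj : Function.Injective θ := by
    rw [injective_iff_map_eq_zero]
    intro x hx
    obtain ⟨x, rfl⟩ := toBound_surjective K x
    rw [toBound_eq_zero_iff, hK]
    intro y
    rw [← ht, map_mul, ← hθ, hx, LinearMap.zero_apply]
  let e : BoundQuiverAlgebra K ≃ₗ[k] Module.Dual k (BoundQuiverAlgebra K) :=
    LinearEquiv.ofInjectiveOfFinrankEq θ hinj Subspace.dual_finrank_eq.symm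
  refine ⟨e, fun a x b => ?_⟩
  refine DualBimodule.ext fun y => ?_
  change t (a * x * b * y) = t (x * (b * (y * a)))
  rw [mul_assoc, mul_assoc, htc, mul_assoc, mul_assoc]

theorem isSymmetricSpecialBiserial (hC : CycleSystem C)
    (hK : ∀ x, x ∈ K ↔ ∀ y, cycleTrace k C (x * y) = 0)
    (hs : ∀ i : W, ENat.card (Star i) ≤ 2) : IsSymmetricSpecialBiserial K where
  toIsSpecialBiserial := hC.isSpecialBiserial hK hs
  symmetric := hC.isSymmetricAlgebra hK fun i =>
    ENat.card_lt_top.1 ((hs i).trans_lt (ENat.natCast_lt_top 2))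
  generated := by
    refine ⟨{x | (∃ (i j : W) (p : Path i j), path k p ∈ K ∧ x = path k p) ∨
      ∃ (v : W) (p q : Path v v), C v p ∧ C v q ∧ x = path k p - path k q}, le_antisymm ?_ ?_, ?_⟩
    · exact hC.le_of_path_mem hK _
        (fun p hp => TwoSidedIdeal.subset_span (Or.inl ⟨_, _, p, hp, rfl⟩))
        (fun p q hp hq => TwoSidedIdeal.subset_span (Or.inr ⟨_, p, q, hp, hq, rfl⟩))
    · rw [TwoSidedIdeal.span_le]
      rintro x (⟨i, j, p, hp, rfl⟩ | ⟨v, p, q, hp, hq, rfl⟩)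
      · exact hp
      · exact hC.sub_mem hK hp hq
    · rintro x (⟨i, j, p, hp, rfl⟩ | ⟨v, p, q, hp, hq, rfl⟩)
      · exact Or.inl ⟨i, j, p, rfl⟩
      · exact Or.inr ⟨v, v, p, q, path_notMem_of_cycle hK hp, path_notMem_of_cycle hK hq, rfl⟩

end CycleSystem

end CycleSystem

end Gentle
end

noncomputable section
namespace Gentle
open Quiver MulOpposite
open PathAlgebra

/-! ### Uniserial projective modules -/

section Uniserial

variable {k : Type w} [Field k] {W : Type u} [Quiver.{v} W] [Fintype W]
  {K : TwoSidedIdeal (PathAlgebra k W)}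

theorem toBound_mul_mem (N : Submodule (BoundQuiverAlgebra K)ᵐᵒᵖ (BoundQuiverAlgebra K))
    {x : BoundQuiverAlgebra K} (hx : x ∈ N) (y : BoundQuiverAlgebra K) : x * y ∈ N :=
  N.smul_mem (op y) hx

theorem smul_mem_rightSubmodule (N : Submodule (BoundQuiverAlgebra K)ᵐᵒᵖ (BoundQuiverAlgebra K))
    {x : BoundQuiverAlgebra K} (hx : x ∈ N) (c : k) : c • x ∈ N := by
  have := toBound_mul_mem N hx (algebraMap k _ c)
  rwa [← Algebra.commutes, ← Algebra.smul_def] at this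

/-- Elements of `e_v Λ` are combinations of paths that start at `v` and are not in the ideal. -/
theorem exists_finsupp_of_mem_projectiveAt {v : W} {x : BoundQuiverAlgebra K}
    (hx : x ∈ projectiveAt K v) : ∃ X : QPath W →₀ k,
      (∀ p ∈ X.support, p.1 = v ∧ path k p.2.2 ∉ K) ∧
      x = X.sum fun p c => c • toBound K (path k p.2.2) := by
  have key : x ∈ Submodule.span k ((fun p : QPath W => toBound K (path k p.2.2)) ''
      {p | p.1 = v ∧ path k p.2.2 ∉ K}) := by
    obtain ⟨r, rfl⟩ := Submodule.mem_span_singleton.1 hx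
    obtain ⟨r, rfl⟩ := op_surjective r
    obtain ⟨r, rfl⟩ := toBound_surjective K r
    change toBound K (path k (Path.nil : Path v v)) * toBound K r ∈ _
    rw [← map_mul]
    refine induction_path k (P := fun r => toBound K (path k (Path.nil : Path v v) * r) ∈ _) r
      (fun i j p => ?_) (by rw [mul_zero, map_zero]; exact zero_mem _)
      (fun _ _ h h' => by rw [mul_add, map_add]; exact add_mem h h')
      (fun c _ h => by rw [mul_smul_comm, map_smul]; exact Submodule.smul_mem _ _ h)
    by_cases h : v = i
    · subst h
      rw [path_mul_path, Path.nil_comp]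
      by_cases hp : path k p ∈ K
      · rw [(toBound_eq_zero_iff K _).2 hp]
        exact zero_mem _
      · exact Submodule.subset_span ⟨⟨v, j, p⟩, ⟨rfl, hp⟩, rfl⟩
    · rw [path_mul_path_of_ne k _ _ h, map_zero]
      exact zero_mem _
  rw [Finsupp.mem_span_image_iff_linearCombination] at key
  obtain ⟨X, hX, rfl⟩ := key
  exact ⟨X, fun p hp => hX hp, rfl⟩

/-- If the nonzero paths starting at `v` are determined by their lengths, then a submodule that
contains an element with leading term of length `t` contains all paths of length at least `t`. -/
theorem path_mem_of_leading_term {v : W}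
    (hu : ∀ p q : QPath W, p.1 = v → q.1 = v → path k p.2.2 ∉ K → path k q.2.2 ∉ K →
      p.2.2.length = q.2.2.length → p = q)
    (hN : ∃ N : ℕ, ∀ (i j : W) (p : Path i j), N ≤ p.length → path k p ∈ K)
    (N : Submodule (BoundQuiverAlgebra K)ᵐᵒᵖ (BoundQuiverAlgebra K)) (X : QPath W →₀ k)
    (hX : ∀ p ∈ X.support, p.1 = v ∧ path k p.2.2 ∉ K)
    (hXN : (X.sum fun p c => c • toBound K (path k p.2.2)) ∈ N) {p : QPath W}
    (hp : p ∈ X.support) (hmin : ∀ q ∈ X.support, p.2.2.length ≤ q.2.2.length) (q : QPath W)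
    (hq : q.1 = v) (hpq : p.2.2.length ≤ q.2.2.length) : toBound K (path k q.2.2) ∈ N := by
  classical
  obtain ⟨L, hL⟩ := hN
  -- The induction is descending in the length of `q`: paths of length at least `L` vanish.
  obtain ⟨n, hn⟩ : ∃ n, L ≤ q.2.2.length + n := ⟨L, by omega⟩
  induction n generalizing q with
  | zero =>
    rw [(toBound_eq_zero_iff K _).2 (hL _ _ _ hn)]
    exact zero_mem _
  | succ n ih =>
    by_cases hqK : path k q.2.2 ∈ K
    · rw [(toBound_eq_zero_iff K _).2 hqK]
      exact zero_mem _
    obtain ⟨i, j, q⟩ := q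
    obtain rfl : i = v := hq
    obtain ⟨l, q, d, rfl, hl⟩ := exists_comp_of_length_le q hpq
    have hq0 : path k q ∉ K := by
      intro h
      apply hqK
      dsimp only
      rw [← path_mul_path]
      exact K.mul_mem_right _ _ h
    have hpe : p = ⟨i, l, q⟩ := hu _ _ (hX p hp).1 rfl (hX p hp).2 hq0 hl.symm
    subst hpe
    -- Multiplication by `d` turns the leading path into the desired one. All other terms become
    -- zero or strictly longer paths, which lie in `N` by induction and can be subtracted.
    have h1 := toBound_mul_mem N hXN (toBound K (path k d))
    rw [Finsupp.sum, Finset.sum_mul, ← Finset.add_sum_erase _ _ hp] at h1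
    have h2 : ∑ r ∈ X.support.erase ⟨i, l, q⟩,
        X r • toBound K (path k r.2.2) * toBound K (path k d) ∈ N := by
      refine Submodule.sum_mem _ fun r hre => ?_
      obtain ⟨hne, hr⟩ := Finset.mem_erase.1 hre
      rw [smul_mul_assoc, ← map_mul]
      refine smul_mem_rightSubmodule N ?_ _
      by_cases hrl : r.2.1 = l
      · obtain ⟨i', l', r⟩ := r
        obtain rfl : l' = l := hrl
        dsimp only
        rw [path_mul_path]
        have hlt : q.length < r.length := by
          refine lt_of_le_of_ne (hmin _ hr) fun h => hne ?_
          exact hu _ _ (hX _ hr).1 rfl (hX _ hr).2 hq0 h.symm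
        have := hmin _ hr
        refine ih ⟨i', j, r.comp d⟩ (hX _ hr).1 ?_ ?_
        all_goals simp only [Path.length_comp] at *; omega
      · rw [path_mul_path_of_ne k _ _ hrl, map_zero]
        exact zero_mem _
    have h3 := (Submodule.add_mem_iff_left N h2).1 h1
    rw [smul_mul_assoc, ← map_mul, path_mul_path] at h3
    have h4 := smul_mem_rightSubmodule N h3 (X ⟨i, l, q⟩)⁻¹
    rwa [smul_smul, inv_mul_cancel₀ (Finsupp.mem_support_iff.1 hp), one_smul] at h4

/-- An element with shortest path of length `t` generates all paths from `v` of length at least `t`.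
Submodules are thus compared by the shortest lengths that occur in them. -/
theorem isUniserialAt_of_length_injective {v : W}
    (hu : ∀ p q : QPath W, p.1 = v → q.1 = v → path k p.2.2 ∉ K → path k q.2.2 ∉ K →
      p.2.2.length = q.2.2.length → p = q)
    (hN : ∃ N : ℕ, ∀ (i j : W) (p : Path i j), N ≤ p.length → path k p ∈ K) :
    IsUniserialAt K v := by
  intro N N' hNv hNv'
  by_contra! hcon
  obtain ⟨x, hxN, hxN'⟩ := SetLike.not_le_iff_exists.1 hcon.1
  obtain ⟨X, hX, rfl⟩ := exists_finsupp_of_mem_projectiveAt (hNv hxN)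
  have hne : X.support.Nonempty := by
    rw [Finset.nonempty_iff_ne_empty]
    intro h
    rw [Finsupp.support_eq_empty.1 h] at hxN'
    simp at hxN'
  obtain ⟨p, hp, hpm⟩ := X.support.exists_min_image (fun p => p.2.2.length) hne
  refine hcon.2 fun y hy => ?_
  obtain ⟨Y, hY, rfl⟩ := exists_finsupp_of_mem_projectiveAt (hNv' hy)
  rw [Finsupp.sum]
  refine Submodule.sum_mem _ fun q hq => smul_mem_rightSubmodule N ?_ _
  obtain ⟨q', hq', hqm⟩ := Y.support.exists_min_image (fun p => p.2.2.length) ⟨q, hq⟩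
  refine path_mem_of_leading_term hu hN N X hX hxN hp hpm q (hY q hq).1 ?_
  by_contra! hlt
  refine hxN' (Submodule.sum_mem _ fun r hr => smul_mem_rightSubmodule N' ?_ _)
  refine path_mem_of_leading_term hu hN N' Y hY hy hq' hqm r (hX r hr).1 ?_
  have := hpm r hr
  have := hqm q hq
  omega

/-- If `e_v Λ` is uniserial, then at most one arrow starts at `v`. -/
theorem subsingleton_star_of_isUniserialAt (hK : IsAdmissible K) {v : W} (h : IsUniserialAt K v) :
    Subsingleton (Star v) := by
  classical
  have key : ∀ a b : Star v, Submodule.span (BoundQuiverAlgebra K)ᵐᵒᵖ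
      {toBound K (arrow k a.2)} ≤ Submodule.span _ {toBound K (arrow k b.2)} → a = b := by
    intro a b hab
    obtain ⟨r, hr⟩ := Submodule.mem_span_singleton.1 (hab (Submodule.mem_span_singleton_self _))
    obtain ⟨r, rfl⟩ := op_surjective r
    obtain ⟨r, rfl⟩ := toBound_surjective K r
    change toBound K (arrow k b.2) * toBound K r = _ at hr
    rw [← map_mul, eq_comm, ← sub_eq_zero, ← map_sub, toBound_eq_zero_iff] at hr
    by_contra hne
    -- A multiple of `b` has coefficient zero at any other arrow `a`, while an admissible ideal
    -- contains no element with a nonzero coefficient at an arrow.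
    have hz : (basis k).repr (arrow k b.2 * r) ⟨v, a.1, a.2.toPath⟩ = 0 := by
      refine induction_path k (P := fun r => (basis k).repr (arrow k b.2 * r) ⟨v, a.1, a.2.toPath⟩ = 0)
        r (fun i j p => ?_) (by simp) (fun _ _ h h' => by simp [mul_add, h, h'])
        (fun c _ h => by simp [h])
      by_cases hi : b.1 = i
      · subst hi
        rw [← path_toPath_comp, repr_path_apply, if_neg]
        intro he
        have he' : (⟨j, b.2.toPath.comp p⟩ : Σ x, Path v x) = ⟨a.1, a.2.toPath⟩ :=
          eq_of_heq (Sigma.mk.inj he).2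
        obtain ⟨a1, a2⟩ := a
        obtain ⟨rfl, he2⟩ := Sigma.mk.inj he'
        exact hne (toPath_comp_inj (p' := Path.nil) (eq_of_heq he2)).1.symm
      · rw [arrow, path_mul_path_of_ne k _ _ hi, map_zero, Finsupp.zero_apply]
    have := hK.le_sq _ hr v a.1 a.2.toPath
    rw [map_sub, Finsupp.sub_apply, hz, arrow, repr_path_apply, if_pos rfl, sub_zero] at this
    simpa using this one_ne_zero
  have hle : ∀ a : Star v, Submodule.span (BoundQuiverAlgebra K)ᵐᵒᵖ
      {toBound K (arrow k a.2)} ≤ projectiveAt K v := by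
    intro a
    rw [Submodule.span_singleton_le_iff_mem]
    refine Submodule.mem_span_singleton.2 ⟨op (toBound K (arrow k a.2)), ?_⟩
    change toBound K _ * toBound K _ = _
    rw [← map_mul, arrow, path_mul_path, Path.nil_comp]
  refine ⟨fun a b => ?_⟩
  rcases h _ _ (hle a) (hle b) with h' | h'
  · exact key a b h'
  · exact (key b a h').symm

/-- If only one arrow starts at `v`, then there is only one cycle at `v`. The paths from `v` outside
`K` are its initial parts, which are determined by their lengths. -/
theorem CycleSystem.isUniserialAt_iff {C : ∀ v : W, Path v v → Prop} (hC : CycleSystem C)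
    (hK : ∀ x, x ∈ K ↔ ∀ y, cycleTrace k C (x * y) = 0) (v : W) :
    IsUniserialAt K v ↔ Subsingleton (Star v) := by
  refine ⟨subsingleton_star_of_isUniserialAt (hC.isAdmissible hK), fun h => ?_⟩
  refine isUniserialAt_of_length_injective ?_ (hC.isAdmissible hK).pow_le
  rintro ⟨i, j, p⟩ ⟨i', j', q⟩ hi hi' hp hq hl
  obtain rfl : i = v := hi
  obtain rfl : i' = i := hi'
  obtain ⟨z, hz⟩ := (path_notMem_iff hK p).1 hp
  obtain ⟨z', hz'⟩ := (path_notMem_iff hK q).1 hq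
  have huniq : ∀ c c' : Path i' i', C i' c → C i' c' → c = c' := by
    intro c c' hc hc'
    have h1 := hC.two_le_length _ hc
    have h2 := hC.two_le_length _ hc'
    rcases cases_left c with ⟨_, rfl⟩ | ⟨l, a, r, rfl⟩
    · simp at h1
    rcases cases_left c' with ⟨_, rfl⟩ | ⟨l', a', r', rfl⟩
    · simp at h2
    have := Subsingleton.elim (⟨l, a⟩ : Star i') ⟨l', a'⟩
    cases this
    rw [hC.unique _ _ _ hc hc']
  have := comp_eq_comp_of_length (huniq _ _ hz hz') hl
  cases this
  rfl

end Uniserial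

end Gentle
end

noncomputable section
namespace Gentle
open Quiver MulOpposite
open PathAlgebra

/-! ### Gentle bound quivers -/

section GentleBoundQuiver

variable {k : Type w} {V : Type u} [Field k] [Quiver.{v} V] [Fintype V]

theorem path_notMem_of_comp_left {I : TwoSidedIdeal (PathAlgebra k V)} {i j l : V} {p : Path i j}
    {q : Path j l} (h : path k (p.comp q) ∉ I) : path k p ∉ I := fun h' => h <| by
  rw [← path_mul_path]; exact I.mul_mem_right _ _ h'

theorem path_notMem_of_comp_right {I : TwoSidedIdeal (PathAlgebra k V)} {i j l : V} {p : Path i j}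
    {q : Path j l} (h : path k (p.comp q) ∉ I) : path k q ∉ I := fun h' => h <| by
  rw [← path_mul_path]; exact I.mul_mem_left _ _ h'

/-- An ideal generated by paths is spanned by the paths that contain a generator. -/
theorem mem_span_of_mem_span_paths (S : Set (QPath V)) {x : PathAlgebra k V}
    (hx : x ∈ TwoSidedIdeal.span ((fun x : QPath V => path k x.2.2) '' S)) :
    x ∈ Submodule.span k (basis k '' {p : QPath V | ∃ s ∈ S, ∃ (u : Path p.1 s.1)
      (w : Path s.2.1 p.2.1), p.2.2 = u.comp (s.2.2.comp w)}) := by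
  set M := Submodule.span k (basis k '' {p : QPath V | ∃ s ∈ S, ∃ (u : Path p.1 s.1)
      (w : Path s.2.1 p.2.1), p.2.2 = u.comp (s.2.2.comp w)}) with hM
  have hl : ∀ {x y : PathAlgebra k V}, y ∈ M → x * y ∈ M := by
    intro x y hy
    induction hy using Submodule.span_induction with
    | zero => rw [mul_zero]; exact zero_mem _
    | add y z _ _ h h' => rw [mul_add]; exact add_mem h h'
    | smul c y _ h => rw [mul_smul_comm]; exact Submodule.smul_mem _ _ h
    | mem y hy =>
      obtain ⟨⟨i, j, p⟩, ⟨s, hs, u, w, hp⟩, rfl⟩ := hy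
      dsimp only at hp u w
      subst hp
      refine induction_path k (P := fun x => x * _ ∈ M) x (fun i' j' q => ?_)
        (by rw [zero_mul]; exact zero_mem _) (fun _ _ h h' => by rw [add_mul]; exact add_mem h h')
        (fun c _ h => by rw [smul_mul_assoc]; exact Submodule.smul_mem _ _ h)
      by_cases h : j' = i
      · subst h
        rw [basis_apply, path_mul_path]
        exact Submodule.subset_span ⟨⟨i', j, _⟩, ⟨s, hs, q.comp u, w, by simp⟩, rfl⟩
      · rw [basis_apply, path_mul_path_of_ne k _ _ h]
        exact zero_mem _
  have hr : ∀ {x y : PathAlgebra k V}, x ∈ M → x * y ∈ M := by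
    intro y x hy
    induction hy using Submodule.span_induction with
    | zero => rw [zero_mul]; exact zero_mem _
    | add y z _ _ h h' => rw [add_mul]; exact add_mem h h'
    | smul c y _ h => rw [smul_mul_assoc]; exact Submodule.smul_mem _ _ h
    | mem y hy =>
      obtain ⟨⟨i, j, p⟩, ⟨s, hs, u, w, hp⟩, rfl⟩ := hy
      dsimp only at hp u w
      subst hp
      refine induction_path k (P := fun x => _ * x ∈ M) x (fun i' j' q => ?_)
        (by rw [mul_zero]; exact zero_mem _) (fun _ _ h h' => by rw [mul_add]; exact add_mem h h')
        (fun c _ h => by rw [mul_smul_comm]; exact Submodule.smul_mem _ _ h)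
      by_cases h : j = i'
      · subst h
        rw [basis_apply, path_mul_path]
        exact Submodule.subset_span ⟨⟨i, j', _⟩, ⟨s, hs, u, w.comp q, by simp⟩, rfl⟩
      · rw [basis_apply, path_mul_path_of_ne k _ _ h]
        exact zero_mem _
  let J : TwoSidedIdeal (PathAlgebra k V) := TwoSidedIdeal.mk' (M : Set (PathAlgebra k V))
    (zero_mem M) (fun h h' => add_mem h h') (fun h => neg_mem h) hl hr
  have hJ : TwoSidedIdeal.span ((fun x : QPath V => path k x.2.2) '' S) ≤ J := by
    rw [TwoSidedIdeal.span_le]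
    rintro _ ⟨⟨i, j, p⟩, hp, rfl⟩
    rw [SetLike.mem_coe, TwoSidedIdeal.mem_mk']
    exact Submodule.subset_span ⟨⟨i, j, p⟩, ⟨_, hp, Path.nil, Path.nil, by simp⟩, rfl⟩
  have := hJ hx
  rwa [TwoSidedIdeal.mem_mk'] at this

/-! ### Gluing, comparing and completing paths outside a gentle ideal. -/

namespace IsGentle

variable {I : TwoSidedIdeal (PathAlgebra k V)}

/-- The ideal is monomial: it is spanned by the paths that contain a generator. -/
theorem path_mem_of_repr_ne_zero (hI : IsGentle I) {x : PathAlgebra k V} (hx : x ∈ I) (p : QPath V)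
    (hp : (basis k).repr x p ≠ 0) : path k p.2.2 ∈ I := by
  obtain ⟨S, hS, hIS⟩ := hI.generated
  have h := hx
  rw [hIS] at h
  have h := mem_span_of_mem_span_paths S h
  rw [Module.Basis.mem_span_image] at h
  obtain ⟨s, hs, u, w, he⟩ := h (Finsupp.mem_support_iff.2 hp)
  rw [he, ← path_mul_path, ← path_mul_path]
  refine I.mul_mem_left _ _ (I.mul_mem_right _ _ ?_)
  rw [hIS]
  exact TwoSidedIdeal.subset_span ⟨s, hs, rfl⟩

/-- A path in `I` contains a generator of length two. This is either the last pair of arrows or part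
of the path without its last arrow. -/
theorem cons_cons_notMem (hI : IsGentle I) {i j l m : V} {p : Path i j} {b : j ⟶ l} {a : l ⟶ m}
    (h : path k (p.cons b) ∉ I) (h' : arrow k b * arrow k a ∉ I) :
    path k ((p.cons b).cons a) ∉ I := by
  classical
  obtain ⟨S, hS, hIS⟩ := hI.generated
  have hmem : ∀ s ∈ S, path k s.2.2 ∈ I := by
    intro s hs
    rw [hIS]
    exact TwoSidedIdeal.subset_span ⟨s, hs, rfl⟩
  intro hc
  rw [hIS] at hc
  have hc := mem_span_of_mem_span_paths S hc
  rw [Module.Basis.mem_span_image] at hc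
  have hsup : (⟨i, m, (p.cons b).cons a⟩ : QPath V) ∈
      ((basis k).repr (path k ((p.cons b).cons a))).support := by
    rw [Finsupp.mem_support_iff, repr_path_apply, if_pos rfl]
    exact one_ne_zero
  obtain ⟨⟨s1, s2, s⟩, hs, u, w, he⟩ := hc hsup
  have hsl := hS _ hs
  have hsI := hmem _ hs
  dsimp only at u w he hsl hsI
  cases w with
  | nil =>
    rw [Path.comp_nil] at he
    have he2 : p.comp (b.toPath.cons a) = u.comp s := he
    have hl : p.length = u.length := by
      have := congrArg Path.length he2
      simp at this
      omega
    have := comp_eq_comp_of_length he2 hl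
    cases this
    apply h'
    rwa [path_cons] at hsI
  | cons w c =>
    rw [Path.comp_cons, Path.comp_cons] at he
    have he2 := (comp_cons_inj he).2
    obtain ⟨rfl, he3⟩ := Sigma.mk.inj he2
    exact h (by
      rw [eq_of_heq he3, ← path_mul_path, ← path_mul_path]
      exact I.mul_mem_left _ _ (I.mul_mem_right _ _ hsI))

theorem path_nil_notMem (hI : IsGentle I) (i : V) : path k (Path.nil : Path i i) ∉ I := by
  classical
  intro h
  have := hI.admissible.le_sq _ h i i Path.nil
  rw [repr_path_apply, if_pos rfl] at this
  simpa using this one_ne_zero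

theorem arrow_notMem (hI : IsGentle I) {i j : V} (a : i ⟶ j) : arrow k a ∉ I := by
  classical
  intro h
  have := hI.admissible.le_sq _ h i j a.toPath
  rw [arrow, repr_path_apply, if_pos rfl] at this
  simpa using this one_ne_zero

/-- Membership in `I` is decided on pairs of consecutive arrows, and each pair lies in one of the
two paths that overlap in `a`. -/
theorem cons_comp_notMem (hI : IsGentle I) {i j l m : V} {p : Path i j} {a : j ⟶ l} {q : Path l m}
    (h : path k (p.cons a) ∉ I) (h' : path k (a.toPath.comp q) ∉ I) :
    path k ((p.cons a).comp q) ∉ I := by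
  induction q with
  | nil => exact h
  | cons q b ih =>
    have h1 := ih (path_notMem_of_comp_left (q := b.toPath) h')
    cases q with
    | nil =>
      refine hI.cons_cons_notMem h ?_
      rw [arrow, arrow, path_mul_path]
      exact h'
    | cons q c =>
      refine hI.cons_cons_notMem h1 fun hcb => h' ?_
      rw [Path.comp_cons, Path.comp_cons, path_cons, path_cons, mul_assoc]
      exact I.mul_mem_left _ _ hcb

theorem comp_notMem (hI : IsGentle I) {i j l m : V} {p : Path i j} {a : j ⟶ l} {q : Path l m}
    (h : path k (p.comp a.toPath) ∉ I) (h' : path k (a.toPath.comp q) ∉ I) :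
    path k (p.comp (a.toPath.comp q)) ∉ I := by
  rw [← Path.comp_assoc]
  exact hI.cons_comp_notMem h h'

/-- Outside `I`, an arrow determines the next one. The common arrow `a` is needed to start, since
two arrows may leave a vertex. -/
theorem right_compare (hI : IsGentle I) {i j l l' : V} (a : i ⟶ j) (u : Path j l) (u' : Path j l')
    (hu : path k (a.toPath.comp u) ∉ I) (hu' : path k (a.toPath.comp u') ∉ I) :
    (∃ t, u' = u.comp t) ∨ ∃ t, u = u'.comp t := by
  induction u with
  | nil => exact Or.inl ⟨u', by simp⟩
  | @cons l1 l2 u b ih =>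
    rcases ih (path_notMem_of_comp_left (q := b.toPath) hu) with ⟨t, rfl⟩ | ⟨t, rfl⟩
    · rcases cases_left t with ⟨rfl, rfl⟩ | ⟨m, c, t, rfl⟩
      · exact Or.inr ⟨b.toPath, rfl⟩
      -- The arrow `d` that precedes both continuations is the last arrow of `u`, or `a` itself if
      -- `u` is trivial.
      · obtain ⟨x, p, d, hd⟩ : ∃ (x : V) (p : Path i x) (d : x ⟶ l1), a.toPath.comp u = p.cons d := by
          cases u with
          | nil => exact ⟨_, Path.nil, a, rfl⟩
          | cons u d => exact ⟨_, a.toPath.comp u, d, rfl⟩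
        have hdb : arrow k d * arrow k b ∉ I := by
          intro h
          apply hu
          rw [Path.comp_cons, hd, path_cons, path_cons, mul_assoc]
          exact I.mul_mem_left _ _ h
        have hdc : arrow k d * arrow k c ∉ I := by
          intro h
          apply hu'
          rw [← Path.comp_assoc, hd, ← path_mul_path, path_cons, path_toPath_comp,
            mul_assoc, ← mul_assoc (arrow k d)]
          exact I.mul_mem_left _ _ (I.mul_mem_right _ _ h)
        have : (⟨_, b⟩ : Star l1) = ⟨_, c⟩ := hI.mul_right_unique _ _ d hdb hdc
        cases this
        exact Or.inl ⟨t, by rw [← Path.comp_assoc]; rfl⟩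
    · exact Or.inr ⟨t.cons b, rfl⟩

/-- The mirror image of `right_compare`, with the preceding arrow determined by the next one. -/
theorem left_compare (hI : IsGentle I) {i j l l' : V} (a : i ⟶ j) (w : Path l i) (w' : Path l' i)
    (hw : path k (w.comp a.toPath) ∉ I) (hw' : path k (w'.comp a.toPath) ∉ I) :
    (∃ t : Path l' l, w' = t.comp w) ∨ ∃ t : Path l l', w = t.comp w' := by
  induction w using path_induction_left with
  | hnil => exact Or.inl ⟨w', by simp⟩
  | @hcons l1 l2 b w ih =>
    rw [Path.comp_assoc] at hw
    rcases ih (path_notMem_of_comp_right hw) with ⟨t, rfl⟩ | ⟨t, rfl⟩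
    · cases t with
      | nil => exact Or.inr ⟨b.toPath, by simp⟩
      | cons t c =>
        obtain ⟨x, d, p, hd⟩ : ∃ (x : V) (d : l2 ⟶ x) (p : Path x j),
            w.comp a.toPath = d.toPath.comp p := by
          rcases cases_left w with ⟨rfl, rfl⟩ | ⟨x, d, w, rfl⟩
          · exact ⟨_, a, Path.nil, by simp [Hom.toPath]⟩
          · exact ⟨_, d, w.comp a.toPath, by rw [Path.comp_assoc]⟩
        have hdb : arrow k b * arrow k d ∉ I := by
          intro h
          apply hw
          rw [hd, path_toPath_comp, path_toPath_comp, ← mul_assoc]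
          exact I.mul_mem_right _ _ h
        have hdc : arrow k c * arrow k d ∉ I := by
          intro h
          apply hw'
          rw [Path.comp_assoc, hd, ← path_mul_path, path_cons, path_toPath_comp,
            mul_assoc, ← mul_assoc (arrow k c)]
          exact I.mul_mem_left _ _ (I.mul_mem_right _ _ h)
        have hs := hI.mul_left_unique _ _ d
        have : (⟨l1, b⟩ : Costar l2) = ⟨_, c⟩ := hs (x := ⟨l1, b⟩) hdb (y := ⟨_, c⟩) hdc
        cases this
        exact Or.inl ⟨t, by rw [← Path.comp_assoc]; rfl⟩
    · exact Or.inr ⟨b.toPath.comp t, by rw [Path.comp_assoc]⟩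

/-- An arrow has a unique position on a unique maximal path. -/
theorem maximalPath_unique (hI : IsGentle I) {i j l l' r r' : V} {a : i ⟶ j} {w : Path l i}
    {u : Path j r} {w' : Path l' i} {u' : Path j r'}
    (h : IsMaximalPath I (w.comp (a.toPath.comp u)))
    (h' : IsMaximalPath I (w'.comp (a.toPath.comp u'))) :
    (⟨l, w⟩ : Σ x, Path x i) = ⟨l', w'⟩ ∧ (⟨r, u⟩ : Σ x, Path j x) = ⟨r', u'⟩ := by
  -- If `t` started with an arrow `c`, gluing along `a` would prolong the first path by `c` outside
  -- `I`, against its maximality.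
  have aux_right : ∀ {l l' r r' : V} {w : Path l i} {u : Path j r} {w' : Path l' i} (t : Path r r'),
      IsMaximalPath I (w.comp (a.toPath.comp u)) →
      IsMaximalPath I (w'.comp (a.toPath.comp (u.comp t))) →
      (⟨r, u⟩ : Σ x, Path j x) = ⟨r', u.comp t⟩ := by
    intro l l' r r' w u w' t h h'
    rcases cases_left t with ⟨rfl, rfl⟩ | ⟨m, c, t, rfl⟩
    · rfl
    · have h1 := path_notMem_of_comp_right h'.1
      rw [← Path.comp_assoc u, ← Path.comp_assoc] at h1
      have h3 := path_notMem_of_comp_left h1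
      have h2 : path k (w.comp a.toPath) ∉ I := by
        have := h.1
        rw [← Path.comp_assoc] at this
        exact path_notMem_of_comp_left this
      have h4 := hI.comp_notMem h2 h3
      refine absurd (h.2.2 _ c) ?_
      rwa [arrow, path_mul_path, Path.comp_assoc, Path.comp_assoc]
  have aux_left : ∀ {l l' r r' : V} {w : Path l i} {u : Path j r} {u' : Path j r'} (t : Path l' l),
      IsMaximalPath I (w.comp (a.toPath.comp u)) →
      IsMaximalPath I ((t.comp w).comp (a.toPath.comp u')) →
      (⟨l, w⟩ : Σ x, Path x i) = ⟨l', t.comp w⟩ := by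
    intro l l' r r' w u u' t h h'
    cases t with
    | nil => simp
    | cons t c =>
      have h1 := h'.1
      rw [← Path.comp_assoc] at h1
      have h2 := path_notMem_of_comp_left h1
      rw [← Path.comp_toPath_eq_cons, Path.comp_assoc, Path.comp_assoc] at h2
      have h3 := path_notMem_of_comp_right h2
      rw [← Path.comp_assoc] at h3
      have h5 : path k ((c.toPath.comp w).comp (a.toPath.comp u)) ∉ I :=
        hI.comp_notMem h3 (path_notMem_of_comp_right h.1)
      refine absurd (h.2.1 _ c) ?_
      rwa [arrow, path_mul_path, ← Path.comp_assoc]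
  constructor
  · rcases hI.left_compare a w w' (by
      have := h.1; rw [← Path.comp_assoc] at this; exact path_notMem_of_comp_left this) (by
      have := h'.1; rw [← Path.comp_assoc] at this; exact path_notMem_of_comp_left this) with
      ⟨t, rfl⟩ | ⟨t, rfl⟩
    · exact aux_left t h h'
    · exact (aux_left t h' h).symm
  · rcases hI.right_compare a u u' (path_notMem_of_comp_right h.1)
      (path_notMem_of_comp_right h'.1) with ⟨t, rfl⟩ | ⟨t, rfl⟩
    · exact aux_right t h h'
    · exact (aux_right t h' h).symm

/-- Every path that is not in the ideal is part of a maximal path. -/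
theorem exists_maximalPath (hI : IsGentle I) {i j : V} (p : Path i j) (hp : path k p ∉ I) :
    ∃ (l r : V) (w : Path l i) (u : Path j r), IsMaximalPath I (w.comp (p.comp u)) := by
  obtain ⟨N, hN⟩ := hI.admissible.pow_le
  obtain ⟨n, hn⟩ : ∃ n, N ≤ p.length + n := ⟨N, by omega⟩
  induction n generalizing i j with
  | zero => exact absurd (hN _ _ _ hn) hp
  | succ n ih =>
    by_cases hm : IsMaximalPath I p
    · exact ⟨i, j, Path.nil, Path.nil, by simpa using hm⟩
    rw [IsMaximalPath] at hm
    push Not at hm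
    by_cases hl : ∀ (l : V) (α : l ⟶ i), arrow k α * path k p ∈ I
    · obtain ⟨l, α, hα⟩ := hm hp hl
      rw [← path_cons] at hα
      obtain ⟨l', r, w, u, h⟩ := ih (p.cons α) hα (by simp; omega)
      exact ⟨l', r, w, α.toPath.comp u, by rwa [← Path.comp_assoc p]⟩
    · push Not at hl
      obtain ⟨l, α, hα⟩ := hl
      rw [← path_toPath_comp] at hα
      obtain ⟨l', r, w, u, h⟩ := ih (α.toPath.comp p) hα (by simp; omega)
      exact ⟨l', r, w.comp α.toPath, u, by rwa [Path.comp_assoc, ← Path.comp_assoc α.toPath]⟩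

theorem exists_maximalPath_arrow (hI : IsGentle I) {i j : V} (a : i ⟶ j) :
    ∃ (l r : V) (w : Path l i) (u : Path j r), IsMaximalPath I (w.comp (a.toPath.comp u)) :=
  hI.exists_maximalPath a.toPath (hI.arrow_notMem a)

theorem finite_star (hI : IsGentle I) (i : V) : Finite (Star i) :=
  ENat.card_lt_top.1 ((hI.card_star_le i).trans_lt (ENat.natCast_lt_top 2))

theorem finite_costar (hI : IsGentle I) (i : V) : Finite (Costar i) :=
  ENat.card_lt_top.1 ((hI.card_costar_le i).trans_lt (ENat.natCast_lt_top 2))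

/-- A trivial path is prolonged outside `I` by any incident arrow. Hence the trivial elements of
`ExtMaximalPath` come only from `HasTrivialMaximalPath`. -/
theorem length_pos_of_isMaximalPath (hI : IsGentle I)
    (hV : ∀ v : V, Nonempty (Star v) ∨ Nonempty (Costar v)) {i j : V} {p : Path i j}
    (hp : IsMaximalPath I p) : 0 < p.length := by
  cases p with
  | cons p a => simp
  | nil =>
    rcases hV i with ⟨⟨l, a⟩⟩ | ⟨⟨l, a⟩⟩
    · refine absurd (hp.2.2 l a) ?_
      rw [arrow, path_mul_path, Path.nil_comp]
      exact hI.arrow_notMem a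
    · refine absurd (hp.2.1 l a) ?_
      rw [arrow, path_mul_path, Path.comp_nil]
      exact hI.arrow_notMem a

open Classical in
/-- The linear form dual to a path that is not in the ideal. -/
theorem exists_dual_path (hI : IsGentle I) (p : QPath V) (hp : path k p.2.2 ∉ I) :
    ∃ f : DualBimodule k (BoundQuiverAlgebra I), ∀ x : QPath V,
      f (toBound I (path k x.2.2)) = if x = p then 1 else 0 := by
  -- The coordinate form at `p` vanishes on `I` because `I` is monomial and does not contain `p`.
  obtain ⟨f, hf⟩ := exists_factor_toBound I ((basis k).coord p) (fun x hx => by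
    rw [Module.Basis.coord_apply]
    by_contra h
    exact hp (hI.path_mem_of_repr_ne_zero hx p h))
  refine ⟨f, fun x => ?_⟩
  refine (hf _).trans ?_
  rw [Module.Basis.coord_apply, repr_path_apply]

end IsGentle

end GentleBoundQuiver

/-- In a connected quiver with at least one arrow, each vertex is incident with an arrow. -/
theorem nonempty_star_or_costar {V : Type u} [Quiver.{v} V]
    (hconn : Subsingleton (Quiver.WeaklyConnectedComponent V))
    (harrow : ∃ i j : V, Nonempty (i ⟶ j)) (v : V) : Nonempty (Star v) ∨ Nonempty (Costar v) := by
  obtain ⟨i, j, ⟨a⟩⟩ := harrow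
  have key : ∀ (x : Symmetrify V) (_ : @Path (Symmetrify V) _ v x),
      x = v ∨ (Nonempty (Star v) ∨ Nonempty (Costar v)) := by
    intro x p
    induction p with
    | nil => exact Or.inl rfl
    | cons p b ih =>
      rcases ih with rfl | h
      · rcases b with b | b
        · exact Or.inr (Or.inl ⟨⟨_, b⟩⟩)
        · exact Or.inr (Or.inr ⟨⟨_, b⟩⟩)
      · exact Or.inr h
  obtain ⟨p⟩ : Nonempty (@Path (Symmetrify V) _ v i) :=
    WeaklyConnectedComponent.eq v i |>.1 (Subsingleton.elim _ _)
  rcases key i p with rfl | h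
  · exact Or.inl ⟨⟨j, a⟩⟩
  · exact h

end Gentle
end

noncomputable section
namespace Gentle
open Quiver MulOpposite
open PathAlgebra

/-! ### The cycles of the extended quiver -/

section ExtendedQuiver

variable {k : Type w} {V : Type u} [Field k] [Quiver.{v} V] [Fintype V]

open ExtendedQuiver

/-- A path of `Q` as a path of `Q_E`. -/
def oldPath (I : TwoSidedIdeal (PathAlgebra k V)) {i : V} :
    ∀ {j : V}, Path i j → Path (of I i) (of I j)
  | _, Path.nil => Path.nil
  | _, Path.cons p a => (oldPath I p).cons (oldArrow I a)

variable (I : TwoSidedIdeal (PathAlgebra k V))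

theorem oldPath_comp {i j l : V} (p : Path i j) (q : Path j l) :
    oldPath I (p.comp q) = (oldPath I p).comp (oldPath I q) := by
  induction q with
  | nil => rfl
  | cons q a ih => rw [Path.comp_cons, oldPath, oldPath, Path.comp_cons, ih]

theorem length_oldPath {i j : V} (p : Path i j) : (oldPath I p).length = p.length := by
  induction p with
  | nil => rfl
  | cons p a ih => rw [oldPath, Path.length_cons, Path.length_cons, ih]

theorem oldPath_toPath {i j : V} (a : i ⟶ j) : oldPath I a.toPath = (oldArrow I a).toPath := rfl

variable {I}

theorem extendedArrow_cases {x y : V} (a : of I x ⟶ of I y) :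
    (∃ α : x ⟶ y, a = oldArrow I α) ∨
      ∃ (m : Path y x) (hm : IsMaximalPath I m), a = newArrow I m hm := by
  rcases a with α | ⟨m, hm⟩
  · exact Or.inl ⟨α, rfl⟩
  · exact Or.inr ⟨m, hm, rfl⟩

/-- The half-edge of `Γ_A` at a position of a maximal path. -/
def halfEdge {i j : V} (m : Path i j) (hm : IsMaximalPath I m) (n : ℕ) (hn : n < m.length + 1) :
    (gentleGraph I).HalfEdge := ⟨⟨⟨i, j, m⟩, Or.inl hm⟩, ⟨n, hn⟩⟩

theorem next_halfEdge_of_lt {i j : V} {m : Path i j} (hm : IsMaximalPath I m) {n : ℕ}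
    (hn : n < m.length) : (gentleGraph I).next (halfEdge m hm n (by omega)) =
      halfEdge m hm (n + 1) (by omega) :=
  congrArg (Sigma.mk _) (finRotate_of_lt hn)

theorem next_halfEdge_length {i j : V} {m : Path i j} (hm : IsMaximalPath I m) :
    (gentleGraph I).next (halfEdge m hm m.length (by omega)) = halfEdge m hm 0 (by omega) :=
  congrArg (Sigma.mk _) finRotate_last'

/-- The closed path of `Q_E` that runs from a position `x` on a maximal path `m` to the end of `m`,
through the arrow `β_m` back to the start of `m` and from there to the initial position. -/
def IsCycleAt {x : V} (c : Path (of I x) (of I x)) (h : (gentleGraph I).HalfEdge) : Prop :=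
  ∃ (i j : V) (m : Path i j) (hm : IsMaximalPath I m) (q₂ : Path i x) (q₁ : Path x j)
    (e : m = q₂.comp q₁),
    c = ((oldPath I q₁).cons (newArrow I m hm)).comp (oldPath I q₂) ∧
    h = halfEdge m hm q₂.length (by rw [e, Path.length_comp]; omega)

theorem edge_of_isCycleAt {x : V} {c : Path (of I x) (of I x)} {h : (gentleGraph I).HalfEdge}
    (H : IsCycleAt c h) : (gentleGraph I).edge h = x := by
  obtain ⟨i, j, m, hm, q₂, q₁, rfl, rfl, rfl⟩ := H
  exact vertexAt_length_comp q₂ q₁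

theorem length_of_isCycleAt {x : V} {c : Path (of I x) (of I x)} {h : (gentleGraph I).HalfEdge}
    (H : IsCycleAt c h) : c.length = h.1.1.2.2.length + 1 := by
  obtain ⟨i, j, m, hm, q₂, q₁, rfl, rfl, rfl⟩ := H
  simp only [Path.length_comp, Path.length_cons, length_oldPath, halfEdge]
  omega

theorem isMaximalPath_of_isCycleAt {x : V} {c : Path (of I x) (of I x)}
    {h : (gentleGraph I).HalfEdge} (H : IsCycleAt c h) : IsMaximalPath I h.1.1.2.2 := by
  obtain ⟨i, j, m, hm, q₂, q₁, rfl, rfl, rfl⟩ := H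
  exact hm

theorem exists_isCycleAt (h : (gentleGraph I).HalfEdge) (hm : IsMaximalPath I h.1.1.2.2) {x : V}
    (hx : (gentleGraph I).edge h = x) : ∃ c : Path (of I x) (of I x), IsCycleAt c h := by
  obtain ⟨⟨⟨i, j, m⟩, hm'⟩, ⟨n, hn⟩⟩ := h
  obtain ⟨q₂, q₁, he, hl⟩ := exists_comp_vertexAt m (Nat.lt_succ_iff.1 hn) hx
  refine ⟨_, i, j, m, hm, q₂, q₁, he, rfl, ?_⟩
  subst hl
  rfl

/-- The half-edge records `m` and the length of `q₂`, and with them the factorization of `m`. -/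
theorem isCycleAt_unique {x : V} {c c' : Path (of I x) (of I x)} {h : (gentleGraph I).HalfEdge}
    (H : IsCycleAt c h) (H' : IsCycleAt c' h) : c = c' := by
  obtain ⟨i, j, m, hm, q₂, q₁, e, rfl, rfl⟩ := H
  obtain ⟨i', j', m', hm', q₂', q₁', e', rfl, he⟩ := H'
  obtain ⟨he1, he2⟩ := Sigma.mk.inj he
  obtain ⟨rfl, he3⟩ := Sigma.mk.inj (congrArg Subtype.val he1)
  obtain ⟨rfl, he4⟩ := Sigma.mk.inj (eq_of_heq he3)
  obtain rfl := eq_of_heq he4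
  have hl : q₂.length = q₂'.length := Fin.mk.inj (eq_of_heq he2)
  have := comp_eq_comp_of_length (e.symm.trans e') hl
  obtain ⟨_, h2⟩ := Sigma.mk.inj this
  obtain ⟨rfl, rfl⟩ := Prod.mk.inj (eq_of_heq h2)
  rfl

/-- The first arrow of a cycle. -/
theorem isCycleAt_cases {x x' : V} {a : of I x ⟶ of I x'} {y : Path (of I x') (of I x)}
    {h : (gentleGraph I).HalfEdge} (H : IsCycleAt (a.toPath.comp y) h) :
    (∃ (i j : V) (m : Path i j) (hm : IsMaximalPath I m) (q₂ : Path i x) (α : x ⟶ x')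
      (r : Path x' j) (e : m = q₂.comp (α.toPath.comp r)), a = oldArrow I α ∧
      y = ((oldPath I r).cons (newArrow I m hm)).comp (oldPath I q₂) ∧
      h = halfEdge m hm q₂.length (by rw [e, Path.length_comp]; omega)) ∨
    ∃ (m : Path x' x) (hm : IsMaximalPath I m), a = newArrow I m hm ∧ y = oldPath I m ∧
      h = halfEdge m hm m.length (by omega) := by
  obtain ⟨i, j, m, hm, q₂, q₁, e, hc, rfl⟩ := H
  rcases cases_left q₁ with ⟨rfl, rfl⟩ | ⟨l, α, r, rfl⟩
  · right
    obtain rfl : m = q₂ := e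
    obtain ⟨h1, h2⟩ := toPath_comp_inj (a' := newArrow I m hm) (p' := oldPath I m) hc
    obtain ⟨h3, h4⟩ := Sigma.mk.inj h1
    obtain rfl : x' = i := h3
    obtain ⟨-, h6⟩ := Sigma.mk.inj h2
    exact ⟨m, hm, eq_of_heq h4, eq_of_heq h6, rfl⟩
  · left
    have hc' : a.toPath.comp y = (oldArrow I α).toPath.comp
        (((oldPath I r).cons (newArrow I m hm)).comp (oldPath I q₂)) := by
      rw [hc, oldPath_comp, oldPath_toPath, ← Path.comp_cons, Path.comp_assoc]
    obtain ⟨h1, h2⟩ := toPath_comp_inj hc'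
    obtain ⟨h3, h4⟩ := Sigma.mk.inj h1
    obtain rfl : x' = l := h3
    obtain ⟨-, h6⟩ := Sigma.mk.inj h2
    exact ⟨i, j, m, hm, q₂, α, r, e, eq_of_heq h4, eq_of_heq h6, rfl⟩

/-- Rotating a cycle by one arrow moves its half-edge to the successor. -/
theorem isCycleAt_rotate_one {x x' : V} {a : of I x ⟶ of I x'} {y : Path (of I x') (of I x)}
    {h : (gentleGraph I).HalfEdge} (H : IsCycleAt (a.toPath.comp y) h) :
    IsCycleAt (y.comp a.toPath) ((gentleGraph I).next h) := by
  -- An old arrow moves the position one step along `m`; the arrow `β_m` carries it from the end of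
  -- `m` to the start.
  rcases isCycleAt_cases H with ⟨i, j, m, hm, q₂, α, r, e, rfl, rfl, rfl⟩ | ⟨m, hm, rfl, rfl, rfl⟩
  · refine ⟨i, j, m, hm, q₂.comp α.toPath, r, by rw [e, Path.comp_assoc], ?_, ?_⟩
    · rw [oldPath_comp, oldPath_toPath, Path.comp_assoc]
    · rw [next_halfEdge_of_lt hm (by rw [e]; simp only [Path.length_comp, Path.length_toPath]; omega)]
      congr 1
  · exact ⟨x', x, m, hm, Path.nil, m, by simp, rfl, next_halfEdge_length hm⟩

variable (I) in
/-- `IsCycleAt` for a vertex of the extended quiver. -/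
def CycleAt (v : ExtendedQuiver I) (c : Path v v) (h : (gentleGraph I).HalfEdge) : Prop :=
  IsCycleAt (x := (of I).symm v) c h

theorem CycleAt.length_eq {v : ExtendedQuiver I} {c : Path v v} {h : (gentleGraph I).HalfEdge}
    (H : CycleAt I v c h) : c.length = h.1.1.2.2.length + 1 :=
  length_of_isCycleAt (x := (of I).symm v) H

theorem CycleAt.isMaximalPath {v : ExtendedQuiver I} {c : Path v v} {h : (gentleGraph I).HalfEdge}
    (H : CycleAt I v c h) : IsMaximalPath I h.1.1.2.2 := isMaximalPath_of_isCycleAt H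

theorem CycleAt.rotate_one {v w : ExtendedQuiver I} {a : v ⟶ w} {y : Path w v}
    {h : (gentleGraph I).HalfEdge} (H : CycleAt I v (a.toPath.comp y) h) :
    CycleAt I w (y.comp a.toPath) ((gentleGraph I).next h) :=
  isCycleAt_rotate_one (x := (of I).symm v) (x' := (of I).symm w) H

theorem CycleAt.rotate {v w : ExtendedQuiver I} {p : Path v w} {q : Path w v}
    {h : (gentleGraph I).HalfEdge} (H : CycleAt I v (p.comp q) h) :
    CycleAt I w (q.comp p) ((gentleGraph I).next^[p.length] h) := by
  induction p using path_induction_left generalizing h with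
  | hnil => simpa using H
  | @hcons i i' a p ih =>
    rw [Path.comp_assoc] at H
    have := H.rotate_one
    rw [Path.comp_assoc] at this
    have := ih this
    rw [Path.length_comp, Path.length_toPath, add_comm, Function.iterate_add_apply]
    rw [Path.comp_assoc] at this
    exact this

namespace IsGentle

/-- An arrow of `Q` lies on some maximal path, and `β_m` starts at the last position of `m`. -/
theorem isCycleAt_of_arrow (hI : IsGentle I) {x x' : V} (a : of I x ⟶ of I x') :
    ∃ (y : Path (of I x') (of I x)) (h : (gentleGraph I).HalfEdge),
      IsCycleAt (a.toPath.comp y) h := by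
  rcases extendedArrow_cases a with ⟨α, rfl⟩ | ⟨m, hm, rfl⟩
  · obtain ⟨l, r, w, u, hm⟩ := hI.exists_maximalPath_arrow α
    refine ⟨((oldPath I u).cons (newArrow I _ hm)).comp (oldPath I w), _, l, r, _, hm, w,
      α.toPath.comp u, rfl, ?_, rfl⟩
    rw [oldPath_comp, oldPath_toPath, ← Path.comp_cons, Path.comp_assoc]
  · exact ⟨oldPath I m, _, x', x, m, hm, m, Path.nil, rfl, rfl, rfl⟩

/-- The arrow `β_m` records `m`, and an arrow of `Q` has a unique position on a unique maximal path.
This is where gentleness makes the cycles a `CycleSystem`. -/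
theorem isCycleAt_arrow_unique (hI : IsGentle I) {x x' : V} {a : of I x ⟶ of I x'}
    {y y' : Path (of I x') (of I x)} {h h' : (gentleGraph I).HalfEdge}
    (H : IsCycleAt (a.toPath.comp y) h) (H' : IsCycleAt (a.toPath.comp y') h') :
    h = h' ∧ y = y' := by
  rcases isCycleAt_cases H with ⟨i, j, m, hm, q₂, α, r, e, rfl, rfl, rfl⟩ | ⟨m, hm, rfl, rfl, rfl⟩
  · rcases isCycleAt_cases H' with ⟨i', j', m', hm', q₂', α', r', e', he, rfl, rfl⟩ |
      ⟨m', hm', he, rfl, rfl⟩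
    · obtain rfl : α = α' := Sum.inl.inj he
      subst e e'
      obtain ⟨h1, h2⟩ := hI.maximalPath_unique hm hm'
      obtain ⟨rfl, h3⟩ := Sigma.mk.inj h1
      obtain ⟨rfl, h4⟩ := Sigma.mk.inj h2
      obtain rfl := eq_of_heq h3
      obtain rfl := eq_of_heq h4
      exact ⟨rfl, rfl⟩
    · cases he
  · rcases isCycleAt_cases H' with ⟨i', j', m', hm', q₂', α', r', e', he, rfl, rfl⟩ |
      ⟨m', hm', he, rfl, rfl⟩
    · cases he
    · obtain rfl : m = m' := congrArg Subtype.val (Sum.inr.inj he)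
      exact ⟨rfl, rfl⟩

end IsGentle

variable (I) in
/-- The cycles of the extended quiver. -/
def extendedCycle (v : ExtendedQuiver I) (c : Path v v) : Prop :=
  ∃ h, CycleAt I v c h

theorem IsGentle.cycleSystem (hI : IsGentle I)
    (hV : ∀ v : V, Nonempty (Star v) ∨ Nonempty (Costar v)) : CycleSystem (extendedCycle I) where
  rotate p q := fun ⟨_, H⟩ => ⟨_, H.rotate⟩
  exists_of_arrow {v w} a := hI.isCycleAt_of_arrow (x := (of I).symm v) (x' := (of I).symm w) a
  unique {v w} a y y' := fun ⟨_, H⟩ ⟨_, H'⟩ =>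
    (hI.isCycleAt_arrow_unique (x := (of I).symm v) (x' := (of I).symm w) H H').2
  two_le_length c := by
    rintro ⟨h, H⟩
    rw [H.length_eq]
    have := hI.length_pos_of_isMaximalPath hV H.isMaximalPath
    omega
  bounded := by
    obtain ⟨N, hN⟩ := hI.admissible.pow_le
    refine ⟨N + 1, fun v c => ?_⟩
    rintro ⟨h, H⟩
    rw [H.length_eq, Nat.add_lt_add_iff_right]
    by_contra hlt
    exact H.isMaximalPath.1 (hN _ _ _ (not_lt.1 hlt))
  exists_arrow v := by
    rcases hV ((of I).symm v) with ⟨⟨l, a⟩⟩ | ⟨⟨l, a⟩⟩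
    · exact ⟨⟨of I l, oldArrow I a⟩⟩
    -- The maximal path through an arrow that ends at `v` either stops there, so that its new arrow
    -- starts at `v`, or continues with an arrow of `Q`.
    · obtain ⟨l, r, w, u, hm⟩ := hI.exists_maximalPath_arrow a
      rcases cases_left u with ⟨rfl, rfl⟩ | ⟨l', b, u, rfl⟩
      · exact ⟨⟨_, newArrow I _ hm⟩⟩
      · exact ⟨⟨of I l', oldArrow I b⟩⟩

end ExtendedQuiver

end Gentle
end

noncomputable section
namespace Gentle
open Quiver MulOpposite
open PathAlgebra

/-! ### The trivial extension as a quotient of the path algebra of the extended quiver -/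

section TrivialExtension

/-- The linear form `(a, f) ↦ f(1)` on a trivial extension. -/
def trivialExtensionTrace (k : Type u) (A : Type v) [Field k] [Ring A] [Algebra k A] :
    TrivialExtension k A →ₗ[k] k where
  toFun x := x.snd 1
  map_add' _ _ := rfl
  map_smul' _ _ := rfl

variable {k : Type u} {A : Type v} [Field k] [Ring A] [Algebra k A]

theorem trivialExtensionTrace_mul (x y : TrivialExtension k A) :
    trivialExtensionTrace k A (x * y) = y.snd x.fst + x.snd y.fst := by
  change (x * y).snd 1 = _
  rw [TrivSqZeroExt.snd_mul]
  change y.snd (1 * x.fst) + x.snd (y.fst * 1) = _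
  rw [one_mul, mul_one]

/-- Pairing with `(0, f)` detects the first component and pairing with `(b, 0)` the second. -/
theorem eq_zero_of_trivialExtensionTrace {x : TrivialExtension k A}
    (hx : ∀ y, trivialExtensionTrace k A (x * y) = 0) : x = 0 := by
  have h1 : x.fst = 0 := by
    rw [← Module.forall_dual_apply_eq_zero_iff k]
    intro f
    have := hx (TrivSqZeroExt.inr (show DualBimodule k A from f))
    rw [trivialExtensionTrace_mul, TrivSqZeroExt.snd_inr, TrivSqZeroExt.fst_inr] at this
    change f x.fst + x.snd 0 = 0 at this
    have h0 : x.snd 0 = 0 := map_zero (show Module.Dual k A from x.snd)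
    rwa [h0, add_zero] at this
  have h2 : x.snd = 0 := by
    refine DualBimodule.ext fun b => ?_
    have := hx (TrivSqZeroExt.inl b)
    rw [trivialExtensionTrace_mul, TrivSqZeroExt.snd_inl, TrivSqZeroExt.fst_inl] at this
    change 0 + x.snd b = 0 at this
    rwa [zero_add] at this
  exact TrivSqZeroExt.ext h1 h2

end TrivialExtension

section Canonical

variable {k : Type w} {V : Type u} [Field k] [Quiver.{v} V] [Fintype V]
  {I : TwoSidedIdeal (PathAlgebra k V)}

open ExtendedQuiver

theorem dual_ext_path {f g : DualBimodule k (BoundQuiverAlgebra I)}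
    (h : ∀ x : QPath V, f (toBound I (path k x.2.2)) = g (toBound I (path k x.2.2))) : f = g := by
  refine DualBimodule.ext fun x => ?_
  obtain ⟨x, rfl⟩ := toBound_surjective I x
  change (show Module.Dual k (BoundQuiverAlgebra I) from f) _ =
    (show Module.Dual k (BoundQuiverAlgebra I) from g) _
  refine induction_path k (P := fun x => (show Module.Dual k (BoundQuiverAlgebra I) from f)
    (toBound I x) = (show Module.Dual k (BoundQuiverAlgebra I) from g) (toBound I x)) x
    (fun i j p => h ⟨i, j, p⟩) (by rw [map_zero, map_zero, map_zero])
    (fun _ _ h h' => by rw [map_add, map_add, map_add, h, h'])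
    (fun c _ h => by rw [map_smul, map_smul, map_smul, h])

open Classical in
/-- A linear form dual to a path is compatible with the idempotents at the ends of the path. -/
theorem smul_dual_path {i j : V} {m : Path i j} {f : DualBimodule k (BoundQuiverAlgebra I)}
    (hf : ∀ x : QPath V, f (toBound I (path k x.2.2)) = if x = ⟨i, j, m⟩ then 1 else 0) :
    toBound I (path k (Path.nil : Path j j)) • f = f ∧
      op (toBound I (path k (Path.nil : Path i i))) • f = f := by
  have h0 : f 0 = 0 := map_zero (show Module.Dual k (BoundQuiverAlgebra I) from f)
  constructor
  · refine dual_ext_path ?_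
    rintro ⟨a, b, x⟩
    rw [DualBimodule.smul_apply, ← map_mul]
    by_cases h : b = j
    · subst h
      rw [path_mul_path, Path.comp_nil]
    · rw [path_mul_path_of_ne k _ _ h, map_zero, h0, hf, if_neg]
      intro he
      cases he
      exact h rfl
  · refine dual_ext_path ?_
    rintro ⟨a, b, x⟩
    rw [DualBimodule.op_smul_apply, ← map_mul]
    by_cases h : i = a
    · subst h
      rw [path_mul_path, Path.nil_comp]
    · rw [path_mul_path_of_ne k _ _ h, map_zero, h0, hf, if_neg]
      intro he
      cases he
      exact h rfl

/-- For `m` from `i` to `j`, the form `m*` lies in `e_j D(A) e_i`. This is what an arrow from `j` to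
`i` needs in the universal property of the path algebra. -/
theorem IsGentle.exists_isCanonical (hI : IsGentle I) :
    ∃ φ : PathAlgebra k (ExtendedQuiver I) →ₐ[k] TrivialExtension k (BoundQuiverAlgebra I),
      IsCanonical I φ := by
  choose f hf using fun x : {x : QPath V // IsMaximalPath I x.2.2} =>
    hI.exists_dual_path x.1 x.2.1
  let e : ExtendedQuiver I → TrivialExtension k (BoundQuiverAlgebra I) := fun v =>
    TrivSqZeroExt.inl (toBound I (path k (Path.nil : Path ((of I).symm v) _)))
  let a : ∀ ⦃v w : ExtendedQuiver I⦄, (v ⟶ w) → TrivialExtension k (BoundQuiverAlgebra I) :=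
    fun v w => Sum.elim
      (fun α : (of I).symm v ⟶ (of I).symm w => TrivSqZeroExt.inl (toBound I (arrow k α)))
      (fun m => TrivSqZeroExt.inr (f ⟨⟨(of I).symm w, (of I).symm v, m.1⟩, m.2⟩))
  obtain ⟨φ, h0, h1⟩ := exists_lift (k := k) e a
    (fun i => by
      simp only [e]
      rw [← TrivSqZeroExt.inl_mul, ← map_mul, path_mul_path, Path.comp_nil])
    (fun i j hij => by
      simp only [e]
      rw [← TrivSqZeroExt.inl_mul, ← map_mul, path_mul_path_of_ne, map_zero, TrivSqZeroExt.inl_zero]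
      exact hij)
    (by
      have h : toBound I (∑ i : V, path k (Path.nil : Path i i)) = 1 := by
        rw [← one_def, map_one]
      rw [map_sum] at h
      have h' := congrArg (TrivSqZeroExt.inlHom (BoundQuiverAlgebra I)
        (DualBimodule k (BoundQuiverAlgebra I))) h
      rw [map_sum, map_one] at h'
      exact h')
    (fun i j α => by
      rcases α with α | ⟨m, hm⟩
      · simp only [e, a, Sum.elim_inl]
        rw [← TrivSqZeroExt.inl_mul, ← map_mul, arrow, path_mul_path, Path.nil_comp]
      · simp only [e, a, Sum.elim_inr]
        rw [TrivSqZeroExt.inl_mul_inr]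
        exact congrArg TrivSqZeroExt.inr (smul_dual_path (hf ⟨⟨_, _, m⟩, hm⟩)).1)
    (fun i j α => by
      rcases α with α | ⟨m, hm⟩
      · simp only [e, a, Sum.elim_inl]
        rw [← TrivSqZeroExt.inl_mul, ← map_mul, arrow, path_mul_path, Path.comp_nil]
      · simp only [e, a, Sum.elim_inr]
        rw [TrivSqZeroExt.inr_mul_inl]
        exact congrArg TrivSqZeroExt.inr (smul_dual_path (hf ⟨⟨_, _, m⟩, hm⟩)).2)
  exact ⟨φ, fun i => h0 (of I i), fun i j α => h1 (oldArrow I α),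
    fun i j m hm => ⟨f ⟨⟨i, j, m⟩, hm⟩, h1 (newArrow I m hm), hf ⟨⟨i, j, m⟩, hm⟩⟩⟩

namespace IsCanonical

variable {φ : PathAlgebra k (ExtendedQuiver I) →ₐ[k] TrivialExtension k (BoundQuiverAlgebra I)}

theorem map_oldPath (hφ : IsCanonical I φ) {i j : V} (p : Path i j) :
    φ (path k (oldPath I p)) = TrivSqZeroExt.inl (toBound I (path k p)) := by
  induction p with
  | nil => exact hφ.map_vertex i
  | cons p a ih =>
    rw [oldPath, path_cons, map_mul, ih, hφ.map_oldArrow, ← TrivSqZeroExt.inl_mul, ← map_mul,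
      ← path_cons]

open Classical in
/-- The value of the canonical map at a path that contains exactly one new arrow. -/
theorem map_path_newArrow (hφ : IsCanonical I φ) {i j x y : V} {m : Path i j}
    (hm : IsMaximalPath I m) (q₁ : Path x j) (q₂ : Path i y) :
    ∃ g : DualBimodule k (BoundQuiverAlgebra I),
      φ (path k (((oldPath I q₁).cons (newArrow I m hm)).comp (oldPath I q₂))) =
        TrivSqZeroExt.inr g ∧ ∀ (a b : V) (p : Path a b), g (toBound I (path k p)) =
          if ∃ (h : y = a) (h' : b = x), m = q₂.comp ((p.cast h.symm h').comp q₁) then 1 else 0 := by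
  obtain ⟨f, h1, h2⟩ := hφ.map_newArrow i j m hm
  have h0 : f 0 = 0 := map_zero (show Module.Dual k (BoundQuiverAlgebra I) from f)
  -- The form `q₁ m* q₂` sends `p` to `m*(q₂ p q₁)`.
  refine ⟨op (toBound I (path k q₂)) • (toBound I (path k q₁) • f), ?_, ?_⟩
  · rw [← path_mul_path, path_cons, map_mul, map_mul, hφ.map_oldPath, hφ.map_oldPath, h1,
      TrivSqZeroExt.inl_mul_inr, TrivSqZeroExt.inr_mul_inl]
  · intro a b p
    rw [DualBimodule.op_smul_apply, DualBimodule.smul_apply, ← map_mul, ← map_mul]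
    by_cases h : y = a
    · subst h
      by_cases h' : b = x
      · subst h'
        rw [path_mul_path, path_mul_path]
        refine (h2 ⟨i, j, _⟩).trans ?_
        refine if_congr ⟨fun he => ⟨rfl, rfl, ?_⟩, ?_⟩ rfl rfl
        · have := eq_of_heq (Sigma.mk.inj (eq_of_heq (Sigma.mk.inj he).2)).2
          rw [← this, Path.comp_assoc]
          rfl
        · rintro ⟨_, _, he⟩
          rw [he, Path.comp_assoc]
          rfl
      · rw [path_mul_path, path_mul_path_of_ne k _ _ h', map_zero, h0, if_neg]
        rintro ⟨_, h'', -⟩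
        exact h' h''
    · rw [path_mul_path_of_ne k _ _ h, zero_mul, map_zero, h0, if_neg]
      rintro ⟨h'', -⟩
      exact h h''

/-- A path with two new arrows is mapped to zero because `D(A)` has square zero in `T(A)`. -/
theorem path_cases (hφ : IsCanonical I φ) {v w : ExtendedQuiver I} (p : Path v w) :
    (∃ q : Path ((of I).symm v) ((of I).symm w), p = oldPath I q) ∨
    (∃ (i j : V) (m : Path i j) (hm : IsMaximalPath I m) (q₁ : Path ((of I).symm v) j)
      (q₂ : Path i ((of I).symm w)),
      p = ((oldPath I q₁).cons (newArrow I m hm)).comp (oldPath I q₂)) ∨ φ (path k p) = 0 := by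
  induction p with
  | nil => exact Or.inl ⟨Path.nil, rfl⟩
  | @cons w w' p a ih =>
    rcases ih with ⟨q, rfl⟩ | ⟨i, j, m, hm, q₁, q₂, rfl⟩ | h
    · rcases extendedArrow_cases (x := (of I).symm w) (y := (of I).symm w') a with
        ⟨α, rfl⟩ | ⟨m, hm, rfl⟩
      · exact Or.inl ⟨q.cons α, rfl⟩
      · exact Or.inr (Or.inl ⟨_, _, m, hm, q, Path.nil, rfl⟩)
    · rcases extendedArrow_cases (x := (of I).symm w) (y := (of I).symm w') a with
        ⟨α, rfl⟩ | ⟨m', hm', rfl⟩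
      · exact Or.inr (Or.inl ⟨i, j, m, hm, q₁, q₂.cons α, rfl⟩)
      · refine Or.inr (Or.inr ?_)
        obtain ⟨g, hg, -⟩ := hφ.map_path_newArrow hm q₁ q₂
        obtain ⟨f, hf, -⟩ := hφ.map_newArrow _ _ m' hm'
        refine (congrArg φ (path_cons k _ _)).trans ((map_mul φ _ _).trans ?_)
        exact (congrArg₂ (· * ·) hg hf).trans (TrivSqZeroExt.inr_mul_inr _ _ _)
    · refine Or.inr (Or.inr ?_)
      rw [path_cons, map_mul, h, zero_mul]

/-- The pivot of the proof. A path without new arrows lands in `A`, where the form is zero. For `q₁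
β_m q₂` the form is a sum of values at trivial paths, and it is one exactly when `m = q₂ q₁`, that
is, when the path is a cycle. -/
theorem trace_map (hφ : IsCanonical I φ) (x : PathAlgebra k (ExtendedQuiver I)) :
    trivialExtensionTrace k (BoundQuiverAlgebra I) (φ x) = cycleTrace k (extendedCycle I) x := by
  classical
  have hone : ∀ g : DualBimodule k (BoundQuiverAlgebra I),
      g 1 = ∑ i : V, g (toBound I (path k (Path.nil : Path i i))) := by
    intro g
    rw [← map_one (toBound I), one_def, map_sum]
    exact map_sum (show Module.Dual k (BoundQuiverAlgebra I) from g) _ _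
  refine induction_path k (P := fun x => trivialExtensionTrace k (BoundQuiverAlgebra I) (φ x) =
    cycleTrace k (extendedCycle I) x) x (fun v w p => ?_) (by simp)
    (fun _ _ h h' => by rw [map_add, map_add, map_add, h, h'])
    (fun c _ h => by rw [map_smul, map_smul, map_smul, h])
  by_cases hp : ∃ h : w = v, extendedCycle I v (p.cast rfl h)
  · obtain ⟨rfl, h, H⟩ := hp
    have H' := H
    obtain ⟨i, j, m, hm, q₂, q₁, e, hc, rfl⟩ := H
    obtain ⟨g, hg, hg'⟩ := hφ.map_path_newArrow hm q₁ q₂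
    rw [cycleTrace_of_mem k ⟨_, H'⟩]
    have hc' : φ (path k p) = TrivSqZeroExt.inr g :=
      (congrArg (fun p => φ (path k p)) hc).trans hg
    rw [hc']
    change g 1 = 1
    rw [hone, Finset.sum_eq_single ((of I).symm w)]
    · rw [hg', if_pos]
      exact ⟨rfl, rfl, by simpa using e⟩
    · intro b _ hb
      rw [hg', if_neg]
      rintro ⟨h, -⟩
      exact hb h.symm
    · simp
  · have hz : cycleTrace k (extendedCycle I) (path k p) = 0 := by
      by_cases h : v = w
      · subst h
        exact cycleTrace_of_notMem k fun h => hp ⟨rfl, h⟩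
      · exact cycleTrace_of_ne k _ h
    rw [hz]
    rcases hφ.path_cases p with ⟨q, rfl⟩ | ⟨i, j, m, hm, q₁, q₂, rfl⟩ | h
    · exact congrArg _ (hφ.map_oldPath q)
    · obtain ⟨g, hg, hg'⟩ := hφ.map_path_newArrow hm q₁ q₂
      refine (congrArg _ hg).trans ?_
      change g 1 = 0
      rw [hone]
      refine Finset.sum_eq_zero fun a _ => ?_
      rw [hg', if_neg]
      rintro ⟨h, h', e⟩
      refine hp ⟨(of I).symm.injective (h.trans h'), ?_⟩
      subst h
      obtain rfl : w = v := h'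
      exact ⟨_, i, j, m, hm, q₂, q₁, by simpa using e, rfl, rfl⟩
    · rw [h, map_zero]

theorem surjective (hφ : IsCanonical I φ) (hI : IsGentle I) : Function.Surjective φ := by
  classical
  have hinl : ∀ a : BoundQuiverAlgebra I, TrivSqZeroExt.inl a ∈ φ.range := by
    intro a
    obtain ⟨x, rfl⟩ := toBound_surjective I a
    refine induction_path k (P := fun x => TrivSqZeroExt.inl (toBound I x) ∈ φ.range) x
      (fun i j p => ⟨_, hφ.map_oldPath p⟩)
      (by rw [map_zero, TrivSqZeroExt.inl_zero]; exact zero_mem _)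
      (fun _ _ h h' => by rw [map_add, TrivSqZeroExt.inl_add]; exact add_mem h h')
      (fun c _ h => by rw [map_smul, TrivSqZeroExt.inl_smul]; exact Subalgebra.smul_mem _ h c)
  -- Complete `p` to a maximal path `m = w p u`. The image of `u β_m w` is the form that takes `x`
  -- to `m*(w x u)`, which is dual to `p`.
  have hdual : ∀ p : QPath V, path k p.2.2 ∉ I → ∃ g : DualBimodule k (BoundQuiverAlgebra I),
      (TrivSqZeroExt.inr g : TrivialExtension k (BoundQuiverAlgebra I)) ∈ φ.range ∧
      ∀ x : QPath V, g (toBound I (path k x.2.2)) = if x = p then 1 else 0 := by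
    rintro ⟨i, j, p⟩ hp
    obtain ⟨l, r, w, u, hm⟩ := hI.exists_maximalPath p hp
    obtain ⟨g, hg, hg'⟩ := hφ.map_path_newArrow hm u w
    refine ⟨g, ⟨_, hg⟩, ?_⟩
    rintro ⟨a, b, x⟩
    refine (hg' a b x).trans (if_congr ⟨?_, ?_⟩ rfl rfl)
    · rintro ⟨rfl, rfl, e⟩
      rw [Path.comp_inj_right, Path.comp_inj_left] at e
      subst e
      rfl
    · intro h
      cases h
      exact ⟨rfl, rfl, rfl⟩
  have hfin : {x : QPath V | path k x.2.2 ∉ I}.Finite :=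
    finite_paths_notMem I hI.admissible.pow_le hI.finite_star
  choose g hg hg' using hdual
  have hinr : ∀ f : DualBimodule k (BoundQuiverAlgebra I),
      (TrivSqZeroExt.inr f : TrivialExtension k (BoundQuiverAlgebra I)) ∈ φ.range := by
    intro f
    -- Finitely many paths lie outside `I`, and `f` is expanded in the forms dual to them.
    have hf : f = ∑ p : hfin.toFinset, f (toBound I (path k p.1.2.2)) •
        g p.1 (hfin.mem_toFinset.1 p.2) := by
      refine dual_ext_path fun x => ?_
      have h1 : (∑ p : hfin.toFinset, f (toBound I (path k p.1.2.2)) •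
          g p.1 (hfin.mem_toFinset.1 p.2)) (toBound I (path k x.2.2)) =
          ∑ p : hfin.toFinset, f (toBound I (path k p.1.2.2)) *
            g p.1 (hfin.mem_toFinset.1 p.2) (toBound I (path k x.2.2)) :=
        LinearMap.sum_apply _ _ _
      rw [h1]
      simp only [hg']
      by_cases hx : path k x.2.2 ∈ I
      · rw [(toBound_eq_zero_iff I _).2 hx,
          show f 0 = 0 from map_zero (show Module.Dual k (BoundQuiverAlgebra I) from f)]
        refine (Finset.sum_eq_zero fun p _ => ?_).symm
        rw [if_neg, mul_zero]
        rintro rfl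
        exact (hfin.mem_toFinset.1 p.2) hx
      · rw [Finset.sum_eq_single ⟨x, hfin.mem_toFinset.2 hx⟩]
        · simp
        · intro p _ hp
          rw [if_neg, mul_zero]
          rintro rfl
          exact hp rfl
        · simp
    rw [hf]
    have h2 : (TrivSqZeroExt.inr (∑ p : hfin.toFinset, f (toBound I (path k p.1.2.2)) •
        g p.1 (hfin.mem_toFinset.1 p.2)) : TrivialExtension k (BoundQuiverAlgebra I)) =
        ∑ p : hfin.toFinset, f (toBound I (path k p.1.2.2)) •
          TrivSqZeroExt.inr (g p.1 (hfin.mem_toFinset.1 p.2)) := by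
      rw [TrivSqZeroExt.inr_sum]
      exact Finset.sum_congr rfl fun p _ => TrivSqZeroExt.inr_smul _ _ _
    rw [h2]
    exact sum_mem fun p _ => Subalgebra.smul_mem _ (hg _ _) _
  intro t
  rw [← AlgHom.mem_range, ← TrivSqZeroExt.inl_fst_add_inr_snd_eq t]
  exact add_mem (hinl _) (hinr _)

/-- Surjectivity transports the non-degenerate form on `T(A)` back to the path algebra. This
supplies the hypothesis `hK` of the results on `CycleSystem` for `ker φ`. -/
theorem mem_ker_iff (hφ : IsCanonical I φ) (hI : IsGentle I)
    (x : PathAlgebra k (ExtendedQuiver I)) :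
    x ∈ TwoSidedIdeal.ker φ ↔ ∀ y, cycleTrace k (extendedCycle I) (x * y) = 0 := by
  rw [TwoSidedIdeal.mem_ker]
  constructor
  · intro h y
    rw [← hφ.trace_map, map_mul, h, zero_mul, map_zero]
  · intro h
    refine eq_zero_of_trivialExtensionTrace fun t => ?_
    obtain ⟨y, rfl⟩ := hφ.surjective hI t
    rw [← map_mul, hφ.trace_map, h]

end IsCanonical

end Canonical

end Gentle
end

noncomputable section
namespace Gentle
open Quiver MulOpposite
open PathAlgebra

/-! ### Counting half-edges -/

/-- The local count at a vertex where `p` arrows end and `q` arrows start, with `r a b` standing for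
`ab ∉ I`. Gentleness says that each row and each column of `r` is injective into `Bool`, so finitely
many tables remain. -/
theorem card_matching_fin (p q : ℕ) (hp : p ≤ 2) (hq : q ≤ 2) (hpq : 0 < p + q)
    (r : Fin p → Fin q → Bool) (h1 : ∀ a b b', r a b = r a b' → b = b')
    (h2 : ∀ b a a', r a b = r a' b → a = a') :
    q + Fintype.card {a // ∀ b, r a b = false} +
      (if (q = 0 ∧ p = 1) ∨ (q = 1 ∧ p = 0) ∨ (q = 1 ∧ p = 1 ∧ ∀ a b, r a b = true)
        then 1 else 0) = 2 := by
  interval_cases p <;> interval_cases q <;> first | omega | (revert r; decide)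

/-- Two finite sets of at most two elements with a relation such that every element is related to at
most one element and is not related to at most one element. -/
theorem card_matching {α : Type*} {β : Type*} [Finite α] [Finite β] (r : α → β → Prop)
    (hp : Nat.card α ≤ 2) (hq : Nat.card β ≤ 2) (hne : Nonempty β ∨ Nonempty α)
    (h1 : ∀ a b b', (r a b ↔ r a b') → b = b') (h2 : ∀ b a a', (r a b ↔ r a' b) → a = a') :
    Nat.card β + Nat.card {a // ∀ b, ¬ r a b} +
      Nat.card (PLift ((Nat.card β = 0 ∧ Nat.card α = 1) ∨ (Nat.card β = 1 ∧ Nat.card α = 0) ∨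
        (Nat.card β = 1 ∧ Nat.card α = 1 ∧ ∀ a b, r a b))) = 2 := by
  classical
  let e := Finite.equivFin α
  let f := Finite.equivFin β
  have key := card_matching_fin (Nat.card α) (Nat.card β) hp hq (by
    rcases hne with h | h
    · have := Nat.card_pos (α := β); omega
    · have := Nat.card_pos (α := α); omega)
    (fun a b => decide (r (e.symm a) (f.symm b)))
    (fun a b b' h => f.symm.injective (h1 _ _ _ (by simpa using h)))
    (fun b a a' h => e.symm.injective (h2 _ _ _ (by simpa using h)))
  rw [← key]
  congr 1
  · congr 1
    rw [← Nat.card_eq_fintype_card]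
    refine Nat.card_congr (e.subtypeEquiv fun a => ?_)
    simp only [Equiv.symm_apply_apply, decide_eq_false_iff_not]
    exact ⟨fun h b => h _, fun h b => by simpa using h (f b)⟩
  · have hiff : (∀ a b, decide (r (e.symm a) (f.symm b)) = true) ↔ ∀ a b, r a b := by
      simp only [decide_eq_true_eq]
      exact ⟨fun h a b => by simpa using h (e a) (f b), fun h a b => h _ _⟩
    simp only [hiff]
    split_ifs with h
    · have : Unique (PLift ((Nat.card β = 0 ∧ Nat.card α = 1) ∨ (Nat.card β = 1 ∧ Nat.card α = 0) ∨
        (Nat.card β = 1 ∧ Nat.card α = 1 ∧ ∀ a b, r a b))) := ⟨⟨⟨h⟩⟩, fun _ => rfl⟩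
      exact Nat.card_unique
    · have : IsEmpty (PLift ((Nat.card β = 0 ∧ Nat.card α = 1) ∨ (Nat.card β = 1 ∧ Nat.card α = 0) ∨
        (Nat.card β = 1 ∧ Nat.card α = 1 ∧ ∀ a b, r a b))) := ⟨fun x => h x.down⟩
      exact Nat.card_of_isEmpty

section BrauerGraph

variable {k : Type w} {V : Type u} [Field k] [Quiver.{v} V] [Fintype V]
  {I : TwoSidedIdeal (PathAlgebra k V)}

open ExtendedQuiver

namespace IsGentle

/-- Every arrow of `Q_E` starts a cycle. -/
theorem exists_arrowHalfEdge (hI : IsGentle I) : ∃ H : ∀ ⦃v w : ExtendedQuiver I⦄, (v ⟶ w) →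
    (gentleGraph I).HalfEdge, ∀ ⦃v w : ExtendedQuiver I⦄ (a : v ⟶ w),
      ∃ y : Path w v, CycleAt I v (a.toPath.comp y) (H a) := by
  have key : ∀ {v w : ExtendedQuiver I} (a : v ⟶ w), ∃ (h : (gentleGraph I).HalfEdge)
      (y : Path w v), CycleAt I v (a.toPath.comp y) h := by
    intro v w a
    obtain ⟨y, h, H⟩ := hI.isCycleAt_of_arrow (x := (of I).symm v) (x' := (of I).symm w) a
    exact ⟨h, y, H⟩
  choose H hH using fun {v w : ExtendedQuiver I} (a : v ⟶ w) => key a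
  exact ⟨fun v w a => H a, fun v w a => hH a⟩

/-- The half-edge of `Γ_A` at which the cycle that starts with a given arrow of `Q_E` starts. -/
def arrowHalfEdge (hI : IsGentle I) {v w : ExtendedQuiver I} (a : v ⟶ w) :
    (gentleGraph I).HalfEdge := hI.exists_arrowHalfEdge.choose a

theorem exists_cycleAt_arrowHalfEdge (hI : IsGentle I) {v w : ExtendedQuiver I} (a : v ⟶ w) :
    ∃ y : Path w v, CycleAt I v (a.toPath.comp y) (hI.arrowHalfEdge a) :=
  hI.exists_arrowHalfEdge.choose_spec a

theorem arrowHalfEdge_eq (hI : IsGentle I) {v w : ExtendedQuiver I} {a : v ⟶ w} {y : Path w v}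
    {h : (gentleGraph I).HalfEdge} (H : CycleAt I v (a.toPath.comp y) h) :
    hI.arrowHalfEdge a = h := by
  obtain ⟨y', H'⟩ := hI.exists_cycleAt_arrowHalfEdge a
  exact (hI.isCycleAt_arrow_unique (x := (of I).symm v) (x' := (of I).symm w) H' H).1

end IsGentle

theorem CycleAt.edge_eq {v : ExtendedQuiver I} {c : Path v v} {h : (gentleGraph I).HalfEdge}
    (H : CycleAt I v c h) : of I ((gentleGraph I).edge h) = v :=
  edge_of_isCycleAt (x := (of I).symm v) H

theorem CycleAt.unique {v : ExtendedQuiver I} {c c' : Path v v} {h : (gentleGraph I).HalfEdge}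
    (H : CycleAt I v c h) (H' : CycleAt I v c' h) : c = c' :=
  isCycleAt_unique (x := (of I).symm v) H H'

namespace IsGentle

theorem edge_arrowHalfEdge (hI : IsGentle I) {v w : ExtendedQuiver I} (a : v ⟶ w) :
    of I ((gentleGraph I).edge (hI.arrowHalfEdge a)) = v := by
  obtain ⟨y, H⟩ := hI.exists_cycleAt_arrowHalfEdge a
  exact H.edge_eq

theorem edge_next_arrowHalfEdge (hI : IsGentle I) {v w : ExtendedQuiver I} (a : v ⟶ w) :
    of I ((gentleGraph I).edge ((gentleGraph I).next (hI.arrowHalfEdge a))) = w := by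
  obtain ⟨y, H⟩ := hI.exists_cycleAt_arrowHalfEdge a
  exact H.rotate_one.edge_eq

theorem isMaximalPath_arrowHalfEdge (hI : IsGentle I) {v w : ExtendedQuiver I} (a : v ⟶ w) :
    IsMaximalPath I (hI.arrowHalfEdge a).1.1.2.2 := by
  obtain ⟨y, H⟩ := hI.exists_cycleAt_arrowHalfEdge a
  exact H.isMaximalPath

theorem arrowHalfEdge_injective (hI : IsGentle I) {v w w' : ExtendedQuiver I} {a : v ⟶ w}
    {a' : v ⟶ w'} (h : hI.arrowHalfEdge a = hI.arrowHalfEdge a') :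
    (⟨w, a⟩ : Star v) = ⟨w', a'⟩ := by
  obtain ⟨y, H⟩ := hI.exists_cycleAt_arrowHalfEdge a
  obtain ⟨y', H'⟩ := hI.exists_cycleAt_arrowHalfEdge a'
  rw [h] at H
  exact (toPath_comp_inj (H.unique H')).1

theorem exists_arrowHalfEdge_eq (hI : IsGentle I) (h : (gentleGraph I).HalfEdge)
    (hm : IsMaximalPath I h.1.1.2.2) :
    ∃ a : Star (of I ((gentleGraph I).edge h)), hI.arrowHalfEdge a.2 = h := by
  obtain ⟨c, hc⟩ := exists_isCycleAt h hm rfl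
  have hl := length_of_isCycleAt hc
  rcases cases_left c with ⟨_, rfl⟩ | ⟨l, a, y, rfl⟩
  · simp at hl
  · exact ⟨⟨l, a⟩, hI.arrowHalfEdge_eq hc⟩

theorem exists_maximalPath_cons (hI : IsGentle I) {i v : V} (a : i ⟶ v)
    (ha : ∀ b : Star v, arrow k a * arrow k b.2 ∈ I) :
    ∃ (l : V) (w : Path l i), IsMaximalPath I (w.cons a) := by
  obtain ⟨l, r, w, u, hm⟩ := hI.exists_maximalPath_arrow a
  rcases cases_left u with ⟨rfl, rfl⟩ | ⟨r', b, u, rfl⟩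
  · exact ⟨l, w, hm⟩
  · have := path_notMem_of_comp_right hm.1
    rw [← Path.comp_assoc] at this
    have := path_notMem_of_comp_left this
    rw [← path_mul_path] at this
    exact absurd (ha ⟨_, b⟩) this

/-- A new arrow starting at `v` is given by a maximal path that ends at `v`. Such a path is
determined by its last arrow, and an arrow ending at `v` occurs as a last arrow exactly when all its
products with arrows starting at `v` lie in `I`. -/
theorem card_star_extendedQuiver_aux (hI : IsGentle I)
    (hV : ∀ v : V, Nonempty (Star v) ∨ Nonempty (Costar v)) (v : V) :
    Nonempty (Star v ⊕ {a : Costar v // ∀ b : Star v, arrow k a.2 * arrow k b.2 ∈ I} ≃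
      Star (of I v)) := by
  choose l w hw using fun a : {a : Costar v // ∀ b : Star v, arrow k a.2 * arrow k b.2 ∈ I} =>
    hI.exists_maximalPath_cons a.1.2 a.2
  refine ⟨Equiv.ofBijective (Sum.elim (fun α => ⟨of I α.1, oldArrow I α.2⟩)
    (fun a => ⟨of I (l a), newArrow I _ (hw a)⟩)) ⟨?_, ?_⟩⟩
  · rintro (⟨x, α⟩ | a) (⟨x', α'⟩ | a') h
    · obtain ⟨h1, h2⟩ := Sigma.mk.inj h
      obtain rfl : x = x' := h1
      obtain rfl : α = α' := Sum.inl.inj (eq_of_heq h2)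
      rfl
    · obtain ⟨h1, h2⟩ := Sigma.mk.inj h
      obtain rfl : x = l a' := h1
      cases eq_of_heq h2
    · obtain ⟨h1, h2⟩ := Sigma.mk.inj h
      obtain rfl : l a = x' := h1
      cases eq_of_heq h2
    · obtain ⟨h1, h2⟩ := Sigma.mk.inj h
      have key : ∀ (x x' : V) (m : Path x v) (m' : Path x' v) (hm : IsMaximalPath I m)
          (hm' : IsMaximalPath I m') (_ : x = x')
          (_ : newArrow I m hm ≍ newArrow I m' hm'), (⟨x, m⟩ : Σ x, Path x v) = ⟨x', m'⟩ := by
        rintro x _ m m' hm hm' rfl h2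
        obtain rfl : m = m' := congrArg Subtype.val (Sum.inr.inj (eq_of_heq h2))
        rfl
      have h3 := key _ _ _ _ (hw a) (hw a') h1 h2
      have h4 : ∀ (x x' : V) (p : Path x a.1.1) (p' : Path x' a'.1.1),
          (⟨x, p.cons a.1.2⟩ : Σ x, Path x v) = ⟨x', p'.cons a'.1.2⟩ → a.1 = a'.1 := by
        intro x x' p p' h
        obtain ⟨rfl, h⟩ := Sigma.mk.inj h
        exact (comp_cons_inj (eq_of_heq h)).1
      exact congrArg Sum.inr (Subtype.ext (h4 _ _ _ _ h3))
  · rintro ⟨x, a⟩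
    rcases extendedArrow_cases (x := v) (y := (of I).symm x) a with ⟨α, rfl⟩ | ⟨m, hm, rfl⟩
    · exact ⟨Sum.inl ⟨_, α⟩, rfl⟩
    · have hl := hI.length_pos_of_isMaximalPath hV hm
      cases m with
      | nil => simp at hl
      | @cons y _ m a =>
        have ha : ∀ b : Star v, arrow k a * arrow k b.2 ∈ I := by
          intro b
          by_contra hb
          have h1 := hI.cons_cons_notMem hm.1 hb
          rw [path_cons] at h1
          exact h1 (hm.2.2 _ _)
        refine ⟨Sum.inr ⟨⟨y, a⟩, ha⟩, ?_⟩
        have h2 := (hI.maximalPath_unique (w := w ⟨⟨y, a⟩, ha⟩) (w' := m) (a := a)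
          (u := Path.nil) (u' := Path.nil) (hw ⟨⟨y, a⟩, ha⟩) hm).1
        have key : ∀ (z : V) (m' : Path z y) (hm' : IsMaximalPath I (m'.cons a)),
            (⟨z, m'⟩ : Σ x, Path x y) = ⟨(of I).symm x, m⟩ →
            (⟨of I z, newArrow I _ hm'⟩ : Star (of I v)) = ⟨x, newArrow I _ hm⟩ := by
          rintro z m' hm' h
          cases h
          rfl
        exact key _ _ _ h2

/-- A half-edge on a non-trivial maximal path corresponds to the first arrow of its cycle. The only
other half-edge possible at `v` belongs to the trivial maximal path. -/
theorem card_halfEdge_aux (hI : IsGentle I)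
    (hV : ∀ v : V, Nonempty (Star v) ∨ Nonempty (Costar v)) (v : V) :
    Nonempty (Star (of I v) ⊕ PLift (HasTrivialMaximalPath I v) ≃
      {h : (gentleGraph I).HalfEdge // (gentleGraph I).edge h = v}) := by
  refine ⟨Equiv.ofBijective (Sum.elim
    (fun a => ⟨hI.arrowHalfEdge a.2, hI.edge_arrowHalfEdge a.2⟩)
    (fun t => ⟨⟨⟨⟨v, v, Path.nil⟩, Or.inr ⟨v, rfl, t.down⟩⟩, 0⟩, rfl⟩)) ⟨?_, ?_⟩⟩
  · have hne : ∀ (a : Star (of I v)) (t : HasTrivialMaximalPath I v) (n : Fin 1),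
        hI.arrowHalfEdge a.2 ≠ ⟨⟨⟨v, v, Path.nil⟩, Or.inr ⟨v, rfl, t⟩⟩, n⟩ := by
      intro a t n h
      have h1 := hI.length_pos_of_isMaximalPath hV (hI.isMaximalPath_arrowHalfEdge a.2)
      rw [h] at h1
      simp at h1
    rintro (a | t) (a' | t') h
    · exact congrArg Sum.inl (hI.arrowHalfEdge_injective (congrArg Subtype.val h))
    · exact absurd (congrArg Subtype.val h) (hne a t'.down 0)
    · exact absurd (congrArg Subtype.val h).symm (hne a' t.down 0)
    · exact congrArg Sum.inr (Subsingleton.elim t t')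
  · rintro ⟨h, rfl⟩
    rcases h.1.2 with hm | ⟨i, he, ht⟩
    · obtain ⟨a, ha⟩ := hI.exists_arrowHalfEdge_eq h hm
      exact ⟨Sum.inl a, Subtype.ext ha⟩
    · obtain ⟨⟨x, hx⟩, n⟩ := h
      dsimp only at he
      subst he
      have hn : n = 0 := Subsingleton.elim (α := Fin 1) _ _
      subst hn
      exact ⟨Sum.inr ⟨ht⟩, rfl⟩

theorem finite_star_extendedQuiver (hI : IsGentle I)
    (hV : ∀ v : V, Nonempty (Star v) ∨ Nonempty (Costar v)) (v : V) :
    Finite (Star (of I v)) := by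
  obtain ⟨e⟩ := hI.card_star_extendedQuiver_aux hV v
  have := hI.finite_star v
  have := hI.finite_costar v
  exact Finite.of_equiv _ e

theorem card_star_add_card_trivial (hI : IsGentle I)
    (hV : ∀ v : V, Nonempty (Star v) ∨ Nonempty (Costar v)) (v : V) :
    Nat.card (Star (of I v)) + Nat.card (PLift (HasTrivialMaximalPath I v)) = 2 := by
  obtain ⟨e⟩ := hI.card_star_extendedQuiver_aux hV v
  have := hI.finite_star v
  have := hI.finite_costar v
  have hs := hI.card_star_le v
  have hc := hI.card_costar_le v
  rw [ENat.card_eq_coe_natCard] at hs hc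
  have hs' : Nat.card (Star v) ≤ 2 := by exact_mod_cast hs
  have hc' : Nat.card (Costar v) ≤ 2 := by exact_mod_cast hc
  have key := card_matching (α := Costar v) (β := Star v)
    (fun a b => arrow k a.2 * arrow k b.2 ∉ I) hc' hs' (hV v)
    -- Two arrows with the same status after `a` agree: by the gentle condition if the products are
    -- zero relations, by the special biserial one if not.
    (fun a b b' h => by
      by_cases hb : arrow k a.2 * arrow k b.2 ∈ I
      · exact hI.rel_right_unique _ _ a.2 hb (by simpa [hb] using h)
      · exact hI.mul_right_unique _ _ a.2 hb (h.1 hb))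
    (fun b a a' h => by
      by_cases hb : arrow k a.2 * arrow k b.2 ∈ I
      · exact hI.rel_left_unique _ _ b.2 hb (by simpa [hb] using h)
      · exact hI.mul_left_unique _ _ b.2 hb (h.1 hb))
  rw [← Nat.card_congr e, Nat.card_sum, ← key]
  congr 1
  · congr 1
    refine Nat.card_congr (Equiv.subtypeEquivRight fun a => ?_)
    simp only [not_not]
  · refine Nat.card_congr (Equiv.plift.trans (Equiv.trans ?_ Equiv.plift.symm))
    refine Equiv.ofIff ?_
    rw [HasTrivialMaximalPath, ENat.card_eq_coe_natCard, ENat.card_eq_coe_natCard]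
    norm_cast

theorem card_star_extendedQuiver_le (hI : IsGentle I)
    (hV : ∀ v : V, Nonempty (Star v) ∨ Nonempty (Costar v)) (v : ExtendedQuiver I) :
    ENat.card (Star v) ≤ 2 := by
  have := hI.card_star_add_card_trivial hV ((of I).symm v)
  have hf := hI.finite_star_extendedQuiver hV ((of I).symm v)
  change Finite (Star v) at hf
  change Nat.card (Star v) + _ = 2 at this
  rw [ENat.card_eq_coe_natCard]
  have : Nat.card (Star v) ≤ 2 := by omega
  exact_mod_cast this

/-- The number of arrows and the number of trivial maximal paths add up to two, and the latter is at
most one. This later translates uniseriality into the presence of a trivial maximal path. -/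
theorem subsingleton_star_iff (hI : IsGentle I)
    (hV : ∀ v : V, Nonempty (Star v) ∨ Nonempty (Costar v)) (v : V) :
    Subsingleton (Star (of I v)) ↔ HasTrivialMaximalPath I v := by
  have h := hI.card_star_add_card_trivial hV v
  have hf := hI.finite_star_extendedQuiver hV v
  rw [← Finite.card_le_one_iff_subsingleton]
  constructor
  · intro h1
    by_contra ht
    have : IsEmpty (PLift (HasTrivialMaximalPath I v)) := ⟨fun x => ht x.down⟩
    rw [Nat.card_of_isEmpty (α := PLift (HasTrivialMaximalPath I v))] at h
    omega
  · intro ht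
    have : Nonempty (PLift (HasTrivialMaximalPath I v)) := ⟨⟨ht⟩⟩
    have hpos : 0 < Nat.card (PLift (HasTrivialMaximalPath I v)) :=
      Nat.card_pos_iff.2 ⟨this, inferInstance⟩
    omega

theorem card_halfEdge (hI : IsGentle I)
    (hV : ∀ v : V, Nonempty (Star v) ∨ Nonempty (Costar v)) (v : V) :
    Nat.card {h : (gentleGraph I).HalfEdge // (gentleGraph I).edge h = v} = 2 := by
  obtain ⟨e⟩ := hI.card_halfEdge_aux hV v
  have := hI.finite_star_extendedQuiver hV v
  rw [← Nat.card_congr e, Nat.card_sum, hI.card_star_add_card_trivial hV]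

end IsGentle

/-! ### The cyclic orders and the connectedness of `Γ_A`. -/

theorem gentleGraph_next_iterate (m : ExtMaximalPath I) (n : ℕ)
    (i : Fin (m.1.2.2.length + 1)) :
    (gentleGraph I).next^[n] ⟨m, i⟩ = ⟨m, (finRotate (m.1.2.2.length + 1))^[n] i⟩ := by
  induction n with
  | zero => rfl
  | succ n ih =>
    refine (Function.iterate_succ_apply' _ _ _).trans
      ((congrArg (gentleGraph I).next ih).trans (congrArg (Sigma.mk m) ?_))
    exact (Function.iterate_succ_apply' _ _ _).symm

theorem gentleGraph_vert_iterate (n : ℕ) (h : (gentleGraph I).HalfEdge) :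
    (gentleGraph I).vert ((gentleGraph I).next^[n] h) = (gentleGraph I).vert h := by
  obtain ⟨m, i⟩ := h
  exact congrArg Sigma.fst (gentleGraph_next_iterate m n i)

theorem exists_iterate_next_eq {h h' : (gentleGraph I).HalfEdge}
    (e : (gentleGraph I).vert h = (gentleGraph I).vert h') :
    ∃ n < h.1.1.2.2.length + 1, (gentleGraph I).next^[n] h = h' := by
  obtain ⟨m, i⟩ := h
  obtain ⟨m', i'⟩ := h'
  obtain rfl : m = m' := e
  -- The difference is taken cyclically, modulo the number of positions.
  refine ⟨((i' - i : Fin _) : ℕ), Fin.isLt _, ?_⟩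
  refine (gentleGraph_next_iterate m _ i).trans (congrArg (Sigma.mk m) ?_)
  rw [← finCycle_eq_finRotate_iterate, finCycle_apply, add_sub_cancel]

theorem gentleGraph_vert_eq_iff (h h' : (gentleGraph I).HalfEdge) :
    (gentleGraph I).vert h = (gentleGraph I).vert h' ↔ (gentleGraph I).next.SameCycle h h' := by
  constructor
  · intro e
    obtain ⟨n, -, hn⟩ := exists_iterate_next_eq e
    exact ⟨n, by rw [zpow_natCast, Equiv.Perm.coe_pow, hn]⟩
  · rintro ⟨n, hn⟩
    obtain ⟨n, rfl | rfl⟩ := n.eq_nat_or_neg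
    · rw [← hn, zpow_natCast, Equiv.Perm.coe_pow, gentleGraph_vert_iterate]
    · rw [zpow_neg, zpow_natCast, Equiv.Perm.inv_eq_iff_eq] at hn
      rw [hn, Equiv.Perm.coe_pow, gentleGraph_vert_iterate]

theorem IsGentle.isBrauerGraph (hI : IsGentle I)
    (hconn : Subsingleton (Quiver.WeaklyConnectedComponent V))
    (harrow : ∃ i j : V, Nonempty (i ⟶ j)) : (gentleGraph I).IsBrauerGraph := by
  have hV := nonempty_star_or_costar hconn harrow
  have hne : Nonempty (gentleGraph I).HalfEdge := by
    obtain ⟨i, j, ⟨a⟩⟩ := harrow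
    exact ⟨hI.arrowHalfEdge (oldArrow I a)⟩
  have harr : ∀ {i j : V} (_ : i ⟶ j), ∃ h h' : (gentleGraph I).HalfEdge,
      (gentleGraph I).edge h = i ∧ (gentleGraph I).edge h' = j ∧
      (gentleGraph I).vert h = (gentleGraph I).vert h' := fun {i j} a =>
    ⟨hI.arrowHalfEdge (oldArrow I a), (gentleGraph I).next (hI.arrowHalfEdge (oldArrow I a)),
      hI.edge_arrowHalfEdge (oldArrow I a), hI.edge_next_arrowHalfEdge (oldArrow I a), rfl⟩
  -- A walk in `Q` is followed in `Γ_A`: an arrow joins two edges with a common vertex, and changing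
  -- the half-edge within an edge is a step between adjacent vertices.
  have hpath : ∀ (i j : Symmetrify V) (_ : @Path (Symmetrify V) _ i j)
      (h h' : (gentleGraph I).HalfEdge), (gentleGraph I).edge h = i → (gentleGraph I).edge h' = j →
      Relation.ReflTransGen (fun x y => ∃ h h', (gentleGraph I).edge h = (gentleGraph I).edge h' ∧
        (gentleGraph I).vert h = x ∧ (gentleGraph I).vert h' = y)
        ((gentleGraph I).vert h) ((gentleGraph I).vert h') := by
    intro i j p
    induction p with
    | nil =>
      intro h h' h1 h2
      exact Relation.ReflTransGen.single ⟨h, h', h1.trans h2.symm, rfl, rfl⟩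
    | @cons b c p a ih =>
      intro h h' h1 h2
      obtain ⟨g, g', hg, hg', e⟩ : ∃ g g' : (gentleGraph I).HalfEdge,
          (gentleGraph I).edge g = b ∧ (gentleGraph I).edge g' = c ∧
          (gentleGraph I).vert g = (gentleGraph I).vert g' := by
        rcases a with a | a
        · exact harr a
        · obtain ⟨g, g', hg, hg', e⟩ := harr a
          exact ⟨g', g, hg', hg, e.symm⟩
      have := ih h g h1 hg
      rw [e] at this
      exact this.tail ⟨g', h', hg'.trans h2.symm, rfl, rfl⟩
  have hsurj : Function.Surjective (gentleGraph I).vert := fun m => ⟨⟨m, 0⟩, rfl⟩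
  refine ⟨inferInstance, ?_, hI.card_halfEdge hV, hsurj, gentleGraph_vert_eq_iff,
    fun _ => Nat.one_pos, ⟨(gentleGraph I).vert hne.some⟩, fun x y => ?_⟩
  · have hfin : Finite {x : QPath V // path k x.2.2 ∉ I} :=
      (finite_paths_notMem I hI.admissible.pow_le hI.finite_star).to_subtype
    refine Finite.of_injective (β := {x : QPath V // path k x.2.2 ∉ I})
      (fun m : ExtMaximalPath I => ⟨m.1, ?_⟩) fun m m' h => Subtype.ext (congrArg (fun x => x.1) h)
    rcases m.2 with h | ⟨i, h, -⟩
    · exact h.1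
    · rw [h]
      exact hI.path_nil_notMem i
  · obtain ⟨h, rfl⟩ := hsurj x
    obtain ⟨h', rfl⟩ := hsurj y
    obtain ⟨p⟩ : Nonempty (@Path (Symmetrify V) _ ((gentleGraph I).edge h)
        ((gentleGraph I).edge h')) :=
      (WeaklyConnectedComponent.eq _ _).1 (Subsingleton.elim _ _)
    exact hpath _ _ p h h' rfl rfl

end BrauerGraph

end Gentle
end

noncomputable section
namespace Gentle
open Quiver MulOpposite
open PathAlgebra

/-! ### The Brauer graph algebra of the graph of a gentle algebra -/

theorem nonempty_algEquiv_of_ker_eq {k : Type*} {A B C : Type*} [CommSemiring k] [Ring A] [Ring B]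
    [Ring C] [Algebra k A] [Algebra k B] [Algebra k C] (f : A →ₐ[k] B) (g : A →ₐ[k] C)
    (hf : Function.Surjective f) (hg : Function.Surjective g) (h : ∀ x, f x = 0 ↔ g x = 0) :
    Nonempty (B ≃ₐ[k] C) := by
  have key : ∀ x y, f x = f y ↔ g x = g y := fun x y => by
    rw [← sub_eq_zero, ← map_sub, h, map_sub, sub_eq_zero]
  have hs : ∀ x, g (Function.surjInv hf (f x)) = g x := fun x =>
    (key _ _).1 (Function.surjInv_eq hf _)
  let F : B →ₐ[k] C :=
    { toFun := fun b => g (Function.surjInv hf b)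
      map_one' := by rw [← map_one f, hs, map_one]
      map_zero' := by rw [← map_zero f, hs, map_zero]
      map_mul' := fun a b => by
        obtain ⟨a, rfl⟩ := hf a
        obtain ⟨b, rfl⟩ := hf b
        rw [← map_mul, hs, hs, hs, map_mul]
      map_add' := fun a b => by
        obtain ⟨a, rfl⟩ := hf a
        obtain ⟨b, rfl⟩ := hf b
        rw [← map_add, hs, hs, hs, map_add]
      commutes' := fun c => by rw [← f.commutes, hs, g.commutes] }
  refine ⟨AlgEquiv.ofBijective F ⟨fun a b hab => ?_, fun c => ?_⟩⟩
  · obtain ⟨a, rfl⟩ := hf a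
    obtain ⟨b, rfl⟩ := hf b
    change g (Function.surjInv hf (f a)) = g (Function.surjInv hf (f b)) at hab
    rw [hs, hs] at hab
    exact (key _ _).2 hab
  · obtain ⟨a, rfl⟩ := hg c
    exact ⟨f a, hs a⟩

theorem leftInverse_of_path {k : Type w} {V : Type u} [Field k] [Quiver.{v} V] [Fintype V]
    {B : Type*} [Ring B] [Algebra k B] (f : PathAlgebra k V →ₐ[k] B)
    (g : B →ₐ[k] PathAlgebra k V)
    (h0 : ∀ i : V, g (f (path k (Path.nil : Path i i))) = path k (Path.nil : Path i i))
    (h1 : ∀ ⦃i j : V⦄ (α : i ⟶ j), g (f (arrow k α)) = arrow k α) (x : PathAlgebra k V) :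
    g (f x) = x :=
  DFunLike.congr_fun (algHom_ext (f := g.comp f) (g := AlgHom.id k _) h0 h1) x

theorem val_iterate_finRotate (n d : ℕ) (i : Fin (n + 1)) :
    ((finRotate (n + 1))^[d] i : ℕ) = (i + d) % (n + 1) := by
  induction d with
  | zero => simp [Nat.mod_eq_of_lt i.isLt]
  | succ d ih =>
    rw [Function.iterate_succ_apply', finRotate_apply, Fin.val_add, ih, Fin.val_one',
      ← Nat.add_mod, add_assoc]

theorem RibbonGraph.arr_val {E : Type u} (k : Type w) [Field k] (Γ : RibbonGraph.{u, v} E)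
    {i j : Γ.QuiverVertex} (b : i ⟶ j) : Γ.arr k b.1 = arrow k b := by
  obtain ⟨h, rfl, rfl, hh⟩ := b
  exact dif_neg hh

section GentleGraph

variable {k : Type w} {V : Type u} [Field k] [Quiver.{v} V] [Fintype V]
  {I : TwoSidedIdeal (PathAlgebra k V)}

open ExtendedQuiver

theorem minimalPeriod_next (h : (gentleGraph I).HalfEdge) :
    Function.minimalPeriod (gentleGraph I).next h = h.1.1.2.2.length + 1 := by
  obtain ⟨m, i⟩ := h
  have key : ∀ d, Function.IsPeriodicPt (gentleGraph I).next d (⟨m, i⟩ : (gentleGraph I).HalfEdge) ↔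
      m.1.2.2.length + 1 ∣ d := by
    intro d
    rw [← Nat.modEq_zero_iff_dvd]
    constructor
    · intro h
      have h1 := (gentleGraph_next_iterate m d i).symm.trans h
      have h2 := congrArg Fin.val (eq_of_heq (Sigma.mk.inj h1).2)
      rw [val_iterate_finRotate] at h2
      refine Nat.ModEq.add_left_cancel' i ?_
      rw [Nat.ModEq, h2, add_zero, Nat.mod_eq_of_lt i.isLt]
    · intro h
      refine (gentleGraph_next_iterate m d i).trans (congrArg (Sigma.mk m) (Fin.ext ?_))
      rw [val_iterate_finRotate]
      exact Eq.trans (Nat.ModEq.add_left i.val h) (Nat.mod_eq_of_lt i.isLt)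
  exact Nat.dvd_antisymm (Function.IsPeriodicPt.minimalPeriod_dvd ((key _).2 dvd_rfl))
    ((key _).1 (Function.isPeriodicPt_minimalPeriod _ _))

theorem gentleGraph_truncated_iff (h : (gentleGraph I).HalfEdge) :
    (gentleGraph I).Truncated h ↔ h.1.1.2.2.length = 0 := by
  have h1 : (gentleGraph I).Truncated h ↔ (gentleGraph I).next h = h := and_iff_left rfl
  rw [h1, ← Function.IsFixedPt, ← Function.minimalPeriod_eq_one_iff_isFixedPt, minimalPeriod_next]
  omega

namespace IsGentle

/-- Truncated half-edges are those at trivial paths, so the others are exactly those at which a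
cycle of `Q_E` starts. -/
theorem not_truncated_iff (hI : IsGentle I)
    (hV : ∀ v : V, Nonempty (Star v) ∨ Nonempty (Costar v)) (h : (gentleGraph I).HalfEdge) :
    ¬ (gentleGraph I).Truncated h ↔ IsMaximalPath I h.1.1.2.2 := by
  rw [gentleGraph_truncated_iff]
  constructor
  · intro h1
    rcases h.1.2 with h2 | ⟨i, h2, -⟩
    · exact h2
    · rw [h2] at h1
      exact absurd rfl h1
  · intro h1
    exact (hI.length_pos_of_isMaximalPath hV h1).ne'

theorem exists_arrow_of_not_truncated (hI : IsGentle I)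
    (hV : ∀ v : V, Nonempty (Star v) ∨ Nonempty (Costar v)) {h : (gentleGraph I).HalfEdge}
    (hh : ¬ (gentleGraph I).Truncated h) {v : ExtendedQuiver I}
    (hv : of I ((gentleGraph I).edge h) = v) :
    ∃ (w : ExtendedQuiver I) (a : v ⟶ w) (y : Path w v), hI.arrowHalfEdge a = h ∧
      CycleAt I v (a.toPath.comp y) h := by
  subst hv
  obtain ⟨⟨w, a⟩, h1⟩ := hI.exists_arrowHalfEdge_eq h ((hI.not_truncated_iff hV h).1 hh)
  obtain ⟨y, H⟩ := hI.exists_cycleAt_arrowHalfEdge a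
  dsimp only at h1
  rw [h1] at H
  exact ⟨w, a, y, h1, H⟩

/-- A vertex of `Q_E` as a vertex of the quiver of `Γ_A`. -/
def _root_.Gentle.brauerVertex (v : ExtendedQuiver I) : (gentleGraph I).QuiverVertex := (of I).symm v

/-- The arrows of the quiver of `Γ_A` are the arrows of `Q_E`. -/
def arrowEquiv (hI : IsGentle I) (hV : ∀ v : V, Nonempty (Star v) ∨ Nonempty (Costar v))
    (v w : ExtendedQuiver I) :
    (v ⟶ w) ≃ (brauerVertex v ⟶ brauerVertex w) :=
  Equiv.ofBijective (fun a => ⟨hI.arrowHalfEdge a, hI.edge_arrowHalfEdge a,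
    hI.edge_next_arrowHalfEdge a, (hI.not_truncated_iff hV _).2 (hI.isMaximalPath_arrowHalfEdge a)⟩)
    ⟨fun a b hab => eq_of_heq (Sigma.mk.inj
      (hI.arrowHalfEdge_injective (congrArg Subtype.val hab))).2, by
      rintro ⟨h, h0, h1, h2⟩
      obtain ⟨x, a, -, rfl, -⟩ := hI.exists_arrow_of_not_truncated hV h2 (v := v) h0
      obtain rfl : x = w := (hI.edge_next_arrowHalfEdge a).symm.trans h1
      exact ⟨a, rfl⟩⟩

theorem exists_algHom_brauerGraph (hI : IsGentle I)
    (hV : ∀ v : V, Nonempty (Star v) ∨ Nonempty (Costar v)) :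
    ∃ (G : PathAlgebra k (ExtendedQuiver I) →ₐ[k] PathAlgebra k (gentleGraph I).QuiverVertex)
      (G' : PathAlgebra k (gentleGraph I).QuiverVertex →ₐ[k] PathAlgebra k (ExtendedQuiver I)),
      (∀ x, G (G' x) = x) ∧ (∀ x, G' (G x) = x) ∧
      (∀ v : ExtendedQuiver I, G (path k (Path.nil : Path v v)) =
        path k (Path.nil : Path (brauerVertex v) _)) ∧
      ∀ ⦃v w : ExtendedQuiver I⦄ (a : v ⟶ w),
        G (arrow k a) = (gentleGraph I).arr k (hI.arrowHalfEdge a) := by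
  obtain ⟨G, hG0, hG1⟩ := exists_lift (k := k) (V := ExtendedQuiver I)
    (B := PathAlgebra k (gentleGraph I).QuiverVertex)
    (fun v => path k (Path.nil : Path (brauerVertex v) _))
    (fun v w a => arrow k (hI.arrowEquiv hV v w a))
    (fun i => path_mul_path k _ _) (fun i j hij => path_mul_path_of_ne k _ _ hij) rfl
    (fun i j α => (path_mul_path k _ _).trans (by rw [Path.nil_comp]; rfl))
    (fun i j α => (path_mul_path k _ _))
  obtain ⟨G', hG0', hG1'⟩ := exists_lift (k := k) (V := (gentleGraph I).QuiverVertex)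
    (B := PathAlgebra k (ExtendedQuiver I))
    (fun v => path k (Path.nil : Path (of I v) _))
    (fun v w a => arrow k ((hI.arrowEquiv hV (of I v) (of I w)).symm a))
    (fun i => path_mul_path k _ _) (fun i j hij => path_mul_path_of_ne k _ _ hij) rfl
    (fun i j α => (path_mul_path k _ _).trans (by rw [Path.nil_comp]; rfl))
    (fun i j α => (path_mul_path k _ _))
  refine ⟨G, G', fun x => ?_, fun x => ?_, hG0, fun v w a => (hG1 a).trans ?_⟩
  · refine leftInverse_of_path G' G (fun i => ?_) (fun i j α => ?_) x
    · exact (congrArg G (hG0' i)).trans (hG0 _)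
    · refine (congrArg G (hG1' α)).trans ((hG1 _).trans ?_)
      exact congrArg (arrow k) (Equiv.apply_symm_apply _ _)
  · refine leftInverse_of_path G G' (fun i => ?_) (fun i j α => ?_) x
    · exact (congrArg G' (hG0 i)).trans (hG0' _)
    · refine (congrArg G' (hG1 α)).trans ((hG1' _).trans ?_)
      exact congrArg (arrow k) (Equiv.symm_apply_apply _ _)
  · exact ((gentleGraph I).arr_val k (hI.arrowEquiv hV v w a)).symm

end IsGentle

namespace IsGentle

variable {G : PathAlgebra k (ExtendedQuiver I) →ₐ[k] PathAlgebra k (gentleGraph I).QuiverVertex}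

/-- Each arrow moves the half-edge to its successor. The factor at the trivial path is needed
because the empty product is one, not an idempotent at `v`. -/
theorem map_path_of_cycleAt (hI : IsGentle I)
    (hG1 : ∀ ⦃v w : ExtendedQuiver I⦄ (a : v ⟶ w),
        G (arrow k a) = (gentleGraph I).arr k (hI.arrowHalfEdge a))
    {v w : ExtendedQuiver I} (p : Path v w) (z : Path w v) {h : (gentleGraph I).HalfEdge}
    (H : CycleAt I v (p.comp z) h) :
    G (path k p) = G (path k (Path.nil : Path v v)) *
      ((List.range p.length).map fun n => (gentleGraph I).arr k ((gentleGraph I).next^[n] h)).prod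
      := by
  induction p with
  | nil => simp
  | cons p a ih =>
    have H' : CycleAt I v (p.comp (a.toPath.comp z)) h := by
      rwa [← Path.comp_assoc]
    rw [path_cons, map_mul, ih _ H', Path.length_cons, List.range_succ, List.map_append,
      List.prod_append, List.map_singleton, List.prod_singleton, mul_assoc, hG1]
    have H'' := H'.rotate
    rw [Path.comp_assoc] at H''
    rw [hI.arrowHalfEdge_eq H'']

theorem map_cycle (hI : IsGentle I)
    (hG1 : ∀ ⦃v w : ExtendedQuiver I⦄ (a : v ⟶ w),
        G (arrow k a) = (gentleGraph I).arr k (hI.arrowHalfEdge a))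
    {v : ExtendedQuiver I} {c : Path v v} {h : (gentleGraph I).HalfEdge}
    (H : CycleAt I v c h) : G (path k c) = (gentleGraph I).cyclePow k h := by
  have h1 := hI.map_path_of_cycleAt hG1 c Path.nil H
  have hl := H.length_eq
  rcases cases_left c with ⟨_, rfl⟩ | ⟨w, a, y, rfl⟩
  · simp at hl
  · have h2 : path k (Path.nil : Path v v) * arrow k a = arrow k a := by
      rw [arrow, path_mul_path, Path.nil_comp]
    rw [h1, RibbonGraph.cyclePow, minimalPeriod_next, ← hl]
    change _ = ((List.range (1 * _)).map _).prod
    rw [one_mul, Path.length_comp, Path.length_toPath, add_comm, List.range_succ_eq_map,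
      List.map_cons, List.prod_cons, ← mul_assoc]
    congr 1
    change _ * (gentleGraph I).arr k h = (gentleGraph I).arr k h
    rw [← hI.arrowHalfEdge_eq H, ← hG1, ← map_mul, h2]

/-- The product of two arrows of `Q_E` is not a zero relation if and only if the arrows follow each
other around a vertex of `Γ_A`. -/
theorem mul_notMem_iff_next (hI : IsGentle I) {K : TwoSidedIdeal (PathAlgebra k (ExtendedQuiver I))}
    (hK : ∀ x, x ∈ K ↔ ∀ y, cycleTrace k (extendedCycle I) (x * y) = 0)
    (hV : ∀ v : V, Nonempty (Star v) ∨ Nonempty (Costar v))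
    {v w x : ExtendedQuiver I} (a : v ⟶ w) (b : w ⟶ x) :
    arrow k a * arrow k b ∉ K ↔
      hI.arrowHalfEdge b = (gentleGraph I).next (hI.arrowHalfEdge a) := by
  rw [CycleSystem.mul_notMem_iff hK]
  constructor
  · rintro ⟨z, h, H⟩
    have H' := H.rotate_one
    rw [Path.comp_assoc] at H'
    rw [hI.arrowHalfEdge_eq H, hI.arrowHalfEdge_eq H']
  · intro h
    obtain ⟨y, H⟩ := hI.exists_cycleAt_arrowHalfEdge a
    have hl := (hI.cycleSystem hV).two_le_length _ ⟨_, H⟩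
    rcases cases_left y with ⟨rfl, rfl⟩ | ⟨l, b', z, rfl⟩
    · simp at hl
    · have H' := H.rotate_one
      rw [Path.comp_assoc] at H'
      have h1 := hI.arrowHalfEdge_injective (h.trans (hI.arrowHalfEdge_eq H').symm)
      cases h1
      exact ⟨z, _, H⟩

theorem exists_other_halfEdge (hI : IsGentle I)
    (hV : ∀ v : V, Nonempty (Star v) ∨ Nonempty (Costar v)) (h : (gentleGraph I).HalfEdge) :
    ∃ h', (gentleGraph I).edge h = (gentleGraph I).edge h' ∧ h ≠ h' := by
  have hc := hI.card_halfEdge hV ((gentleGraph I).edge h)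
  have : Finite {h' : (gentleGraph I).HalfEdge // (gentleGraph I).edge h' = (gentleGraph I).edge h} :=
    Nat.finite_of_card_ne_zero (by omega)
  have : Nontrivial {h' : (gentleGraph I).HalfEdge //
      (gentleGraph I).edge h' = (gentleGraph I).edge h} :=
    Finite.one_lt_card_iff_nontrivial.1 (by omega)
  obtain ⟨⟨h', h1⟩, h2⟩ := exists_ne (⟨h, rfl⟩ : {h' : (gentleGraph I).HalfEdge //
      (gentleGraph I).edge h' = (gentleGraph I).edge h})
  exact ⟨h', h1.symm, fun h3 => h2 (Subtype.ext h3.symm)⟩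

/-- By `le_of_relations` it suffices to find three kinds of elements in the preimage `J`. The first
two are the `zero` and `comm` relations; a cycle followed by its first arrow is a `trunc` relation
if the other end of the edge is truncated. -/
theorem map_mem_span_rel (hI : IsGentle I) {K : TwoSidedIdeal (PathAlgebra k (ExtendedQuiver I))}
    (hK : ∀ x, x ∈ K ↔ ∀ y, cycleTrace k (extendedCycle I) (x * y) = 0)
    (hV : ∀ v : V, Nonempty (Star v) ∨ Nonempty (Costar v))
    (hG1 : ∀ ⦃v w : ExtendedQuiver I⦄ (a : v ⟶ w),
        G (arrow k a) = (gentleGraph I).arr k (hI.arrowHalfEdge a))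
    {x : PathAlgebra k (ExtendedQuiver I)} (hx : x ∈ K) :
    G x ∈ TwoSidedIdeal.span {x | (gentleGraph I).Rel k x} := by
  have hC := hI.cycleSystem hV
  set J := (TwoSidedIdeal.span {x | (gentleGraph I).Rel k x}).comap G with hJ
  have hmem : ∀ x, x ∈ J ↔ G x ∈ TwoSidedIdeal.span {x | (gentleGraph I).Rel k x} := fun x =>
    TwoSidedIdeal.mem_comap _
  rw [← hmem]
  have hnt : ∀ {v w : ExtendedQuiver I} (a : v ⟶ w),
      ¬ (gentleGraph I).Truncated (hI.arrowHalfEdge a) := fun a =>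
    (hI.not_truncated_iff hV _).2 (hI.isMaximalPath_arrowHalfEdge a)
  have h1 : ∀ {i j l : ExtendedQuiver I} (a : i ⟶ j) (b : j ⟶ l), arrow k a * arrow k b ∈ K →
      arrow k a * arrow k b ∈ J := by
    intro i j l a b hab
    rw [hmem, map_mul, hG1, hG1]
    refine TwoSidedIdeal.subset_span (.zero _ _ ?_ (fun h => ?_) (hnt a) (hnt b))
    · exact (hI.edge_arrowHalfEdge b).trans (hI.edge_next_arrowHalfEdge a).symm
    · exact (hI.mul_notMem_iff_next hK hV a b).2 h hab
  have h2 : ∀ {v : ExtendedQuiver I} (p q : Path v v), extendedCycle I v p → extendedCycle I v q →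
      path k p - path k q ∈ J := by
    rintro v p q ⟨h, H⟩ ⟨h', H'⟩
    by_cases hh : h = h'
    · subst hh
      rw [H.unique H', sub_self]
      exact zero_mem _
    · rw [hmem, map_sub, hI.map_cycle hG1 H, hI.map_cycle hG1 H']
      exact TwoSidedIdeal.subset_span (.comm _ _ (H.edge_eq.trans H'.edge_eq.symm) hh
        ((hI.not_truncated_iff hV _).2 H.isMaximalPath)
        ((hI.not_truncated_iff hV _).2 H'.isMaximalPath))
  refine hC.le_of_relations hK J h1 h2 ?_ hx
  rintro v w a y ⟨h, H⟩
  obtain ⟨h', he, hne⟩ := hI.exists_other_halfEdge hV h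
  have ha := hI.arrowHalfEdge_eq H
  by_cases ht : (gentleGraph I).Truncated h'
  · rw [hmem, map_mul, hI.map_cycle hG1 H, hG1, ha]
    exact TwoSidedIdeal.subset_span (.trunc h h' he hne
      ((hI.not_truncated_iff hV _).2 H.isMaximalPath) ht)
  · obtain ⟨w', a', y', -, H'⟩ := hI.exists_arrow_of_not_truncated hV ht
      (v := v) (he.symm.trans H.edge_eq)
    -- If neither end is truncated, the cycle may be replaced by the one at the other end. The last
    -- arrow `b` of that cycle and `a` are not consecutive: otherwise `a` would start both cycles,
    -- and the half-edges would agree.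
    have h3 : path k (a'.toPath.comp y') * arrow k a ∈ J := by
      cases hy : a'.toPath.comp y' with
      | nil => simpa using congrArg Path.length hy
      | cons p b =>
        rw [path_cons, mul_assoc]
        refine TwoSidedIdeal.mul_mem_left _ _ _ (h1 _ _ ?_)
        by_contra hb
        rw [hI.mul_notMem_iff_next hK hV, ha] at hb
        have H₁ : CycleAt I v (p.comp b.toPath) h' := by
          rw [hy] at H'
          exact H'
        have H₂ := H₁.rotate.rotate_one
        rw [← hI.arrowHalfEdge_eq H₁.rotate, ← hb,
          show p.comp b.toPath = a'.toPath.comp y' from hy.symm] at H₂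
        exact hne ((hI.arrowHalfEdge_eq H₂).symm.trans (hI.arrowHalfEdge_eq H'))
    have h4 := TwoSidedIdeal.mul_mem_right J _ (arrow k a) (h2 _ _ ⟨_, H⟩ ⟨_, H'⟩)
    rw [sub_mul] at h4
    simpa using add_mem h4 h3

theorem mem_of_map_mem_span_rel (hI : IsGentle I)
    {K : TwoSidedIdeal (PathAlgebra k (ExtendedQuiver I))}
    (hK : ∀ x, x ∈ K ↔ ∀ y, cycleTrace k (extendedCycle I) (x * y) = 0)
    (hV : ∀ v : V, Nonempty (Star v) ∨ Nonempty (Costar v))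
    (hG1 : ∀ ⦃v w : ExtendedQuiver I⦄ (a : v ⟶ w),
        G (arrow k a) = (gentleGraph I).arr k (hI.arrowHalfEdge a))
    {G' : PathAlgebra k (gentleGraph I).QuiverVertex →ₐ[k] PathAlgebra k (ExtendedQuiver I)}
    (hG : ∀ x, G' (G x) = x) {x : PathAlgebra k (ExtendedQuiver I)}
    (hx : G x ∈ TwoSidedIdeal.span {x | (gentleGraph I).Rel k x}) : x ∈ K := by
  have hC := hI.cycleSystem hV
  have key : TwoSidedIdeal.span {x | (gentleGraph I).Rel k x} ≤ K.comap G' := by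
    rw [TwoSidedIdeal.span_le]
    intro r hr
    change r ∈ K.comap G'
    rw [TwoSidedIdeal.mem_comap]
    induction hr with
    | comm h h' he hne ht ht' =>
      obtain ⟨w, a, y, -, H⟩ := hI.exists_arrow_of_not_truncated hV ht rfl
      obtain ⟨w', a', y', -, H'⟩ := hI.exists_arrow_of_not_truncated hV ht'
        (congrArg (of I) he.symm)
      rw [← hI.map_cycle hG1 H, ← hI.map_cycle hG1 H', ← map_sub, hG]
      exact hC.sub_mem hK ⟨_, H⟩ ⟨_, H'⟩
    | trunc h h' he hne ht ht' =>
      obtain ⟨w, a, y, ha, H⟩ := hI.exists_arrow_of_not_truncated hV ht rfl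
      have e : (gentleGraph I).arr k h = G (arrow k a) := by rw [hG1, ha]
      rw [← hI.map_cycle hG1 H, e, ← map_mul, hG]
      exact (hC.isMaximalPath_of_cycle hK ⟨_, H⟩).2.2 _ _
    | zero h h' he hne ht ht' =>
      obtain ⟨w, a, y, ha, H⟩ := hI.exists_arrow_of_not_truncated hV ht rfl
      obtain ⟨w', b, y', hb, H'⟩ := hI.exists_arrow_of_not_truncated hV ht'
        (v := w) (he.trans H.rotate_one.edge_eq)
      rw [← ha, ← hb, ← hG1, ← hG1, ← map_mul, hG]
      by_contra hab
      rw [hI.mul_notMem_iff_next hK hV, ha, hb] at hab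
      exact hne hab
  have := key hx
  rwa [TwoSidedIdeal.mem_comap, hG] at this

/-- Both algebras are quotients of the path algebra of `Q_E` by the radical of the same trace form.
-/
theorem nonempty_algEquiv_brauerGraphAlgebra (hI : IsGentle I)
    (hV : ∀ v : V, Nonempty (Star v) ∨ Nonempty (Costar v)) :
    Nonempty (TrivialExtension k (BoundQuiverAlgebra I) ≃ₐ[k]
      (gentleGraph I).BrauerGraphAlgebra k) := by
  obtain ⟨φ, hφ⟩ := hI.exists_isCanonical
  obtain ⟨G, G', hGG', hG'G, -, hG1⟩ := hI.exists_algHom_brauerGraph hV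
  refine nonempty_algEquiv_of_ker_eq φ
    ((toBound (TwoSidedIdeal.span {x | (gentleGraph I).Rel k x})).comp G) (hφ.surjective hI)
    ((toBound_surjective _).comp fun x => ⟨G' x, hGG' x⟩) fun x => ?_
  rw [← TwoSidedIdeal.mem_ker, AlgHom.comp_apply, toBound_eq_zero_iff]
  exact ⟨hI.map_mem_span_rel (hφ.mem_ker_iff hI) hV hG1,
    hI.mem_of_map_mem_span_rel (hφ.mem_ker_iff hI) hV hG1 hG'G⟩

end IsGentle

end GentleGraph

end Gentle
end

noncomputable section
namespace Gentle
open Quiver MulOpposite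
open PathAlgebra

/-! ### The graph of the trivial extension -/

section GraphIso

variable {k : Type w} {V : Type u} [Field k] [Quiver.{v} V] [Fintype V]
  {I : TwoSidedIdeal (PathAlgebra k V)}

open ExtendedQuiver

theorem closedPathPow_comp {W : Type u} [Quiver.{v} W] {i : W} (c : Path i i) (n : ℕ) :
    c.comp (closedPathPow c n) = (closedPathPow c n).comp c := by
  induction n with
  | zero => simp [closedPathPow]
  | succ n ih => rw [closedPathPow, ← Path.comp_assoc, ih]

theorem length_closedPathPow {W : Type u} [Quiver.{v} W] {i : W} (c : Path i i) (n : ℕ) :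
    (closedPathPow c n).length = n * c.length := by
  induction n with
  | zero => simp [closedPathPow]
  | succ n ih => rw [closedPathPow, Path.length_comp, ih, add_mul, one_mul]

theorem iterate_finRotate_eq {α : Type*} (f : α → α) {x : α} {N : ℕ} (hx : f^[N] x = x)
    (t : Fin N) : f^[finRotate N t] x = f (f^[t] x) := by
  rw [← Function.iterate_succ_apply' f]
  cases N with
  | zero => exact t.elim0
  | succ n =>
    obtain ⟨t, ht⟩ := t
    rcases (Nat.lt_succ_iff.1 ht).lt_or_eq with h | rfl
    · rw [finRotate_of_lt h]
    · rw [finRotate_last']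
      exact hx.symm

theorem iterate_next_eq_self_iff (h : (gentleGraph I).HalfEdge) (n : ℕ) :
    (gentleGraph I).next^[n] h = h ↔ h.1.1.2.2.length + 1 ∣ n := by
  rw [← minimalPeriod_next]
  exact Function.isPeriodicPt_iff_minimalPeriod_dvd

theorem iterate_next_injOn (h : (gentleGraph I).HalfEdge) {n n' : ℕ}
    (hn : n < h.1.1.2.2.length + 1) (hn' : n' < h.1.1.2.2.length + 1)
    (e : (gentleGraph I).next^[n] h = (gentleGraph I).next^[n'] h) : n = n' := by
  rw [← minimalPeriod_next] at hn hn'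
  exact Function.iterate_injOn_Iio_minimalPeriod hn hn' e

theorem halfEdge_eq_of_length_eq_zero {h h' : (gentleGraph I).HalfEdge} (e : h.1 = h'.1)
    (hl : h.1.1.2.2.length = 0) : h = h' := by
  obtain ⟨m, i⟩ := h
  obtain ⟨m', i'⟩ := h'
  obtain rfl : m = m' := e
  have h1 := i.isLt
  have h2 := i'.isLt
  dsimp only at hl
  exact congrArg (Sigma.mk m) (Fin.ext (by omega))

/-- A cyclic path at a vertex of `Q_E` starts at a half-edge of `Γ_A`: it is a cycle of `Q_E`, or it
is trivial and its half-edge is the one at the trivial maximal path. -/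
def CyclicAt (c : Σ v : ExtendedQuiver I, Path v v) (h : (gentleGraph I).HalfEdge) : Prop :=
  CycleAt I c.1 c.2 h ∨
    (c.2.length = 0 ∧ h.1.1 = ⟨(of I).symm c.1, (of I).symm c.1, Path.nil⟩)

namespace CyclicAt

theorem length_eq_zero {c : Σ v : ExtendedQuiver I, Path v v} {h : (gentleGraph I).HalfEdge}
    (e : h.1.1 = ⟨(of I).symm c.1, (of I).symm c.1, Path.nil⟩) : h.1.1.2.2.length = 0 := by
  rw [e]; rfl

theorem edge_eq_of_trivial {c : Σ v : ExtendedQuiver I, Path v v} {h : (gentleGraph I).HalfEdge}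
    (e : h.1.1 = ⟨(of I).symm c.1, (of I).symm c.1, Path.nil⟩) :
    of I ((gentleGraph I).edge h) = c.1 := by
  obtain ⟨⟨x, hx⟩, n, hn⟩ := h
  dsimp only at e
  subst e
  obtain rfl : n = 0 := Nat.lt_one_iff.1 hn
  rfl

end CyclicAt

namespace IsGentle

theorem cycleAt_halfEdge_unique (hI : IsGentle I) {v : ExtendedQuiver I} {c : Path v v}
    {h h' : (gentleGraph I).HalfEdge} (H : CycleAt I v c h) (H' : CycleAt I v c h') : h = h' := by
  have hl := H.length_eq
  rcases cases_left c with ⟨_, rfl⟩ | ⟨l, a, y, rfl⟩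
  · simp at hl
  · exact (hI.arrowHalfEdge_eq H).symm.trans (hI.arrowHalfEdge_eq H')

theorem cyclicAt_halfEdge_unique (hI : IsGentle I) {c : Σ v : ExtendedQuiver I, Path v v}
    {h h' : (gentleGraph I).HalfEdge} (H : CyclicAt c h) (H' : CyclicAt c h') : h = h' := by
  rcases H with H | ⟨H1, H2⟩
  · rcases H' with H' | ⟨H1', H2'⟩
    · exact hI.cycleAt_halfEdge_unique H H'
    · rw [H.length_eq] at H1'
      omega
  · rcases H' with H' | ⟨H1', H2'⟩
    · rw [H'.length_eq] at H1
      omega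
    · exact halfEdge_eq_of_length_eq_zero (Subtype.ext (H2.trans H2'.symm))
        (CyclicAt.length_eq_zero H2)

/-- If `c` is the power of `d` with exponent `n + 1`, rotation by the first `n` factors fixes `c`
but moves its half-edge by `n` times the length of `d`. As `c` determines its half-edge, the length
of `c` divides this smaller number, so `n = 0`. -/
theorem pathMult_eq_one_of_cycleAt (hI : IsGentle I) {v : ExtendedQuiver I} {c : Path v v}
    {h : (gentleGraph I).HalfEdge} (H : CycleAt I v c h) : pathMult c = 1 := by
  have hl := H.length_eq
  have hs : {m : ℕ | ∃ d : Path v v, c = closedPathPow d m} = {1} := by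
    ext m
    rw [Set.mem_ofPred_eq, Set.mem_singleton_iff]
    constructor
    · rintro ⟨d, rfl⟩
      cases m with
      | zero => simp [closedPathPow] at hl
      | succ n =>
        have H' : CycleAt I v (d.comp (closedPathPow d n)) _ := CycleAt.rotate H
        rw [closedPathPow_comp] at H'
        have h1 := (iterate_next_eq_self_iff h _).1 (hI.cycleAt_halfEdge_unique H' H)
        rw [← hl, length_closedPathPow, length_closedPathPow] at h1
        rw [length_closedPathPow] at hl
        have hd : 0 < d.length := Nat.pos_of_ne_zero fun h0 => by simp [h0] at hl
        have h2 := Nat.eq_zero_of_dvd_of_lt h1 (Nat.mul_lt_mul_of_pos_right n.lt_succ_self hd)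
        rcases Nat.mul_eq_zero.1 h2 with h3 | h3 <;> omega
    · rintro rfl
      exact ⟨c, by simp [closedPathPow]⟩
  rw [pathMult, if_neg (by omega), hs, csSup_singleton]

theorem pathMult_eq_one (hI : IsGentle I) {c : Σ v : ExtendedQuiver I, Path v v}
    {h : (gentleGraph I).HalfEdge} (H : CyclicAt c h) : pathMult c.2 = 1 := by
  rcases H with H | ⟨H, -⟩
  · exact hI.pathMult_eq_one_of_cycleAt H
  · rw [pathMult, if_pos H]

theorem muLength_eq (hI : IsGentle I) {c : Σ v : ExtendedQuiver I, Path v v}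
    {h : (gentleGraph I).HalfEdge} (H : CyclicAt c h) : muLength c.2 = h.1.1.2.2.length + 1 := by
  rw [muLength, hI.pathMult_eq_one H, Nat.div_one]
  rcases H with H | ⟨H1, H2⟩
  · rw [H.length_eq, if_neg (by omega)]
  · rw [if_pos H1, CyclicAt.length_eq_zero H2]

theorem vertexAt_eq {c : Σ v : ExtendedQuiver I, Path v v}
    {h : (gentleGraph I).HalfEdge} (H : CyclicAt c h) {n : ℕ} (hn : n < h.1.1.2.2.length + 1) :
    vertexAt c.2 n = of I ((gentleGraph I).edge ((gentleGraph I).next^[n] h)) := by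
  obtain ⟨v, c⟩ := c
  rcases H with H | ⟨H1, H2⟩
  · obtain ⟨x, p, q, hc, rfl⟩ := exists_comp_of_length_le c (n := n) (by rw [H.length_eq]; omega)
    dsimp only at hc H ⊢
    subst hc
    rw [vertexAt_length_comp, H.rotate.edge_eq]
  · rw [CyclicAt.length_eq_zero H2] at hn
    obtain rfl : n = 0 := by omega
    rw [vertexAt_zero]
    exact (CyclicAt.edge_eq_of_trivial H2).symm

variable {K : TwoSidedIdeal (PathAlgebra k (ExtendedQuiver I))}

/-- Non-trivial maximal paths modulo `K` are cycles. A trivial one stands where the projective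
module is uniserial, hence where one arrow starts and a trivial maximal path exists. -/
theorem exists_cyclicAt (hI : IsGentle I)
    (hK : ∀ x, x ∈ K ↔ ∀ y, cycleTrace k (extendedCycle I) (x * y) = 0)
    (hV : ∀ v : V, Nonempty (Star v) ∨ Nonempty (Costar v)) (y : MaximalCyclicPath K) :
    ∃ h, CyclicAt y.1 h := by
  obtain ⟨⟨v, c⟩, ⟨h1, h2⟩ | ⟨h1, h2⟩⟩ := y
  · obtain ⟨_, h, H⟩ := CycleSystem.cycle_of_isMaximalPath hK h2
    exact ⟨h, Or.inl H⟩
  · have h3 := (hI.subsingleton_star_iff hV ((of I).symm v)).1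
      (((hI.cycleSystem hV).isUniserialAt_iff hK v).1 h2)
    exact ⟨⟨⟨⟨(of I).symm v, (of I).symm v, Path.nil⟩, Or.inr ⟨_, rfl, h3⟩⟩, 0⟩, Or.inr ⟨h1, rfl⟩⟩

theorem exists_maximalCyclicPath (hI : IsGentle I)
    (hK : ∀ x, x ∈ K ↔ ∀ y, cycleTrace k (extendedCycle I) (x * y) = 0)
    (hV : ∀ v : V, Nonempty (Star v) ∨ Nonempty (Costar v)) (h : (gentleGraph I).HalfEdge) :
    ∃ y : MaximalCyclicPath K, CyclicAt y.1 h := by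
  rcases h.1.2 with hm | ⟨i, he, ht⟩
  · obtain ⟨c, H⟩ := exists_isCycleAt h hm rfl
    have hl := length_of_isCycleAt H
    exact ⟨⟨⟨of I _, c⟩, Or.inl ⟨by dsimp only; omega,
      (hI.cycleSystem hV).isMaximalPath_of_cycle hK ⟨h, H⟩⟩⟩, Or.inl H⟩
  · exact ⟨⟨⟨of I i, Path.nil⟩, Or.inr ⟨rfl, ((hI.cycleSystem hV).isUniserialAt_iff hK _).2
      ((hI.subsingleton_star_iff hV i).2 ht)⟩⟩, Or.inr ⟨rfl, he⟩⟩

theorem exists_cyclicAt_of_isRotation {c c' : Σ v : ExtendedQuiver I, Path v v}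
    (hr : IsRotation c c') {h : (gentleGraph I).HalfEdge} (H : CyclicAt c h) :
    ∃ h', h'.1 = h.1 ∧ CyclicAt c' h' := by
  obtain ⟨v, w, p, q, rfl, rfl⟩ := hr
  rcases H with H | ⟨H1, H2⟩
  · exact ⟨_, gentleGraph_vert_iterate _ h, Or.inl (CycleAt.rotate H)⟩
  · dsimp only at H1 H2
    rw [Path.length_comp] at H1
    obtain rfl : v = w := Path.eq_of_length_zero p (by omega)
    refine ⟨h, rfl, Or.inr ⟨?_, H2⟩⟩
    dsimp only
    rw [Path.length_comp]
    omega

/-- Two half-edges at the same vertex differ by an iterate of the successor map, which is a rotation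
on cycles. Lengths separate cycles from trivial paths. -/
theorem isRotation_of_cyclicAt (hI : IsGentle I)
    (hV : ∀ v : V, Nonempty (Star v) ∨ Nonempty (Costar v))
    {c c' : Σ v : ExtendedQuiver I, Path v v} {h h' : (gentleGraph I).HalfEdge} (e : h.1 = h'.1)
    (H : CyclicAt c h) (H' : CyclicAt c' h') : IsRotation c c' := by
  obtain ⟨v, c⟩ := c
  obtain ⟨v', c'⟩ := c'
  rcases H with H | ⟨H1, H2⟩
  · have hpos := hI.length_pos_of_isMaximalPath hV H.isMaximalPath
    rw [e] at hpos
    rcases H' with H' | ⟨H1', H2'⟩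
    · obtain ⟨n, hn, rfl⟩ := exists_iterate_next_eq e
      obtain ⟨x, p, q, hc, rfl⟩ := exists_comp_of_length_le c (n := n) (by rw [H.length_eq]; omega)
      dsimp only at hc H H'
      subst hc
      have H'' := H.rotate
      obtain rfl : x = v' := H''.edge_eq.symm.trans H'.edge_eq
      obtain rfl := H''.unique H'
      exact ⟨v, x, p, q, rfl, rfl⟩
    · rw [CyclicAt.length_eq_zero H2'] at hpos
      omega
  · rcases H' with H' | ⟨H1', H2'⟩
    · have hpos := hI.length_pos_of_isMaximalPath hV H'.isMaximalPath
      rw [← e, CyclicAt.length_eq_zero H2] at hpos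
      omega
    · obtain rfl : v = v' := congrArg Sigma.fst (H2.symm.trans ((congrArg Subtype.val e).trans H2'))
      obtain rfl := Path.eq_nil_of_length_zero c H1
      obtain rfl := Path.eq_nil_of_length_zero c' H1'
      exact ⟨v, v, Path.nil, Path.nil, rfl, rfl⟩

theorem exists_iso (hI : IsGentle I)
    (hK : ∀ x, x ∈ K ↔ ∀ y, cycleTrace k (extendedCycle I) (x * y) = 0)
    (hV : ∀ v : V, Nonempty (Star v) ∨ Nonempty (Costar v)) :
    ∃ F : (gentleGraph I).Iso (symmetricSpecialBiserialGraph K), F.onEdges = of I := by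
  choose H hH using hI.exists_cyclicAt hK hV
  let f : RotationClass K → ExtMaximalPath I := fun x => (H x.rep).1
  have hf : ∀ y, f (Quot.mk _ y) = (H y).1 := by
    intro y
    -- The map `f` uses the chosen representative. Its agreement with the rotation-invariant `g`
    -- allows evaluation at any path of the class.
    let g : RotationClass K → ExtMaximalPath I := Quot.lift (fun y => (H y).1) fun y y' hy => by
      obtain ⟨h', h1, h2⟩ := exists_cyclicAt_of_isRotation hy (hH y)
      rw [← h1, hI.cyclicAt_halfEdge_unique h2 (hH y')]
    have h1 : ∀ x, f x = g x := fun x => congrArg g (Quot.out_eq x)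
    exact h1 _
  have hf1 : Function.Injective f := fun x x' hx => by
    rw [← Quot.out_eq x, ← Quot.out_eq x']
    exact Quot.sound (hI.isRotation_of_cyclicAt hV hx (hH x.rep) (hH x'.rep))
  have hf2 : Function.Surjective f := fun m => by
    obtain ⟨y, hy⟩ := hI.exists_maximalCyclicPath hK hV ⟨m, 0⟩
    refine ⟨Quot.mk _ y, (hf y).trans ?_⟩
    rw [hI.cyclicAt_halfEdge_unique (hH y) hy]
  -- Position `n` on the representative goes to the `n`-th successor of the half-edge at which it
  -- starts.
  let G : (symmetricSpecialBiserialGraph K).HalfEdge → (gentleGraph I).HalfEdge := fun t =>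
    (gentleGraph I).next^[t.2] (H t.1.rep)
  have hlen : ∀ x : RotationClass K, muLength x.rep.1.2 = (H x.rep).1.1.2.2.length + 1 := fun x =>
    hI.muLength_eq (hH x.rep)
  have hvert : ∀ t, (G t).1 = f t.1 := fun t => gentleGraph_vert_iterate _ _
  have hG1 : Function.Injective G := by
    rintro ⟨x, t⟩ ⟨x', t'⟩ h
    obtain rfl : x' = x :=
      hf1 ((hvert ⟨x', t'⟩).symm.trans ((congrArg Sigma.fst h.symm).trans (hvert ⟨x, t⟩)))
    exact congrArg (Sigma.mk x') (Fin.ext (iterate_next_injOn _ (t.isLt.trans_eq (hlen x'))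
      (t'.isLt.trans_eq (hlen x')) h))
  have hG2 : Function.Surjective G := by
    intro h
    obtain ⟨x, hx⟩ := hf2 h.1
    obtain ⟨n, hn, h1⟩ := exists_iterate_next_eq (h := H x.rep) (h' := h) hx
    exact ⟨⟨x, ⟨n, hn.trans_eq (hlen x).symm⟩⟩, h1⟩
  have hnext : ∀ t, (gentleGraph I).next (G t) = G ((symmetricSpecialBiserialGraph K).next t) := by
    rintro ⟨x, t⟩
    exact (iterate_finRotate_eq _ (by rw [hlen]; exact (iterate_next_eq_self_iff _ _).2 dvd_rfl) t).symm
  let eF := Equiv.ofBijective f ⟨hf1, hf2⟩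
  let eG := Equiv.ofBijective G ⟨hG1, hG2⟩
  have hs : ∀ t, eG.symm (G t) = t := eG.symm_apply_apply
  -- The maps `f` and `G` lead from the graph of the presentation to `Γ_A`, so their inverses give
  -- the isomorphism.
  refine ⟨⟨eF.symm, of I, eG.symm, fun h => ?_, fun h => ?_, fun h => ?_, fun m => ?_⟩, rfl⟩
  · obtain ⟨t, rfl⟩ := hG2 h
    exact (congrArg (symmetricSpecialBiserialGraph K).vert (hs t)).trans
      ((eF.symm_apply_apply t.1).symm.trans (congrArg eF.symm (hvert t).symm))
  · obtain ⟨t, rfl⟩ := hG2 h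
    exact (congrArg (symmetricSpecialBiserialGraph K).edge (hs t)).trans
      (vertexAt_eq (hH t.1.rep) (t.2.isLt.trans_eq (hlen t.1)))
  · obtain ⟨t, rfl⟩ := hG2 h
    exact (congrArg (symmetricSpecialBiserialGraph K).next (hs t)).trans
      ((hs _).symm.trans (congrArg eG.symm (hnext t).symm))
  · exact hI.pathMult_eq_one (hH _)

end IsGentle

end GraphIso

end Gentle
end

open Gentle in
theorem theorem1p2 {k : Type w} [Field k] [IsAlgClosed k] {V : Type u} [Fintype V] [Quiver.{v} V]
    (hconn : Subsingleton (Quiver.WeaklyConnectedComponent V))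
    (harrow : ∃ i j : V, Nonempty (i ⟶ j))
    (I : TwoSidedIdeal (PathAlgebra k V)) (hI : IsGentle I) :
    (gentleGraph I).IsBrauerGraph ∧
    Nonempty (TrivialExtension k (BoundQuiverAlgebra I) ≃ₐ[k]
      (gentleGraph I).BrauerGraphAlgebra k) ∧
    ∃ φ : PathAlgebra k (ExtendedQuiver I) →ₐ[k] TrivialExtension k (BoundQuiverAlgebra I),
      IsCanonical I φ ∧ Function.Surjective φ ∧
      IsSymmetricSpecialBiserial (TwoSidedIdeal.ker φ) ∧
      ∃ F : (gentleGraph I).Iso (symmetricSpecialBiserialGraph (TwoSidedIdeal.ker φ)),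
        F.onEdges = ExtendedQuiver.of I := by
  have hV := nonempty_star_or_costar hconn harrow
  obtain ⟨φ, hφ⟩ := hI.exists_isCanonical
  exact ⟨hI.isBrauerGraph hconn harrow, hI.nonempty_algEquiv_brauerGraphAlgebra hV, φ, hφ,
    hφ.surjective hI, (hI.cycleSystem hV).isSymmetricSpecialBiserial (hφ.mem_ker_iff hI)
      (hI.card_star_extendedQuiver_le hV), hI.exists_iso (hφ.mem_ker_iff hI) hV⟩
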